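/- Let $d,n\ge 1$. For an integrable function $f:\mathbb{R}^d\to[0,\infty)$ with $\int f>0$ let $$[\mathrm{Cov}(f)]_{ij}=\frac{\int x_ix_jf}{\int f}-\frac{\int x_if\,\int x_jf}{(\int f)^2},\qquad \sigma_f:=\det(\mathrm{Cov}(f))^{1/(2d)},$$ and for $K\ge 0$ call $f$ almost isotropic with constant $K$ if $|\mathrm{Cov}(f)_{ii}-\sigma_f^2|\le K\sigma_f$ for all $i$ and $|\mathrm{Cov}(f)_{ij}|\le K\sigma_f$ for all $i\ne j$. A function $f:\mathbb{R}^d\to[0,\infty)$ is a log-concave extension of $p:\mathbb{Z}^d\to[0,1]$ if $f=e^{-V}$ with $V:\mathbb{R}^d\to\mathbb{R}\cup\{+\infty\}$ convex, and $f(k)=p(k)$ for all $k\in\mathbb{Z}^d$. There is a constant $C=C(d,n)>0$ such that for every $K$ there is $N=N(d,n,K)$ with the following property. Let $X_1,\dots,X_n$ be i.i.d. random vectors on $\mathbb{Z}^d$ such that the probability mass function of $S_n=X_1+\cdots+X_n$ has a log-concave extension $f$ which is almost isotropic with constant $K$ and has $\sigma_f\ge N$. Let $U_1,\dots,U_n$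 be i.i.d. uniform on $[0,1]^d$, independent of $X_1,\dots,X_n$. Then the Shannon entropies $H(X_1)$ and $H(S_n)$ (natural logarithms) and the differential entropy $h(S_n+U_1+\cdots+U_n)$ are well defined and finite, and $$\bigl|h(S_n+U_1+\cdots+U_n)-H(S_n)\bigr|\le C\,H(X_1)\,e^{-H(X_1)/d}.$$ Moreover, with $\sigma:=\det(\mathrm{Cov}(X_1))^{1/(2d)}$, $$\bigl|h(S_n+U_1+\cdots+U_n)-H(S_n)\bigr|\le C\,\frac{\log\sigma}{\sigma}.$$ In particular the difference tends to $0$ as $H(X_1)\to\infty$ within this regime. -/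

import Mathlib

open MeasureTheory ProbabilityTheory

noncomputable section

namespace DiscreteEntropy

/-- `f = exp (-V)` for a convex function `V : ℝ^d → ℝ ∪ {+∞}`. The set `D` is the effective domain
`{V < +∞}`, so that `f` vanishes off `D`; `ConvexOn` contains the convexity of `D`. -/
def IsLogConcave {d : ℕ} (f : (Fin d → ℝ) → ℝ) : Prop :=
  ∃ (D : Set (Fin d → ℝ)) (V : (Fin d → ℝ) → ℝ),
    ConvexOn ℝ D V ∧ f = D.indicator fun x => Real.exp (-V x)

/-- `f` is a log-concave extension to `ℝ^d` of the function `p` on `ℤ^d`. -/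
def IsLogConcaveExtension {d : ℕ} (p : (Fin d → ℤ) → ℝ) (f : (Fin d → ℝ) → ℝ) : Prop :=
  IsLogConcave f ∧ ∀ k : Fin d → ℤ, f (fun i => (k i : ℝ)) = p k

/-- The covariance matrix of a nonnegative function on `ℝ^d`. -/
def covMatrix {d : ℕ} (f : (Fin d → ℝ) → ℝ) : Matrix (Fin d) (Fin d) ℝ :=
  Matrix.of fun i j =>
    (∫ x, x i * x j * f x) / (∫ x, f x) -
      ((∫ x, x i * f x) * (∫ x, x j * f x)) / (∫ x, f x) ^ 2

/-- The covariance matrix of a nonnegative function on `ℤ^d`. -/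
def discreteCovMatrix {d : ℕ} (p : (Fin d → ℤ) → ℝ) : Matrix (Fin d) (Fin d) ℝ :=
  Matrix.of fun i j =>
    (∑' k : Fin d → ℤ, (k i : ℝ) * (k j : ℝ) * p k) / (∑' k, p k) -
      ((∑' k : Fin d → ℤ, (k i : ℝ) * p k) * (∑' k : Fin d → ℤ, (k j : ℝ) * p k)) /
        (∑' k, p k) ^ 2

/-- The parameter `σ = det(A)^(1/(2d))` of a `d × d` covariance matrix `A`. -/
def scale {d : ℕ} (A : Matrix (Fin d) (Fin d) ℝ) : ℝ :=
  A.det ^ (1 / (2 * (d : ℝ)))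

/-- Almost isotropy with implied constant `K`: with `σ = det(Cov f)^(1/(2d))`, the diagonal entries
of `Cov f` are within `K σ` of `σ ^ 2` and the other entries are within `K σ` of `0`. -/
structure IsAlmostIsotropic {d : ℕ} (K : ℝ) (f : (Fin d → ℝ) → ℝ) : Prop where
  integrable : Integrable f
  diag : ∀ i, |covMatrix f i i - scale (covMatrix f) ^ 2| ≤ K * scale (covMatrix f)
  offDiag : ∀ i j, i ≠ j → |covMatrix f i j| ≤ K * scale (covMatrix f)

/-- The probability mass function of a random vector `X` on `ℤ^d`. -/
def pmf {Ω : Type*} [MeasurableSpace Ω] {d : ℕ} (P : Measure Ω) (X : Ω → Fin d → ℤ) :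
    (Fin d → ℤ) → ℝ :=
  fun k => (P.map X).real {k}

/-- The Shannon entropy `-∑ p log p` (natural logarithm) of a random vector on `ℤ^d`. -/
def shannonEntropy {Ω : Type*} [MeasurableSpace Ω] {d : ℕ} (P : Measure Ω)
    (X : Ω → Fin d → ℤ) : ℝ :=
  ∑' k, Real.negMulLog (pmf P X k)

/-- The series defining the Shannon entropy converges. -/
def HasShannonEntropy {Ω : Type*} [MeasurableSpace Ω] {d : ℕ} (P : Measure Ω)
    (X : Ω → Fin d → ℤ) : Prop :=
  Summable fun k => Real.negMulLog (pmf P X k)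

/-- The differential entropy `-∫ g log g` of a random vector in `ℝ^d` with Lebesgue density `g`. -/
def differentialEntropy {Ω : Type*} [MeasurableSpace Ω] {d : ℕ} (P : Measure Ω)
    (Y : Ω → Fin d → ℝ) : ℝ :=
  ∫ x, Real.negMulLog (pdf Y P volume x).toReal

/-- `Y` has a Lebesgue density, and the integral defining its differential entropy converges. -/
def HasDifferentialEntropy {Ω : Type*} [MeasurableSpace Ω] {d : ℕ} (P : Measure Ω)
    (Y : Ω → Fin d → ℝ) : Prop :=
  HasPDF Y P volume ∧ Integrable fun x => Real.negMulLog (pdf Y P volume x).toReal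

/-- The sum `X₁ + ⋯ + Xₙ`. -/
def latticeSum {Ω : Type*} {d n : ℕ} (X : Fin n → Ω → Fin d → ℤ) : Ω → Fin d → ℤ :=
  fun ω => ∑ i, X i ω

/-- The sum `X₁ + ⋯ + Xₙ + U₁ + ⋯ + Uₙ`, as a random vector in `ℝ^d`. -/
def smoothedSum {Ω : Type*} {d n : ℕ} (X : Fin n → Ω → Fin d → ℤ) (U : Fin n → Ω → Fin d → ℝ) :
    Ω → Fin d → ℝ :=
  fun ω j => (latticeSum X ω j : ℝ) + ∑ i, U i ω j

end DiscreteEntropy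

end

/-!
The density of `X₁ + ⋯ + Xₙ + U₁ + ⋯ + Uₙ` arises from the mass function `p` of `X₁ + ⋯ + Xₙ` by a
partition of unity: at every point it averages values of `p` at nearby lattice points. Hence the two
entropies differ by at most a multiple of the total variation of `p` in the coordinate directions.
On a lattice line `p` is unimodal, being the restriction of a log-concave function, so its variation
there is at most a multiple of its maximum. A log-concave function whose covariance matrix is
comparable to `s ^ 2` is at least a multiple of its maximum on a cube of radius of order `s`, and
halves at distance of order `s` from a suitable center, so that `p` is at most
`A / s ^ d * exp (-b * |k - c| / s)`; summing over the `O(s ^ (d - 1))` lines that matter, the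
variation is `O(1 / s)`. The same decay gives `H(X₁) ≤ d * log s + O(1)` and
`det (Cov X₁) ^ (1 / (2 * d)) ≍ s`, which turn `1 / s` into the stated rates.
-/

namespace DiscreteEntropy

section ConvexSets

variable {E : Type*} [NormedAddCommGroup E] [NormedSpace ℝ E]

theorem closedBall_midpoint_subset {s : Set E} (hs : Convex ℝ s) {x z : E} (hx : x ∈ s) {ε : ℝ}
    (hz : Metric.closedBall z ε ⊆ s) : Metric.closedBall (midpoint ℝ x z) (ε / 2) ⊆ s := by
  intro y hy
  set y' := (2 : ℝ) • y - x with y'_def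
  have hy' : y' - z = (2 : ℝ) • (y - midpoint ℝ x z) := by
    rw [y'_def, midpoint_eq_smul_add, invOf_eq_inv, smul_sub, smul_inv_smul₀ two_ne_zero, sub_sub]
  have hmid : midpoint ℝ x y' = y := by
    rw [midpoint_eq_smul_add, invOf_eq_inv, add_sub_cancel, inv_smul_smul₀ two_ne_zero]
  refine hmid ▸ hs.midpoint_mem hx (hz ?_)
  rw [mem_closedBall_iff_norm] at hy ⊢
  rw [hy', norm_smul, Real.norm_two]
  linarith

theorem isBounded_of_convex_of_measure_ne_top [FiniteDimensional ℝ E] [MeasurableSpace E]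
    [BorelSpace E] (μ : Measure E) [μ.IsAddHaarMeasure] {s : Set E} (hs : Convex ℝ s)
    (hint : (interior s).Nonempty) (hμ : μ s ≠ ⊤) : Bornology.IsBounded s := by
  obtain ⟨z, hz⟩ := hint
  obtain ⟨ε, hε, hball⟩ := Metric.nhds_basis_closedBall.mem_iff.1 (mem_interior_iff_mem_nhds.1 hz)
  set m := μ (Metric.closedBall (0 : E) (ε / 2))
  have hm : m ≠ 0 := (Metric.measure_closedBall_pos μ _ (by positivity)).ne'
  have : IsFiniteMeasure (μ.restrict s) := isFiniteMeasure_restrict.2 hμ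
  obtain ⟨T, hT, hTm⟩ := isTightMeasureSet_iff_exists_isCompact_measure_compl_le.1
    (isTightMeasureSet_singleton (μ := μ.restrict s)) (m / 2) (ENNReal.half_pos hm)
  have hlt : μ.restrict s Tᶜ < m :=
    (hTm _ rfl).trans_lt (ENNReal.half_lt_self hm measure_closedBall_lt_top.ne)
  -- The half-size ball around `midpoint ℝ x z` lies in `s`, so it is too heavy to avoid `T`.
  have hmeet : ∀ x ∈ s, (Metric.closedBall (midpoint ℝ x z) (ε / 2) ∩ T).Nonempty := by
    intro x hx
    by_contra hdisj
    have hsub : Metric.closedBall (midpoint ℝ x z) (ε / 2) ⊆ Tᶜ ∩ s :=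
      Set.subset_inter (fun y hy hyT => hdisj ⟨y, hy, hyT⟩) (closedBall_midpoint_subset hs hx hball)
    refine hlt.not_ge ?_
    calc m = μ (Metric.closedBall (midpoint ℝ x z) (ε / 2)) :=
          (Measure.addHaar_closedBall_center μ _ _).symm
      _ ≤ μ (Tᶜ ∩ s) := measure_mono hsub
      _ ≤ μ.restrict s Tᶜ := Measure.le_restrict_apply _ _
  obtain ⟨R, hR⟩ := hT.isBounded.subset_closedBall z
  refine (Metric.isBounded_closedBall (x := z) (r := ε + 2 * R)).subset fun x hx => ?_
  obtain ⟨y, hy, hyT⟩ := hmeet x hx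
  have hdist : dist (midpoint ℝ x z) z = dist x z / 2 := by
    rw [dist_midpoint_right, Real.norm_two, inv_mul_eq_div]
  have htri := dist_triangle_left (midpoint ℝ x z) z y
  rw [Metric.mem_closedBall] at hy ⊢
  linarith [Metric.mem_closedBall.1 (hR hyT)]

end ConvexSets

section Midpoint

variable {E F : Type*} [NormedAddCommGroup E] [NormedSpace ℝ E] [FiniteDimensional ℝ E]
  [MeasurableSpace E] [BorelSpace E] {μ : Measure E} [μ.IsAddHaarMeasure] [NormedAddCommGroup F]

theorem integrable_comp_midpoint {f : E → F} (hf : Integrable f μ) (z : E) :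
    Integrable (fun x => f (midpoint ℝ x z)) μ := by
  simp_rw [midpoint_eq_smul_add, invOf_eq_inv]
  exact (hf.comp_smul (by norm_num : (2⁻¹ : ℝ) ≠ 0)).comp_add_right z

theorem integral_comp_midpoint [NormedSpace ℝ F] (f : E → F) (z : E) :
    ∫ x, f (midpoint ℝ x z) ∂μ = (2 : ℝ) ^ Module.finrank ℝ E • ∫ x, f x ∂μ := by
  simp_rw [midpoint_eq_smul_add, invOf_eq_inv]
  rw [integral_add_right_eq_self (fun x => f ((2⁻¹ : ℝ) • x)) z, Measure.integral_comp_smul]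
  simp

end Midpoint

section LogConcave

variable {d : ℕ} {f : (Fin d → ℝ) → ℝ}

theorem IsLogConcave.nonneg (hf : IsLogConcave f) (x : Fin d → ℝ) : 0 ≤ f x := by
  obtain ⟨D, V, -, rfl⟩ := hf
  exact Set.indicator_nonneg (fun _ _ => (Real.exp_pos _).le) x

theorem IsLogConcave.rpow_mul_rpow_le (hf : IsLogConcave f) {x y : Fin d → ℝ} (hx : 0 < f x)
    (hy : 0 < f y) {a b : ℝ} (ha : 0 ≤ a) (hb : 0 ≤ b) (hab : a + b = 1) :
    f x ^ a * f y ^ b ≤ f (a • x + b • y) := by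
  obtain ⟨D, V, hV, rfl⟩ := hf
  have hxD : x ∈ D := Set.mem_of_indicator_ne_zero hx.ne'
  have hyD : y ∈ D := Set.mem_of_indicator_ne_zero hy.ne'
  have hconv := hV.2 hxD hyD ha hb hab
  rw [smul_eq_mul, smul_eq_mul] at hconv
  rw [Set.indicator_of_mem hxD, Set.indicator_of_mem hyD,
    Set.indicator_of_mem (hV.1 hxD hyD ha hb hab), ← Real.exp_mul, ← Real.exp_mul, ← Real.exp_add,
    Real.exp_le_exp]
  linarith

theorem IsLogConcave.convex_superlevel (hf : IsLogConcave f) {t : ℝ} (ht : 0 < t) :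
    Convex ℝ {x | t ≤ f x} := by
  intro x hx y hy a b ha hb hab
  rw [Set.mem_ofPred_eq] at *
  calc t = t ^ a * t ^ b := by rw [← Real.rpow_add ht, hab, Real.rpow_one]
    _ ≤ f x ^ a * f y ^ b := by
        have := hf.nonneg x
        gcongr
    _ ≤ f (a • x + b • y) := hf.rpow_mul_rpow_le (ht.trans_le hx) (ht.trans_le hy) ha hb hab

theorem IsLogConcave.mul_le_sq_midpoint (hf : IsLogConcave f) (x y : Fin d → ℝ) :
    f x * f y ≤ f (midpoint ℝ x y) ^ 2 := by
  rcases (hf.nonneg x).eq_or_lt with hx | hx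
  · rw [← hx, zero_mul]
    positivity
  rcases (hf.nonneg y).eq_or_lt with hy | hy
  · rw [← hy, mul_zero]
    positivity
  have h := hf.rpow_mul_rpow_le hx hy (a := 1 / 2) (b := 1 / 2) (by norm_num) (by norm_num)
    (by norm_num)
  have hmid : (1 / 2 : ℝ) • x + (1 / 2 : ℝ) • y = midpoint ℝ x y := by
    rw [midpoint_eq_smul_add, smul_add, invOf_eq_inv, one_div]
  rw [hmid, ← Real.sqrt_eq_rpow, ← Real.sqrt_eq_rpow] at h
  calc f x * f y = (√(f x) * √(f y)) ^ 2 := by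
        rw [mul_pow, Real.sq_sqrt hx.le, Real.sq_sqrt hy.le]
    _ ≤ f (midpoint ℝ x y) ^ 2 := by gcongr

theorem IsLogConcave.le_mul_rpow_of_lineMap_le (hf : IsLogConcave f) {z x : Fin d → ℝ}
    (hz : 0 < f z) {κ t : ℝ} (hκ : 0 ≤ κ) (ht : 1 ≤ t)
    (h : f (AffineMap.lineMap z x t⁻¹) ≤ f z * κ) : f x ≤ f z * κ ^ t := by
  rcases (hf.nonneg x).eq_or_lt with hx | hx
  · rw [← hx]
    positivity
  have ht0 : 0 < t := by linarith
  have hratio : (f x / f z) ^ t⁻¹ ≤ κ := by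
    refine le_of_mul_le_mul_left ?_ hz
    calc f z * (f x / f z) ^ t⁻¹ = f z ^ (1 - t⁻¹) * f x ^ t⁻¹ := by
          rw [Real.rpow_sub hz, Real.div_rpow hx.le hz.le, Real.rpow_one]
          ring
      _ ≤ f (AffineMap.lineMap z x t⁻¹) := by
          rw [AffineMap.lineMap_apply_module]
          exact hf.rpow_mul_rpow_le hz hx (sub_nonneg.2 (inv_le_one_of_one_le₀ ht))
            (by positivity) (by ring)
      _ ≤ f z * κ := h
  calc f x = f z * ((f x / f z) ^ t⁻¹) ^ t := by
        rw [Real.rpow_inv_rpow (by positivity) ht0.ne', mul_div_cancel₀ _ hz.ne']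
    _ ≤ f z * κ ^ t := by gcongr

theorem sq_le_four_rpow {u : ℝ} (hu : 1 ≤ u) : u ^ 2 ≤ 4 ^ u := by
  have h2 : u ≤ 2 ^ u := by
    have := one_add_mul_self_le_rpow_one_add (s := 1) (by norm_num) hu
    norm_num at this
    linarith
  calc u ^ 2 ≤ ((2 : ℝ) ^ u) ^ 2 := by gcongr
    _ = 4 ^ u := by
        rw [← Real.rpow_mul_natCast (by norm_num), mul_comm, Real.rpow_natCast_mul (by norm_num)]
        norm_num

theorem IsLogConcave.sq_mul_le_midpoint (hf : IsLogConcave f) {x z : Fin d → ℝ} (hz : 0 < f z)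
    {u : ℝ} (hu : 1 ≤ u)
    (h : f (AffineMap.lineMap z (midpoint ℝ x z) u⁻¹) ≤ f z * 4⁻¹) :
    u ^ 2 * f x ≤ f (midpoint ℝ x z) := by
  set m := midpoint ℝ x z
  have hm : f m ≤ f z * 4⁻¹ ^ u := hf.le_mul_rpow_of_lineMap_le hz (by norm_num) hu h
  have hxm : f x ≤ f m * 4⁻¹ ^ u := by
    refine le_of_mul_le_mul_right ?_ hz
    calc f x * f z ≤ f m ^ 2 := hf.mul_le_sq_midpoint x z
      _ ≤ f m * (f z * 4⁻¹ ^ u) := by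
          rw [sq]
          have := hf.nonneg m
          gcongr
      _ = f m * 4⁻¹ ^ u * f z := by ring
  have hpow : u ^ 2 * (4⁻¹ : ℝ) ^ u ≤ 1 := by
    rw [Real.inv_rpow (by norm_num), ← div_eq_mul_inv, div_le_one (by positivity)]
    exact sq_le_four_rpow hu
  calc u ^ 2 * f x ≤ u ^ 2 * (f m * 4⁻¹ ^ u) := by gcongr
    _ = f m * (u ^ 2 * 4⁻¹ ^ u) := by ring
    _ ≤ f m := mul_le_of_le_one_right (hf.nonneg m) hpow

theorem IsLogConcave.seminorm_sq_mul_le (hf : IsLogConcave f) {z : Fin d → ℝ} (hz : 0 < f z)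
    (N : Seminorm ℝ (Fin d → ℝ)) {w : ℝ} (hw : 0 < w)
    (h : ∀ y, w ≤ N (y - z) → f y ≤ f z / 4) (x : Fin d → ℝ) :
    N (x - z) ^ 2 * f x ≤ 4 * w ^ 2 * (f x + f (midpoint ℝ x z)) := by
  have hx := hf.nonneg x
  have hm := hf.nonneg (midpoint ℝ x z)
  rcases le_or_gt (N (x - z)) (2 * w) with hle | hgt
  · calc N (x - z) ^ 2 * f x ≤ (2 * w) ^ 2 * f x := by gcongr
      _ = 4 * w ^ 2 * (f x + 0) := by ring
      _ ≤ 4 * w ^ 2 * (f x + f (midpoint ℝ x z)) := by gcongr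
  · set u := N (x - z) / (2 * w) with hu
    have hNu : N (x - z) = 2 * w * u := by rw [hu, mul_div_cancel₀ _ (by positivity)]
    have hu1 : 1 ≤ u := (one_le_div (by positivity)).2 hgt.le
    have hline : AffineMap.lineMap z (midpoint ℝ x z) u⁻¹ - z = (u⁻¹ * 2⁻¹ : ℝ) • (x - z) := by
      rw [AffineMap.lineMap_apply_module', add_sub_cancel_right, midpoint_sub_right, invOf_eq_inv,
        smul_smul]
    have hdrop : f (AffineMap.lineMap z (midpoint ℝ x z) u⁻¹) ≤ f z * 4⁻¹ := by
      refine h _ (le_of_eq ?_)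
      rw [hline, map_smul_eq_mul, Real.norm_of_nonneg (by positivity), hNu]
      field_simp
    calc N (x - z) ^ 2 * f x = 4 * w ^ 2 * (u ^ 2 * f x) := by rw [hNu]; ring
      _ ≤ 4 * w ^ 2 * (0 + f (midpoint ℝ x z)) := by
          rw [zero_add]
          gcongr
          exact hf.sq_mul_le_midpoint hz hu1 hdrop
      _ ≤ 4 * w ^ 2 * (f x + f (midpoint ℝ x z)) := by gcongr

theorem IsLogConcave.exists_interior_superlevel_nonempty (hf : IsLogConcave f)
    (hpos : 0 < ∫ x, f x) : ∃ t > 0, (interior {x | t ≤ f x}).Nonempty := by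
  obtain ⟨D, V, hV, rfl⟩ := hf
  obtain ⟨z, hz⟩ : (interior D).Nonempty := by
    by_contra! hempty
    have hD : volume D = 0 := by
      refine measure_mono_null ?_ (hV.1.addHaar_frontier volume)
      rw [frontier, hempty, Set.sdiff_empty]
      exact subset_closure
    exact hpos.ne' (integral_eq_zero_of_ae (indicator_meas_zero hD))
  have hcont : ContinuousAt V z :=
    hV.continuousOn_interior.continuousAt (isOpen_interior.mem_nhds hz)
  refine ⟨Real.exp (-(V z + 1)), Real.exp_pos _, z, mem_interior_iff_mem_nhds.2 ?_⟩
  filter_upwards [hcont.eventually_le_const (lt_add_one _), mem_interior_iff_mem_nhds.1 hz]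
    with y hVy hyD
  rw [Set.indicator_of_mem hyD, Real.exp_le_exp]
  exact neg_le_neg hVy

theorem IsLogConcave.exists_pos (hf : IsLogConcave f) (hpos : 0 < ∫ x, f x) : ∃ z, 0 < f z := by
  obtain ⟨t, ht, z, hz⟩ := hf.exists_interior_superlevel_nonempty hpos
  exact ⟨z, ht.trans_le (interior_subset hz : z ∈ {x | t ≤ f x})⟩

theorem IsLogConcave.isBounded_superlevel (hf : IsLogConcave f) (hi : Integrable f)
    (hpos : 0 < ∫ x, f x) {t : ℝ} (ht : 0 < t) : Bornology.IsBounded {x | t ≤ f x} := by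
  obtain ⟨r, hr, hint⟩ := hf.exists_interior_superlevel_nonempty hpos
  have hmin : 0 < min r t := lt_min hr ht
  have hr_sub : {x | r ≤ f x} ⊆ {x | min r t ≤ f x} :=
    fun _ hx => (min_le_left r t).trans hx
  have ht_sub : {x | t ≤ f x} ⊆ {x | min r t ≤ f x} :=
    fun _ hx => (min_le_right r t).trans hx
  exact (isBounded_of_convex_of_measure_ne_top volume (hf.convex_superlevel hmin)
    (hint.mono (interior_mono hr_sub)) (hi.measure_ge_lt_top hmin).ne).subset ht_sub



theorem IsLogConcave.integrable_norm_sq_mul (hf : IsLogConcave f) (hi : Integrable f)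
    (hpos : 0 < ∫ x, f x) : Integrable fun x => ‖x‖ ^ 2 * f x := by
  obtain ⟨z, hz⟩ := hf.exists_pos hpos
  obtain ⟨R, hR⟩ := (hf.isBounded_superlevel hi hpos (by positivity : 0 < f z / 4)).subset_ball z
  have hR0 : 0 < R := Metric.pos_of_mem_ball (hR (show f z / 4 ≤ f z by linarith))
  have hcentered : ∀ x, ‖x - z‖ ^ 2 * f x ≤ 4 * R ^ 2 * (f x + f (midpoint ℝ x z)) :=
    hf.seminorm_sq_mul_le hz (normSeminorm ℝ _) hR0 fun y hy => by
      by_contra! hlt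
      exact (mem_ball_iff_norm.1 (hR hlt.le)).not_ge hy
  have hdom : Integrable fun x =>
      2 * (4 * R ^ 2 * (f x + f (midpoint ℝ x z)) + ‖z‖ ^ 2 * f x) :=
    (((hi.add (integrable_comp_midpoint hi z)).const_mul _).add (hi.const_mul _)).const_mul _
  refine hdom.mono' ((continuous_norm.pow 2).aestronglyMeasurable.mul hi.1)
    (Filter.Eventually.of_forall fun x => ?_)
  have hx := hf.nonneg x
  have hnorm : ‖x‖ ^ 2 ≤ 2 * (‖x - z‖ ^ 2 + ‖z‖ ^ 2) := by
    calc ‖x‖ ^ 2 ≤ (‖x - z‖ + ‖z‖) ^ 2 := by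
          gcongr
          exact norm_le_norm_sub_add x z
      _ ≤ 2 * (‖x - z‖ ^ 2 + ‖z‖ ^ 2) := add_sq_le
  rw [Real.norm_of_nonneg (by positivity)]
  calc ‖x‖ ^ 2 * f x ≤ 2 * (‖x - z‖ ^ 2 + ‖z‖ ^ 2) * f x := by gcongr
    _ = 2 * (‖x - z‖ ^ 2 * f x + ‖z‖ ^ 2 * f x) := by ring
    _ ≤ 2 * (4 * R ^ 2 * (f x + f (midpoint ℝ x z)) + ‖z‖ ^ 2 * f x) := by
        linarith [hcentered x]

end LogConcave

section Cube

open Matrix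

theorem abs_dotProduct_le {ι : Type*} [Fintype ι] (x y : ι → ℝ) :
    |x ⬝ᵥ y| ≤ Fintype.card ι * (‖x‖ * ‖y‖) := by
  calc |x ⬝ᵥ y| ≤ ∑ i, |x i * y i| := Finset.abs_sum_le_sum_abs _ _
    _ ≤ ∑ _i : ι, ‖x‖ * ‖y‖ := by
        gcongr with i
        rw [abs_mul]
        exact mul_le_mul (norm_le_pi_norm x i) (norm_le_pi_norm y i) (abs_nonneg _) (norm_nonneg _)
    _ = Fintype.card ι * (‖x‖ * ‖y‖) := by simp

theorem span_eq_top_of_forall_exists_dotProduct_ne_zero {K ι : Type*} [Field K] [Fintype ι]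
    {S : Set (ι → K)} (h : ∀ θ : ι → K, θ ≠ 0 → ∃ y ∈ S, θ ⬝ᵥ y ≠ 0) :
    Submodule.span K S = ⊤ := by
  classical
  by_contra hne
  obtain ⟨φ, hφ, hker⟩ := Submodule.exists_le_ker_of_lt_top _ (lt_top_iff_ne_top.2 hne)
  obtain ⟨θ, rfl⟩ := (dotProductEquiv K ι).surjective φ
  obtain ⟨y, hy, hθy⟩ := h θ fun hθ => hφ (by rw [hθ, map_zero])
  exact hθy (hker (Submodule.subset_span hy))

theorem exists_rows_mem_det_ne_zero {K : Type*} [Field K] {d : ℕ} {S : Set (Fin d → K)}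
    (hS : Submodule.span K S = ⊤) : ∃ v : Matrix (Fin d) (Fin d) K, (∀ j, v j ∈ S) ∧ v.det ≠ 0 := by
  obtain ⟨g, hg, -, hli⟩ := Submodule.exists_fun_fin_finrank_span_eq K S
  have hfin : Module.finrank K (Submodule.span K S) = d := by
    rw [hS, finrank_top, Module.finrank_fin_fun]
  set v : Matrix (Fin d) (Fin d) K := Matrix.of fun j => g (Fin.cast hfin.symm j)
  have hrows : LinearIndependent K v.row := hli.comp _ (Fin.cast_injective _)
  rw [linearIndependent_rows_iff_isUnit, isUnit_iff_isUnit_det] at hrows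
  exact ⟨v, fun j => hg _, hrows.ne_zero⟩

variable {d : ℕ}

theorem exists_rows_mem_det_almost_max {S : Set (Fin d → ℝ)} (hb : Bornology.IsBounded S)
    (hS : Submodule.span ℝ S = ⊤) :
    ∃ v : Matrix (Fin d) (Fin d) ℝ, (∀ j, v j ∈ S) ∧ v.det ≠ 0 ∧
      ∀ u : Matrix (Fin d) (Fin d) ℝ, (∀ j, u j ∈ S) → |u.det| ≤ 2 * |v.det| := by
  obtain ⟨R, hR⟩ := hb.exists_norm_le
  obtain ⟨v₀, hv₀, hdet₀⟩ := exists_rows_mem_det_ne_zero hS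
  set T : Set ℝ := (fun v => |v.det|) '' {v : Matrix (Fin d) (Fin d) ℝ | ∀ j, v j ∈ S}
  have hbdd : BddAbove T := by
    refine ⟨(Fintype.card (Fin d)).factorial • R ^ Fintype.card (Fin d), ?_⟩
    rintro _ ⟨v, hv, rfl⟩
    exact Matrix.det_le (abv := AbsoluteValue.abs) fun i j =>
      (norm_le_pi_norm (v i) j).trans (hR _ (hv i))
  have hpos : 0 < sSup T := (abs_pos.2 hdet₀).trans_le (le_csSup hbdd ⟨v₀, hv₀, rfl⟩)
  obtain ⟨_, ⟨v, hv, rfl⟩, hlt⟩ := exists_lt_of_lt_csSup (s := T) ⟨_, v₀, hv₀, rfl⟩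
    (half_lt_self hpos)
  refine ⟨v, hv, abs_pos.1 ((half_pos hpos).trans hlt), fun u hu => ?_⟩
  linarith [le_csSup hbdd ⟨u, hu, rfl⟩]

theorem abs_vecMul_inv_le_of_det_updateRow_le {v : Matrix (Fin d) (Fin d) ℝ} (hv : v.det ≠ 0)
    {y : Fin d → ℝ} {j : Fin d} {a : ℝ} (h : |(v.updateRow j y).det| ≤ a * |v.det|) :
    |(y ᵥ* v⁻¹) j| ≤ a := by
  have hcramer := congrFun (det_smul_inv_vecMul_eq_cramer_transpose v y hv.isUnit) j
  rw [cramer_transpose_apply, Pi.smul_apply, smul_eq_mul] at hcramer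
  rw [← hcramer, abs_mul, mul_comm] at h
  exact le_of_mul_le_mul_right h (abs_pos.2 hv)

theorem add_sum_smul_mem_of_convex {ι E : Type*} [Fintype ι] [AddCommGroup E] [Module ℝ E]
    {s : Set E} (hs : Convex ℝ s) {z : E} (hz : z ∈ s) {v : ι → E} (hv : ∀ j, z + v j ∈ s)
    {a : ι → ℝ} (ha : ∀ j, 0 ≤ a j) (hsum : ∑ j, a j ≤ 1) : z + ∑ j, a j • v j ∈ s := by
  have hcomb : z + ∑ j, a j • v j = ∑ o : Option ι,
      o.elim (1 - ∑ j, a j) a • o.elim z fun j => z + v j := by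
    simp only [Fintype.sum_option, Option.elim, smul_add, Finset.sum_add_distrib, sub_smul,
      one_smul, ← Finset.sum_smul]
    abel
  rw [hcomb]
  refine hs.sum_mem ?_ (by simp [Fintype.sum_option]) ?_
  · rintro (_ | j) -
    exacts [sub_nonneg.2 hsum, ha j]
  · rintro (_ | j) -
    exacts [hz, hv j]

theorem closedBall_subset_of_norm_inv_col_le (hd : 0 < d) {L : Set (Fin d → ℝ)} (hL : Convex ℝ L)
    {z : Fin d → ℝ} (hz : z ∈ L) {v : Matrix (Fin d) (Fin d) ℝ} (hv : ∀ j, z + v j ∈ L)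
    (hdet : v.det ≠ 0) {a : ℝ} (ha : 0 < a) (hcol : ∀ j, ‖v⁻¹.col j‖ ≤ a) :
    Metric.closedBall (z + ∑ j, (1 / (2 * d) : ℝ) • v j) (1 / (2 * d ^ 2 * a)) ⊆ L := by
  have : (0 : ℝ) < d := by exact_mod_cast hd
  have hhalves : (d : ℝ) * (1 / (2 * d) + 1 / (2 * d)) = 1 := by
    field_simp
    norm_num
  intro y hy
  set u := y - (z + ∑ j, (1 / (2 * d) : ℝ) • v j) with hu
  set b := u ᵥ* v⁻¹ with hb_def
  have hbu : ∑ j, b j • v j = u := by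
    rw [← vecMul_eq_sum, hb_def, vecMul_vecMul, nonsing_inv_mul v hdet.isUnit, vecMul_one]
  have hb : ∀ j, |b j| ≤ 1 / (2 * d) := by
    intro j
    calc |b j| ≤ Fintype.card (Fin d) * (‖u‖ * ‖v⁻¹.col j‖) := abs_dotProduct_le _ _
      _ ≤ Fintype.card (Fin d) * (1 / (2 * d ^ 2 * a) * a) := by
          gcongr
          exacts [mem_closedBall_iff_norm.1 hy, hcol j]
      _ = 1 / (2 * d) := by
          rw [Fintype.card_fin]
          field_simp
  have hy_eq : y = z + ∑ j, (1 / (2 * d) + b j) • v j := by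
    simp only [add_smul, Finset.sum_add_distrib, hbu, hu]
    abel
  rw [hy_eq]
  refine add_sum_smul_mem_of_convex hL hz hv (fun j => ?_) ?_
  · linarith [(abs_le.1 (hb j)).1]
  · calc ∑ j, (1 / (2 * d) + b j) ≤ ∑ _j : Fin d, (1 / (2 * d) + 1 / (2 * d) : ℝ) := by
          gcongr with j
          exact (le_abs_self _).trans (hb j)
      _ = 1 := by rw [Finset.sum_const, Finset.card_univ, Fintype.card_fin, nsmul_eq_mul, hhalves]

theorem exists_closedBall_subset_of_wide (hd : 0 < d) {L : Set (Fin d → ℝ)} (hL : Convex ℝ L)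
    (hb : Bornology.IsBounded L) {z : Fin d → ℝ} (hz : z ∈ L) {w : ℝ} (hw : 0 < w)
    (h : ∀ θ : Fin d → ℝ, θ ≠ 0 → ∃ x ∈ L, w * ‖θ‖ ≤ |θ ⬝ᵥ (x - z)|) :
    ∃ c, Metric.closedBall c (w / (4 * d ^ 2)) ⊆ L := by
  set S := {y | z + y ∈ L} with hS
  have hmem : ∀ x ∈ L, x - z ∈ S := fun x hx => by
    rwa [hS, Set.mem_ofPred_eq, add_sub_cancel]
  have hSb : Bornology.IsBounded S :=
    (hb.sub Bornology.isBounded_singleton).subset fun y hy =>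
      Set.mem_sub.2 ⟨z + y, hy, z, rfl, add_sub_cancel_left z y⟩
  obtain ⟨v, hv, hdet, hmax⟩ := exists_rows_mem_det_almost_max hSb
    (span_eq_top_of_forall_exists_dotProduct_ne_zero fun θ hθ => by
      obtain ⟨x, hx, hle⟩ := h θ hθ
      have : 0 < w * ‖θ‖ := mul_pos hw (norm_pos_iff.2 hθ)
      exact ⟨x - z, hmem x hx, abs_pos.1 (this.trans_le hle)⟩)
  have hcoef : ∀ x ∈ L, ∀ j, |((x - z) ᵥ* v⁻¹) j| ≤ 2 := fun x hx j =>
    abs_vecMul_inv_le_of_det_updateRow_le hdet <| hmax _ fun i => by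
      rcases eq_or_ne i j with rfl | hij
      · rw [updateRow_self]
        exact hmem x hx
      · rw [updateRow_ne hij]
        exact hv i
  have hcol : ∀ j, ‖v⁻¹.col j‖ ≤ 2 / w := by
    intro j
    rcases eq_or_ne (v⁻¹.col j) 0 with h0 | h0
    · rw [h0, norm_zero]
      positivity
    obtain ⟨x, hx, hle⟩ := h _ h0
    rw [le_div_iff₀' hw]
    refine hle.trans ?_
    rw [dotProduct_comm]
    exact hcoef x hx j
  have hradius : 1 / (2 * d ^ 2 * (2 / w)) = w / (4 * d ^ 2) := by
    field_simp
    norm_num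
  exact ⟨_, hradius ▸ closedBall_subset_of_norm_inv_col_le hd hL hz hv hdet (by positivity) hcol⟩

end Cube

section Moments

open Matrix

/-- The barycenter of a density on `ℝ^d` which need not have total mass one. -/
noncomputable def barycenter {d : ℕ} (f : (Fin d → ℝ) → ℝ) : Fin d → ℝ :=
  fun i => (∫ x, x i * f x) / ∫ x, f x

variable {d : ℕ} {f : (Fin d → ℝ) → ℝ}

theorem integral_coord_mul (hpos : 0 < ∫ x, f x) (i : Fin d) :
    ∫ x, x i * f x = (∫ x, f x) * barycenter f i :=
  (mul_div_cancel₀ _ hpos.ne').symm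

theorem integral_coord_mul_coord_mul (hpos : 0 < ∫ x, f x) (i j : Fin d) :
    ∫ x, x i * x j * f x =
      (∫ x, f x) * (covMatrix f i j + barycenter f i * barycenter f j) := by
  simp only [covMatrix, barycenter, of_apply]
  field_simp
  ring

theorem IsLogConcave.integrable_coord_mul_coord_mul (hf : IsLogConcave f) (hi : Integrable f)
    (hpos : 0 < ∫ x, f x) (i j : Fin d) : Integrable fun x => x i * x j * f x := by
  refine (hf.integrable_norm_sq_mul hi hpos).mono'
    (((continuous_apply i).mul (continuous_apply j)).aestronglyMeasurable.mul hi.1)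
    (Filter.Eventually.of_forall fun x => ?_)
  have := hf.nonneg x
  rw [norm_mul, norm_mul, Real.norm_of_nonneg this, sq]
  gcongr
  exacts [norm_le_pi_norm x i, norm_le_pi_norm x j]

theorem IsLogConcave.integrable_coord_mul (hf : IsLogConcave f) (hi : Integrable f)
    (hpos : 0 < ∫ x, f x) (i : Fin d) : Integrable fun x => x i * f x := by
  refine ((hf.integrable_norm_sq_mul hi hpos).add hi).mono'
    ((continuous_apply i).aestronglyMeasurable.mul hi.1)
    (Filter.Eventually.of_forall fun x => ?_)
  have h0 := hf.nonneg x
  have hcoord : ‖x i‖ ≤ ‖x‖ ^ 2 + 1 := by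
    linarith [norm_le_pi_norm x i, sq_nonneg (‖x‖ - 1), norm_nonneg x]
  calc ‖x i * f x‖ = ‖x i‖ * f x := by rw [norm_mul, Real.norm_of_nonneg h0]
    _ ≤ (‖x‖ ^ 2 + 1) * f x := by gcongr
    _ = ‖x‖ ^ 2 * f x + f x := by ring

theorem sq_dotProduct_sub_mul_eq (θ : Fin d → ℝ) (a : ℝ) (x : Fin d → ℝ) (t : ℝ) :
    (θ ⬝ᵥ x - a) ^ 2 * t = (∑ i, ∑ j, θ i * θ j * (x i * x j * t)) -
      2 * a * (∑ i, θ i * (x i * t)) + a ^ 2 * t := by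
  have hquad : ∑ i, ∑ j, θ i * θ j * (x i * x j * t) = (θ ⬝ᵥ x) ^ 2 * t := by
    rw [dotProduct, sq, Finset.sum_mul_sum, Finset.sum_mul]
    simp only [Finset.sum_mul]
    exact Finset.sum_congr rfl fun i _ => Finset.sum_congr rfl fun j _ => by ring
  have hlin : ∑ i, θ i * (x i * t) = (θ ⬝ᵥ x) * t := by
    simp only [dotProduct, Finset.sum_mul, mul_assoc]
  rw [hquad, hlin]
  ring

theorem IsLogConcave.integrable_sq_dotProduct_sub_mul (hf : IsLogConcave f) (hi : Integrable f)
    (hpos : 0 < ∫ x, f x) (θ : Fin d → ℝ) (a : ℝ) :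
    Integrable fun x => (θ ⬝ᵥ x - a) ^ 2 * f x := by
  simp only [sq_dotProduct_sub_mul_eq]
  exact ((integrable_finsetSum _ fun i _ => integrable_finsetSum _ fun j _ =>
    (hf.integrable_coord_mul_coord_mul hi hpos i j).const_mul _).sub
    ((integrable_finsetSum _ fun i _ => (hf.integrable_coord_mul hi hpos i).const_mul _).const_mul
      _)).add (hi.const_mul _)

theorem IsLogConcave.integral_sq_dotProduct_sub_mul (hf : IsLogConcave f) (hi : Integrable f)
    (hpos : 0 < ∫ x, f x) (θ : Fin d → ℝ) (a : ℝ) :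
    ∫ x, (θ ⬝ᵥ x - a) ^ 2 * f x =
      (∫ x, f x) * (θ ⬝ᵥ covMatrix f *ᵥ θ + (θ ⬝ᵥ barycenter f - a) ^ 2) := by
  have hquad : ∀ i j, Integrable fun x => θ i * θ j * (x i * x j * f x) := fun i j =>
    (hf.integrable_coord_mul_coord_mul hi hpos i j).const_mul _
  have hlin : ∀ i, Integrable fun x => θ i * (x i * f x) := fun i =>
    (hf.integrable_coord_mul hi hpos i).const_mul _
  have hquads : Integrable fun x => ∑ i, ∑ j, θ i * θ j * (x i * x j * f x) :=
    integrable_finsetSum _ fun i _ => integrable_finsetSum _ fun j _ => hquad i j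
  have hlins : Integrable fun x => 2 * a * ∑ i, θ i * (x i * f x) :=
    (integrable_finsetSum _ fun i _ => hlin i).const_mul _
  have hdiff : Integrable fun x => (∑ i, ∑ j, θ i * θ j * (x i * x j * f x)) -
      2 * a * ∑ i, θ i * (x i * f x) := hquads.sub hlins
  simp only [sq_dotProduct_sub_mul_eq]
  rw [integral_add hdiff (hi.const_mul _), integral_sub hquads hlins,
    integral_const_mul, integral_const_mul, integral_finsetSum _ fun i _ => hlin i,
    integral_finsetSum _ fun i _ => integrable_finsetSum _ fun j _ => hquad i j, mul_add,
    mul_comm _ ((θ ⬝ᵥ barycenter f - a) ^ 2), sq_dotProduct_sub_mul_eq]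
  simp only [fun i => integral_finsetSum Finset.univ fun j _ => hquad i j, integral_const_mul,
    integral_coord_mul hpos, integral_coord_mul_coord_mul hpos, dotProduct, mulVec, Finset.mul_sum,
    mul_add, Finset.sum_add_distrib]
  rw [add_sub_assoc, add_assoc]
  congr 1
  · exact Finset.sum_congr rfl fun i _ => Finset.sum_congr rfl fun j _ => by ring
  · simp only [mul_comm (∫ x, f x)]

end Moments

section RoughIsotropy

open Matrix

variable {d : ℕ} {f : (Fin d → ℝ) → ℝ} {Λ s : ℝ}

/-- The covariance matrix of `f` is comparable to `s ^ 2` times the identity: it is at least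
`s ^ 2` as a quadratic form, and its diagonal entries, which control the whole of it, are at most
`Λ * s ^ 2`. This is all the argument needs of an almost isotropic function. -/
structure IsRoughlyIsotropic (Λ s : ℝ) (f : (Fin d → ℝ) → ℝ) : Prop where
  scale_pos : 0 < s
  integrable : Integrable f
  lower : ∀ θ : Fin d → ℝ, s ^ 2 * (θ ⬝ᵥ θ) ≤ θ ⬝ᵥ covMatrix f *ᵥ θ
  upper : ∀ i, covMatrix f i i ≤ Λ * s ^ 2

theorem IsRoughlyIsotropic.sq_le_covMatrix_diag (hs : IsRoughlyIsotropic Λ s f) (i : Fin d) :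
    s ^ 2 ≤ covMatrix f i i := by
  simpa using hs.lower (Pi.single i 1)

theorem IsRoughlyIsotropic.one_le (hs : IsRoughlyIsotropic Λ s f) (hd : 0 < d) : 1 ≤ Λ := by
  have hs2 : 0 < s ^ 2 := pow_pos hs.scale_pos 2
  refine le_of_mul_le_mul_right ?_ hs2
  rw [one_mul]
  exact (hs.sq_le_covMatrix_diag ⟨0, hd⟩).trans (hs.upper _)

theorem IsRoughlyIsotropic.integral_pos (hs : IsRoughlyIsotropic Λ s f) (hd : 0 < d)
    (hf : IsLogConcave f) : 0 < ∫ x, f x := by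
  refine (integral_nonneg hf.nonneg).lt_of_ne' fun h0 => ?_
  have hcov : covMatrix f ⟨0, hd⟩ ⟨0, hd⟩ = 0 := by simp [covMatrix, h0]
  exact (pow_pos hs.scale_pos 2).not_ge ((hs.sq_le_covMatrix_diag ⟨0, hd⟩).trans_eq hcov)

theorem norm_sq_le_dotProduct_self {ι : Type*} [Fintype ι] (x : ι → ℝ) : ‖x‖ ^ 2 ≤ x ⬝ᵥ x := by
  have h0 : 0 ≤ x ⬝ᵥ x := Finset.sum_nonneg fun i _ => mul_self_nonneg _
  refine (Real.le_sqrt (norm_nonneg x) h0).1 ((pi_norm_le_iff_of_nonneg (Real.sqrt_nonneg _)).2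
    fun i => Real.abs_le_sqrt ?_)
  rw [sq]
  exact Finset.single_le_sum (f := fun i => x i * x i) (fun i _ => mul_self_nonneg _)
    (Finset.mem_univ i)

theorem IsLogConcave.dotProduct_covMatrix_le_of_drop (hf : IsLogConcave f) (hi : Integrable f)
    (hpos : 0 < ∫ x, f x) {z : Fin d → ℝ} (hz : 0 < f z) {θ : Fin d → ℝ} {w : ℝ} (hw : 0 < w)
    (h : ∀ x, w ≤ |θ ⬝ᵥ (x - z)| → f x ≤ f z / 4) :
    θ ⬝ᵥ covMatrix f *ᵥ θ ≤ 4 * w ^ 2 * (1 + 2 ^ d) := by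
  have hmid := integrable_comp_midpoint hi z
  have hpt : ∀ x, (θ ⬝ᵥ x - θ ⬝ᵥ z) ^ 2 * f x ≤ 4 * w ^ 2 * (f x + f (midpoint ℝ x z)) := by
    intro x
    rw [← dotProduct_sub, ← sq_abs]
    exact hf.seminorm_sq_mul_le hz (dotProductEquiv ℝ (Fin d) θ).toSeminorm hw h x
  refine le_of_mul_le_mul_left ?_ hpos
  calc (∫ x, f x) * (θ ⬝ᵥ covMatrix f *ᵥ θ)
      ≤ (∫ x, f x) * (θ ⬝ᵥ covMatrix f *ᵥ θ + (θ ⬝ᵥ barycenter f - θ ⬝ᵥ z) ^ 2) := by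
        gcongr
        exact le_add_of_nonneg_right (sq_nonneg _)
    _ = ∫ x, (θ ⬝ᵥ x - θ ⬝ᵥ z) ^ 2 * f x := (hf.integral_sq_dotProduct_sub_mul hi hpos θ _).symm
    _ ≤ ∫ x, 4 * w ^ 2 * (f x + f (midpoint ℝ x z)) :=
        integral_mono (hf.integrable_sq_dotProduct_sub_mul hi hpos θ _)
          ((hi.add hmid).const_mul _) hpt
    _ = (∫ x, f x) * (4 * w ^ 2 * (1 + 2 ^ d)) := by
        rw [integral_const_mul, integral_add hi hmid, integral_comp_midpoint,
          Module.finrank_fin_fun, smul_eq_mul]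
        ring

theorem IsRoughlyIsotropic.exists_wide (hs : IsRoughlyIsotropic Λ s f) (hd : 0 < d)
    (hf : IsLogConcave f) {z : Fin d → ℝ} (hz : 0 < f z) {θ : Fin d → ℝ} (hθ : θ ≠ 0) :
    ∃ x, f z / 4 ≤ f x ∧ s / (4 * (1 + 2 ^ d)) * ‖θ‖ ≤ |θ ⬝ᵥ (x - z)| := by
  have hs0 := hs.scale_pos
  have : 0 < ‖θ‖ := norm_pos_iff.2 hθ
  by_contra! hcon
  have hdrop := hf.dotProduct_covMatrix_le_of_drop hs.integrable (hs.integral_pos hd hf) hz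
    (θ := θ) (w := s / (4 * (1 + 2 ^ d)) * ‖θ‖) (by positivity) fun x hx => by
      by_contra! hlt
      exact (hcon x hlt.le).not_ge hx
  refine lt_irrefl (s ^ 2 * ‖θ‖ ^ 2) ?_
  calc s ^ 2 * ‖θ‖ ^ 2 ≤ s ^ 2 * (θ ⬝ᵥ θ) := by
        gcongr
        exact norm_sq_le_dotProduct_self θ
    _ ≤ 4 * (s / (4 * (1 + 2 ^ d)) * ‖θ‖) ^ 2 * (1 + 2 ^ d) := (hs.lower θ).trans hdrop
    _ = s ^ 2 * ‖θ‖ ^ 2 / (4 * (1 + 2 ^ d)) := by field_simp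
    _ < s ^ 2 * ‖θ‖ ^ 2 := by
        have : (0 : ℝ) < 2 ^ d := by positivity
        exact div_lt_self (by positivity) (by linarith)

/-- The radius, relative to the scale, of the cubes on which `IsRoughlyIsotropic.exists_cube` bounds
a roughly isotropic log-concave function on `ℝ^d` from below. -/
noncomputable def cubeRatio (d : ℕ) : ℝ := 1 / (16 * d ^ 2 * (1 + 2 ^ d))

theorem cubeRatio_pos (hd : 0 < d) : 0 < cubeRatio d := by
  unfold cubeRatio
  positivity

theorem IsRoughlyIsotropic.exists_cube (hs : IsRoughlyIsotropic Λ s f) (hd : 0 < d)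
    (hf : IsLogConcave f) {z : Fin d → ℝ} (hz : 0 < f z) :
    ∃ c, Metric.closedBall c (cubeRatio d * s) ⊆ {x | f z / 4 ≤ f x} := by
  have hs0 := hs.scale_pos
  have hz4 : 0 < f z / 4 := by positivity
  obtain ⟨c, hc⟩ := exists_closedBall_subset_of_wide hd (hf.convex_superlevel hz4)
    (hf.isBounded_superlevel hs.integrable (hs.integral_pos hd hf) hz4)
    (z := z) (show f z / 4 ≤ f z by linarith) (w := s / (4 * (1 + 2 ^ d))) (by positivity)
    (fun θ hθ => hs.exists_wide hd hf hz hθ)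
  refine ⟨c, (congrArg (Metric.closedBall c) ?_).trans_subset hc⟩
  unfold cubeRatio
  field_simp
  norm_num

theorem exists_finset_int_closedBall (c : Fin d → ℝ) {h : ℝ} (hh : 1 ≤ h) :
    ∃ F : Finset (Fin d → ℤ), h ^ d ≤ F.card ∧
      ∀ k ∈ F, (fun i => (k i : ℝ)) ∈ Metric.closedBall c h := by
  refine ⟨Fintype.piFinset fun i => Finset.Icc ⌈c i - h⌉ ⌊c i + h⌋, ?_, fun k hk => ?_⟩
  · rw [Fintype.card_piFinset, Nat.cast_prod]
    calc h ^ d = ∏ _i : Fin d, h := by rw [Finset.prod_const, Finset.card_univ, Fintype.card_fin]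
      _ ≤ ∏ i, ((Finset.Icc ⌈c i - h⌉ ⌊c i + h⌋).card : ℝ) := by
        refine Finset.prod_le_prod (fun i _ => by linarith) fun i _ => ?_
        have hlen : h ≤ ((⌊c i + h⌋ + 1 - ⌈c i - h⌉ : ℤ) : ℝ) := by
          push_cast
          linarith [Int.lt_floor_add_one (c i + h), Int.ceil_lt_add_one (c i - h)]
        rw [Int.card_Icc]
        exact hlen.trans (by exact_mod_cast Int.self_le_toNat _)
  · rw [closedBall_pi _ (by linarith)]
    intro i _
    have := Fintype.mem_piFinset.1 hk i
    rwa [Finset.mem_Icc, Int.ceil_le, Int.le_floor, ← Set.mem_Icc, ← Real.closedBall_eq_Icc] at this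

theorem IsRoughlyIsotropic.le_of_sum_le_one (hs : IsRoughlyIsotropic Λ s f) (hd : 0 < d)
    (hf : IsLogConcave f) (hsum : ∀ F : Finset (Fin d → ℤ), ∑ k ∈ F, f (fun i => (k i : ℝ)) ≤ 1)
    (hs1 : 1 ≤ cubeRatio d * s) (z : Fin d → ℝ) : f z ≤ 4 / (cubeRatio d * s) ^ d := by
  rcases (hf.nonneg z).eq_or_lt with hz | hz
  · rw [← hz]
    positivity
  obtain ⟨c, hc⟩ := hs.exists_cube hd hf hz
  obtain ⟨F, hF, hFc⟩ := exists_finset_int_closedBall c hs1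
  have hmass : (cubeRatio d * s) ^ d * (f z / 4) ≤ 1 := by
    calc (cubeRatio d * s) ^ d * (f z / 4) ≤ F.card * (f z / 4) := by gcongr
      _ = F.card • (f z / 4) := (nsmul_eq_mul _ _).symm
      _ ≤ ∑ k ∈ F, f (fun i => (k i : ℝ)) :=
          Finset.card_nsmul_le_sum _ _ _ fun k hk => hc (hFc k hk)
      _ ≤ 1 := hsum F
  rw [le_div_iff₀ (by positivity)]
  linarith

end RoughIsotropy

section Decay

open Matrix

variable {d : ℕ} {f : (Fin d → ℝ) → ℝ} {Λ s M : ℝ}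

theorem IsLogConcave.hasIntegral_sq_coord_sub (hf : IsLogConcave f) (hi : Integrable f)
    (hpos : 0 < ∫ x, f x) (i : Fin d) :
    Integrable (fun x => (x i - barycenter f i) ^ 2 * f x) ∧
      ∫ x, (x i - barycenter f i) ^ 2 * f x = (∫ x, f x) * covMatrix f i i := by
  have hint := hf.integrable_sq_dotProduct_sub_mul hi hpos (Pi.single i 1) (barycenter f i)
  have hval := hf.integral_sq_dotProduct_sub_mul hi hpos (Pi.single i 1) (barycenter f i)
  simp only [single_one_dotProduct, mulVec_single_one, col_apply, sub_self, ne_eq,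
    OfNat.ofNat_ne_zero, not_false_eq_true, zero_pow, add_zero] at hint hval
  exact ⟨hint, hval⟩

theorem IsLogConcave.integrable_dotProduct_self_sub_mul (hf : IsLogConcave f) (hi : Integrable f)
    (hpos : 0 < ∫ x, f x) :
    Integrable fun x => (x - barycenter f) ⬝ᵥ (x - barycenter f) * f x := by
  simp only [dotProduct, Pi.sub_apply, ← sq, Finset.sum_mul]
  exact integrable_finsetSum _ fun i _ => (hf.hasIntegral_sq_coord_sub hi hpos i).1

theorem IsLogConcave.integral_dotProduct_self_sub_mul (hf : IsLogConcave f) (hi : Integrable f)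
    (hpos : 0 < ∫ x, f x) :
    ∫ x, (x - barycenter f) ⬝ᵥ (x - barycenter f) * f x = (∫ x, f x) * (covMatrix f).trace := by
  simp only [dotProduct, Pi.sub_apply, ← sq, Finset.sum_mul]
  rw [integral_finsetSum _ fun i _ => (hf.hasIntegral_sq_coord_sub hi hpos i).1]
  simp only [(hf.hasIntegral_sq_coord_sub hi hpos _).2, trace, diag_apply, Finset.mul_sum]

theorem IsRoughlyIsotropic.trace_covMatrix_le (hs : IsRoughlyIsotropic Λ s f) :
    (covMatrix f).trace ≤ d * (Λ * s ^ 2) := by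
  calc (covMatrix f).trace ≤ ∑ _i : Fin d, Λ * s ^ 2 := Finset.sum_le_sum fun i _ => hs.upper i
    _ = d * (Λ * s ^ 2) := by simp

theorem volume_real_closedBall_pi (c : Fin d → ℝ) {r : ℝ} (hr : 0 ≤ r) :
    volume.real (Metric.closedBall c r) = (2 * r) ^ d := by
  rw [measureReal_def, Real.volume_pi_closedBall c hr, ENNReal.toReal_ofReal (by positivity),
    Fintype.card_fin]

theorem IsLogConcave.integral_le_setIntegral_closedBall_add (hf : IsLogConcave f)
    (hi : Integrable f) (hpos : 0 < ∫ x, f x) {r : ℝ} (hr : 0 < r) :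
    ∫ x, f x ≤ (∫ x in Metric.closedBall (barycenter f) r, f x) +
      1 / r ^ 2 * ((∫ x, f x) * (covMatrix f).trace) := by
  set B := Metric.closedBall (barycenter f) r with hB
  have hBm : MeasurableSet B := Metric.isClosed_closedBall.measurableSet
  set q := fun x => (x - barycenter f) ⬝ᵥ (x - barycenter f)
  have hq : Integrable fun x => 1 / r ^ 2 * (q x * f x) :=
    (hf.integrable_dotProduct_self_sub_mul hi hpos).const_mul _
  have hpt : ∀ x, f x ≤ B.indicator f x + 1 / r ^ 2 * (q x * f x) := by
    intro x
    have hx0 := hf.nonneg x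
    have hq0 : 0 ≤ q x := (sq_nonneg _).trans (norm_sq_le_dotProduct_self _)
    by_cases hx : x ∈ B
    · rw [Set.indicator_of_mem hx]
      exact le_add_of_nonneg_right (by positivity)
    · rw [hB, mem_closedBall_iff_norm, not_le] at hx
      have hrq : r ^ 2 ≤ q x :=
        (pow_le_pow_left₀ hr.le hx.le 2).trans (norm_sq_le_dotProduct_self _)
      rw [← mul_assoc, one_div_mul_eq_div]
      exact (le_mul_of_one_le_left hx0 ((one_le_div (by positivity)).2 hrq)).trans
        (le_add_of_nonneg_left (Set.indicator_nonneg (fun x _ => hf.nonneg x) x))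
  rw [← hf.integral_dotProduct_self_sub_mul hi hpos, ← integral_const_mul, ← integral_indicator hBm,
    ← integral_add (hi.indicator hBm) hq]
  exact integral_mono hi ((hi.indicator hBm).add hq) hpt

theorem IsRoughlyIsotropic.integral_le (hs : IsRoughlyIsotropic Λ s f) (hd : 0 < d)
    (hf : IsLogConcave f) (hM : ∀ x, f x ≤ M) : ∫ x, f x ≤ 2 * M * (4 * d * Λ * s) ^ d := by
  have hd1 : (1 : ℝ) ≤ d := by exact_mod_cast hd
  have hΛ := hs.one_le hd
  have hs0 := hs.scale_pos
  have hpos := hs.integral_pos hd hf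
  set r := 2 * d * Λ * s with hr
  have hr0 : 0 < r := by positivity
  have hin : ∫ x in Metric.closedBall (barycenter f) r, f x ≤ M * (2 * r) ^ d := by
    rw [← volume_real_closedBall_pi (barycenter f) hr0.le]
    exact (le_abs_self _).trans (norm_setIntegral_le_of_norm_le_const measure_closedBall_lt_top
      fun x _ => by rw [Real.norm_of_nonneg (hf.nonneg x)]; exact hM x)
  have hout : 1 / r ^ 2 * ((∫ x, f x) * (covMatrix f).trace) ≤ (∫ x, f x) / 2 := by
    calc 1 / r ^ 2 * ((∫ x, f x) * (covMatrix f).trace)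
        ≤ 1 / r ^ 2 * ((∫ x, f x) * (d * (Λ * s ^ 2))) := by
          gcongr
          exact hs.trace_covMatrix_le
      _ = (∫ x, f x) / (2 * (2 * d * Λ)) := by
          rw [hr]
          field_simp
      _ ≤ (∫ x, f x) / 2 := by
          gcongr
          nlinarith
  have hcheb := hf.integral_le_setIntegral_closedBall_add hs.integrable hpos hr0
  calc ∫ x, f x ≤ 2 * (M * (2 * r) ^ d) := by linarith
    _ = 2 * M * (4 * d * Λ * s) ^ d := by rw [hr]; ring

theorem IsLogConcave.sq_norm_sub_barycenter_mul_le (hf : IsLogConcave f) (hi : Integrable f)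
    (hpos : 0 < ∫ x, f x) {c : Fin d → ℝ} {m r : ℝ} (hm : 0 ≤ m) (hr : 0 ≤ r)
    (hc : Metric.closedBall c r ⊆ {x | m ≤ f x}) (hfar : 2 * r ≤ ‖c - barycenter f‖) :
    (‖c - barycenter f‖ / 2) ^ 2 * m * (2 * r) ^ d ≤ (∫ x, f x) * (covMatrix f).trace := by
  set b := barycenter f
  have hpt : ∀ x ∈ Metric.closedBall c r,
      (‖c - b‖ / 2) ^ 2 * m ≤ (x - b) ⬝ᵥ (x - b) * f x := by
    intro x hx
    have hdist : ‖c - b‖ / 2 ≤ ‖x - b‖ := by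
      linarith [mem_closedBall_iff_norm'.1 hx, norm_sub_le_norm_sub_add_norm_sub c x b]
    have hq : (‖c - b‖ / 2) ^ 2 ≤ (x - b) ⬝ᵥ (x - b) :=
      (pow_le_pow_left₀ (by positivity) hdist 2).trans (norm_sq_le_dotProduct_self _)
    exact mul_le_mul hq (hc hx) hm ((sq_nonneg _).trans hq)
  have hintg := hf.integrable_dotProduct_self_sub_mul hi hpos
  rw [← hf.integral_dotProduct_self_sub_mul hi hpos, ← volume_real_closedBall_pi c hr]
  exact (setIntegral_ge_of_const_le_real Metric.isClosed_closedBall.measurableSet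
    measure_closedBall_lt_top.ne hpt hintg.integrableOn).trans
    (setIntegral_le_integral hintg (Filter.Eventually.of_forall fun x => mul_nonneg
      ((sq_nonneg _).trans (norm_sq_le_dotProduct_self _)) (hf.nonneg x)))

/-- The bound of `IsRoughlyIsotropic.norm_sub_barycenter_le` for the distance, relative to the
scale, between the barycenter and a cube of relative radius `h` on which the function is at least
`δ` times its maximum. -/
noncomputable def centerRatio (d : ℕ) (Λ δ h : ℝ) : ℝ :=
  2 * h + √(8 * d * Λ * (4 * d * Λ) ^ d / (δ * (2 * h) ^ d))

theorem IsRoughlyIsotropic.norm_sub_barycenter_le (hs : IsRoughlyIsotropic Λ s f) (hd : 0 < d)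
    (hf : IsLogConcave f) (hM0 : 0 < M) (hM : ∀ x, f x ≤ M) {δ h : ℝ} (hδ : 0 < δ) (hh : 0 < h)
    {c : Fin d → ℝ} (hc : Metric.closedBall c (h * s) ⊆ {x | δ * M ≤ f x}) :
    ‖c - barycenter f‖ ≤ centerRatio d Λ δ h * s := by
  have hs0 := hs.scale_pos
  have hΛ := hs.one_le hd
  have hpos := hs.integral_pos hd hf
  unfold centerRatio
  rw [add_mul]
  rcases le_or_gt ‖c - barycenter f‖ (2 * h * s) with hle | hgt
  · exact hle.trans (le_add_of_nonneg_right (by positivity))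
  refine le_add_of_nonneg_of_le (by positivity) ?_
  have hmoment : (‖c - barycenter f‖ / 2) ^ 2 * (δ * M) * (2 * (h * s)) ^ d ≤
      2 * M * (4 * d * Λ * s) ^ d * (d * (Λ * s ^ 2)) :=
    (hf.sq_norm_sub_barycenter_mul_le hs.integrable hpos (by positivity) (by positivity) hc
      (by linarith)).trans <|
    (mul_le_mul_of_nonneg_left hs.trace_covMatrix_le hpos.le).trans <|
    mul_le_mul_of_nonneg_right (hs.integral_le hd hf hM) (by positivity)
  rw [← Real.sqrt_sq hs0.le, ← Real.sqrt_mul (by positivity)]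
  apply Real.le_sqrt_of_sq_le
  rw [div_mul_eq_mul_div, le_div_iff₀ (by positivity)]
  refine le_of_mul_le_mul_right ?_ (by positivity : 0 < M * s ^ d / 4)
  calc ‖c - barycenter f‖ ^ 2 * (δ * (2 * h) ^ d) * (M * s ^ d / 4)
      = (‖c - barycenter f‖ / 2) ^ 2 * (δ * M) * (2 * (h * s)) ^ d := by
        rw [← mul_assoc 2 h s, mul_pow _ s]
        ring
    _ ≤ 2 * M * (4 * d * Λ * s) ^ d * (d * (Λ * s ^ 2)) := hmoment
    _ = 8 * d * Λ * (4 * d * Λ) ^ d * s ^ 2 * (M * s ^ d / 4) := by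
        rw [mul_pow _ s]
        ring

/-- The radius, relative to the scale, beyond which a roughly isotropic log-concave function has
dropped to half of its value at a suitable center. -/
noncomputable def dropRatio (d : ℕ) (Λ : ℝ) : ℝ :=
  4 * centerRatio d Λ (1 / 16) (cubeRatio d / 2) + 1

theorem dropRatio_pos (hd : 0 < d) : 0 < dropRatio d Λ := by
  have := cubeRatio_pos hd
  unfold dropRatio centerRatio
  positivity

theorem IsRoughlyIsotropic.exists_center (hs : IsRoughlyIsotropic Λ s f) (hd : 0 < d)
    (hf : IsLogConcave f) (hM0 : 0 < M) (hM : ∀ x, f x ≤ M) {z : Fin d → ℝ} (hz : M / 2 < f z) :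
    ∃ c, M / 8 ≤ f c ∧ ∀ x, dropRatio d Λ * s ≤ ‖x - c‖ → f x ≤ M / 16 := by
  have hs0 := hs.scale_pos
  have hρ := cubeRatio_pos hd
  obtain ⟨c, hcube⟩ := hs.exists_cube hd hf (show 0 < f z by linarith)
  have hc8 : Metric.closedBall c (cubeRatio d * s) ⊆ {x | M / 8 ≤ f x} := fun x hx =>
    (by linarith : M / 8 ≤ f z / 4).trans (hcube hx)
  have hc : M / 8 ≤ f c := hc8 (Metric.mem_closedBall_self (by positivity))
  have hnear {y : Fin d → ℝ}
      (hy : Metric.closedBall y (cubeRatio d * s / 2) ⊆ {x | M / 16 ≤ f x}) :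
      ‖y - barycenter f‖ ≤ centerRatio d Λ (1 / 16) (cubeRatio d / 2) * s :=
    hs.norm_sub_barycenter_le hd hf hM0 hM (by norm_num) (by positivity)
      (by rwa [div_mul_eq_mul_div, one_div_mul_eq_div])
  have hcb := hnear ((Metric.closedBall_subset_closedBall (half_le_self (by positivity))).trans
    fun x hx => (by linarith : M / 16 ≤ M / 8).trans (hc8 hx))
  refine ⟨c, hc, fun x hx => ?_⟩
  by_contra! hlt
  have hmb := hnear (closedBall_midpoint_subset (hf.convex_superlevel (by positivity)) hlt.le
    fun y hy => (by linarith : M / 16 ≤ M / 8).trans (hc8 hy))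
  have hmc : ‖x - c‖ = 2 * ‖midpoint ℝ x c - c‖ := by
    rw [midpoint_sub_right, norm_smul, invOf_eq_inv, Real.norm_of_nonneg (by norm_num)]
    ring
  rw [hmc, dropRatio] at hx
  linarith [norm_sub_le_norm_sub_add_norm_sub (midpoint ℝ x c) (barycenter f) c,
    norm_sub_rev (barycenter f) c]

/-- The product exponential profile of rate `a` centered at `c`. -/
noncomputable def expProfile {ι : Type*} [Fintype ι] (a : ℝ) (c x : ι → ℝ) : ℝ :=
  ∏ i, Real.exp (-(a * |x i - c i|))

theorem expProfile_eq_exp {ι : Type*} [Fintype ι] (a : ℝ) (c x : ι → ℝ) :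
    expProfile a c x = Real.exp (-(a * ∑ i, |x i - c i|)) := by
  rw [expProfile, ← Real.exp_sum, Finset.sum_neg_distrib, ← Finset.mul_sum]

theorem half_rpow_norm_sub_div_le {r : ℝ} (hr : 0 < r) (hd : 0 < d) (c x : Fin d → ℝ) :
    (1 / 2 : ℝ) ^ (‖x - c‖ / r) ≤ expProfile (1 / (2 * r * d)) c x := by
  have : (0 : ℝ) < d := by exact_mod_cast hd
  rw [expProfile_eq_exp, Real.rpow_def_of_pos (by norm_num), Real.exp_le_exp]
  have hlog : Real.log (1 / 2) ≤ -(1 / 2) := by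
    linarith [Real.log_le_sub_one_of_pos (x := 1 / 2) (by norm_num)]
  have hnorm : ∑ i, |x i - c i| ≤ d * ‖x - c‖ := by
    calc ∑ i, |x i - c i| ≤ ∑ _i : Fin d, ‖x - c‖ :=
          Finset.sum_le_sum fun i _ => norm_le_pi_norm (x - c) i
      _ = d * ‖x - c‖ := by simp
  calc Real.log (1 / 2) * (‖x - c‖ / r) ≤ -(1 / 2) * (‖x - c‖ / r) := by gcongr
    _ = -(1 / (2 * r * d) * (d * ‖x - c‖)) := by field_simp
    _ ≤ -(1 / (2 * r * d) * ∑ i, |x i - c i|) := by gcongr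

theorem IsLogConcave.le_half_rpow_of_drop (hf : IsLogConcave f) (hM : ∀ x, f x ≤ M)
    {c : Fin d → ℝ} {r : ℝ} (hr : 0 < r) (hc0 : 0 < f c)
    (hdrop : ∀ x, r ≤ ‖x - c‖ → f x ≤ f c / 2) (x : Fin d → ℝ) :
    f x ≤ 2 * M * (1 / 2) ^ (‖x - c‖ / r) := by
  have hMc := hM c
  rcases le_or_gt r ‖x - c‖ with hle | hgt
  · have hlt : 0 < ‖x - c‖ := hr.trans_le hle
    have hmid : f (AffineMap.lineMap c x (‖x - c‖ / r)⁻¹) ≤ f c * (1 / 2) := by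
      rw [mul_one_div]
      refine hdrop _ (le_of_eq ?_)
      rw [AffineMap.lineMap_apply_module', add_sub_cancel_right, norm_smul,
        Real.norm_of_nonneg (by positivity), inv_div, div_mul_cancel₀ _ hlt.ne']
    refine (hf.le_mul_rpow_of_lineMap_le hc0 (by norm_num) ((one_le_div hr).2 hle) hmid).trans ?_
    gcongr
    linarith
  · have hhalf : (1 / 2 : ℝ) ≤ (1 / 2) ^ (‖x - c‖ / r) := by
      simpa only [Real.rpow_one] using Real.rpow_le_rpow_of_exponent_ge (x := 1 / 2) (by norm_num)
        (by norm_num) ((div_le_one hr).2 hgt.le)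
    nlinarith [hM x]

theorem IsRoughlyIsotropic.exists_decay (hs : IsRoughlyIsotropic Λ s f) (hd : 0 < d)
    (hf : IsLogConcave f) (hsum : ∀ F : Finset (Fin d → ℤ), ∑ k ∈ F, f (fun i => (k i : ℝ)) ≤ 1)
    (hs1 : 1 ≤ cubeRatio d * s) :
    ∃ c, ∀ x, f x ≤
      8 / cubeRatio d ^ d / s ^ d * expProfile (1 / (2 * dropRatio d Λ * d) / s) c x := by
  have hs0 := hs.scale_pos
  have hρ := cubeRatio_pos hd
  have hR : 0 < dropRatio d Λ := dropRatio_pos hd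
  have hbd := hs.le_of_sum_le_one hd hf hsum hs1
  set M := ⨆ x, f x
  have hfM : ∀ x, f x ≤ M := le_ciSup ⟨_, Set.forall_mem_range.2 hbd⟩
  have hMle : M ≤ 4 / (cubeRatio d * s) ^ d := ciSup_le hbd
  have hM0 : 0 < M :=
    have ⟨z, hz⟩ := hf.exists_pos (hs.integral_pos hd hf)
    hz.trans_le (hfM z)
  obtain ⟨z, hz⟩ := exists_lt_of_lt_ciSup (half_lt_self hM0)
  obtain ⟨c, hc, hfar⟩ := hs.exists_center hd hf hM0 hfM hz
  have hdecay := hf.le_half_rpow_of_drop hfM (by positivity : 0 < dropRatio d Λ * s)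
    (by linarith : 0 < f c) fun x hx => (hfar x hx).trans (by linarith)
  refine ⟨c, fun x => ?_⟩
  calc f x ≤ 2 * M * (1 / 2) ^ (‖x - c‖ / (dropRatio d Λ * s)) := hdecay x
    _ ≤ 2 * (4 / (cubeRatio d * s) ^ d) *
          expProfile (1 / (2 * (dropRatio d Λ * s) * d)) c x := by
        gcongr
        exact half_rpow_norm_sub_div_le (by positivity) hd c x
    _ = 8 / cubeRatio d ^ d / s ^ d * expProfile (1 / (2 * dropRatio d Λ * d) / s) c x := by
        rw [mul_pow, div_div, div_div]
        ring_nf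

end Decay

section LatticeSums

theorem tsum_pi_prod_fin {α : Type*} (n : ℕ) (φ : Fin n → α → ENNReal) :
    ∑' k : Fin n → α, ∏ i, φ i (k i) = ∏ i, ∑' t, φ i t := by
  induction n with
  | zero => simp
  | succ n ih =>
    rw [← (Fin.consEquiv fun _ : Fin (n + 1) => α).tsum_eq, Fin.prod_univ_succ, ← ih,
      ← ENNReal.tsum_mul_right]
    simp_rw [← ENNReal.tsum_mul_left]
    rw [← ENNReal.tsum_prod (f := fun a (b : Fin n → α) => φ 0 a * ∏ i, φ i.succ (b i))]
    refine tsum_congr fun p => ?_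
    rw [Fin.prod_univ_succ]
    simp [Fin.consEquiv]

theorem tsum_pi_prod {ι α : Type*} [Fintype ι] (φ : ι → α → ENNReal) :
    ∑' k : ι → α, ∏ i, φ i (k i) = ∏ i, ∑' t, φ i t := by
  classical
  set e := Fintype.equivFin ι
  rw [← (Equiv.arrowCongr e.symm (Equiv.refl α)).tsum_eq, ← e.symm.prod_comp, ← tsum_pi_prod_fin]
  refine tsum_congr fun k => ?_
  rw [← e.symm.prod_comp]
  simp [Equiv.arrowCongr]

theorem hasSum_exp_neg_mul_nat {a : ℝ} (ha : 0 < a) :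
    HasSum (fun n : ℕ => Real.exp (-(a * n))) (1 - Real.exp (-a))⁻¹ := by
  convert hasSum_geometric_of_lt_one (Real.exp_pos (-a)).le
    (Real.exp_lt_one_iff.2 (neg_neg_iff_pos.2 ha)) using 2 with n
  rw [← Real.exp_nat_mul, mul_neg, mul_comm]

theorem hasSum_exp_neg_mul_abs_int {a : ℝ} (ha : 0 < a) :
    HasSum (fun t : ℤ => Real.exp (-(a * |(t : ℝ)|)))
      ((1 - Real.exp (-a))⁻¹ + Real.exp (-a) * (1 - Real.exp (-a))⁻¹) := by
  apply HasSum.of_nat_of_neg_add_one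
  · simpa using hasSum_exp_neg_mul_nat ha
  · refine ((hasSum_exp_neg_mul_nat ha).mul_left (Real.exp (-a))).congr_fun fun n => ?_
    rw [← Real.exp_add]
    congr 1
    push_cast
    rw [abs_neg, abs_of_nonneg (by positivity)]
    ring

theorem inv_one_sub_exp_neg_le {a : ℝ} (ha : 0 < a) : (1 - Real.exp (-a))⁻¹ ≤ 1 + 1 / a := by
  have hexp : Real.exp (-a) * (1 + a) ≤ 1 := by
    rw [Real.exp_neg, inv_mul_le_iff₀ (Real.exp_pos a)]
    linarith [Real.add_one_le_exp a]
  have hlow : a / (1 + a) ≤ 1 - Real.exp (-a) := by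
    rw [div_le_iff₀ (by positivity)]
    linarith
  calc (1 - Real.exp (-a))⁻¹ ≤ (a / (1 + a))⁻¹ := by gcongr
    _ = 1 + 1 / a := by field_simp; ring

theorem tsum_exp_neg_mul_abs_int_le {a : ℝ} (ha : 0 < a) :
    ∑' t : ℤ, ENNReal.ofReal (Real.exp (-(a * |(t : ℝ)|))) ≤
      ENNReal.ofReal (2 * (1 + 1 / a)) := by
  have hsum := hasSum_exp_neg_mul_abs_int ha
  rw [← ENNReal.ofReal_tsum_of_nonneg (fun t => (Real.exp_pos _).le) hsum.summable, hsum.tsum_eq]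
  refine ENNReal.ofReal_le_ofReal ?_
  have hle := inv_one_sub_exp_neg_le ha
  have hlt : Real.exp (-a) < 1 := Real.exp_lt_one_iff.2 (neg_neg_iff_pos.2 ha)
  have hnonneg : 0 ≤ (1 - Real.exp (-a))⁻¹ := inv_nonneg.2 (by linarith)
  linarith [mul_le_of_le_one_left hnonneg hlt.le]

theorem tsum_exp_neg_mul_abs_sub_le {a : ℝ} (ha : 0 < a) (x : ℝ) :
    ∑' t : ℤ, ENNReal.ofReal (Real.exp (-(a * |t - x|))) ≤
      ENNReal.ofReal (Real.exp a * (2 * (1 + 1 / a))) := by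
  have hpt : ∀ t : ℤ, Real.exp (-(a * |((t + ⌊x⌋ : ℤ) : ℝ) - x|)) ≤
      Real.exp a * Real.exp (-(a * |(t : ℝ)|)) := by
    intro t
    have hsplit : (t : ℝ) = (((t + ⌊x⌋ : ℤ) : ℝ) - x) + Int.fract x := by
      rw [← Int.self_sub_floor]
      push_cast
      ring
    have habs : |(t : ℝ)| ≤ |((t + ⌊x⌋ : ℤ) : ℝ) - x| + Int.fract x := by
      rw [← Int.abs_fract (a := x)]
      exact (congrArg abs hsplit).trans_le (abs_add_le _ _)
    rw [← Real.exp_add, Real.exp_le_exp]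
    nlinarith [Int.fract_lt_one x]
  rw [← (Equiv.addRight ⌊x⌋).tsum_eq, ENNReal.ofReal_mul (Real.exp_pos a).le]
  calc _ ≤ ∑' t : ℤ, ENNReal.ofReal (Real.exp a) *
          ENNReal.ofReal (Real.exp (-(a * |(t : ℝ)|))) :=
        ENNReal.tsum_le_tsum fun t => (ENNReal.ofReal_le_ofReal (hpt t)).trans_eq
          (ENNReal.ofReal_mul (Real.exp_pos a).le)
    _ ≤ _ := by
        rw [ENNReal.tsum_mul_left]
        gcongr
        exact tsum_exp_neg_mul_abs_int_le ha

/-- The constant in the bound for exponential sums over the lattice. -/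
noncomputable def expSumConst (b : ℝ) : ℝ := Real.exp b * (2 * (1 + 1 / b))

theorem expSumConst_pos {b : ℝ} (hb : 0 < b) : 0 < expSumConst b := by
  unfold expSumConst
  positivity

theorem tsum_exp_neg_div_mul_abs_sub_le {b s : ℝ} (hb : 0 < b) (hs : 1 ≤ s) (x : ℝ) :
    ∑' t : ℤ, ENNReal.ofReal (Real.exp (-(b / s * |t - x|))) ≤
      ENNReal.ofReal (expSumConst b * s) := by
  have hs0 : 0 < s := by linarith
  refine (tsum_exp_neg_mul_abs_sub_le (div_pos hb hs0) x).trans (ENNReal.ofReal_le_ofReal ?_)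
  calc Real.exp (b / s) * (2 * (1 + 1 / (b / s)))
      ≤ Real.exp b * (2 * (s + s / b)) := by
        rw [one_div_div]
        gcongr
        exact div_le_self hb.le hs
    _ = expSumConst b * s := by
        unfold expSumConst
        ring

theorem tsum_expProfile_le {b s : ℝ} (hb : 0 < b) (hs : 1 ≤ s) {ι : Type*} [Fintype ι]
    (c : ι → ℝ) :
    ∑' k : ι → ℤ, ENNReal.ofReal (expProfile (b / s) c fun i => k i) ≤
      ENNReal.ofReal ((expSumConst b * s) ^ Fintype.card ι) := by
  unfold expProfile
  simp_rw [ENNReal.ofReal_prod_of_nonneg fun _ _ => (Real.exp_pos _).le]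
  rw [tsum_pi_prod fun i (t : ℤ) => ENNReal.ofReal (Real.exp (-(b / s * |t - c i|))),
    ENNReal.ofReal_pow (mul_nonneg (expSumConst_pos hb).le (by linarith))]
  exact Finset.prod_le_pow_card _ _ _ fun i _ => tsum_exp_neg_div_mul_abs_sub_le hb hs (c i)

end LatticeSums

section Lines

variable {d : ℕ}

/-- A lattice point as a vector of real numbers. -/
def castVec (k : Fin d → ℤ) : Fin d → ℝ := fun i => k i

/-- The lattice point with `i`-th coordinate `t` and other coordinates `k`. -/
def lineMk (i : Fin d) (k : {j // j ≠ i} → ℤ) (t : ℤ) : Fin d → ℤ :=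
  (Equiv.funSplitAt i ℤ).symm (t, k)

theorem lineMk_self (i : Fin d) (k : {j // j ≠ i} → ℤ) (t : ℤ) : lineMk i k t i = t := by
  simp [lineMk, Equiv.funSplitAt, Equiv.piSplitAt]

theorem lineMk_of_ne {i j : Fin d} (h : j ≠ i) (k : {j // j ≠ i} → ℤ) (t : ℤ) :
    lineMk i k t j = k ⟨j, h⟩ := by
  simp [lineMk, Equiv.funSplitAt, Equiv.piSplitAt, h]

theorem lineMk_add_single (i : Fin d) (k : {j // j ≠ i} → ℤ) (t : ℤ) :
    lineMk i k t + Pi.single i 1 = lineMk i k (t + 1) := by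
  ext j
  by_cases h : j = i
  · subst h
    simp [lineMk_self]
  · simp [lineMk_of_ne h, h]

theorem castVec_lineMk (i : Fin d) (k : {j // j ≠ i} → ℤ) (t : ℤ) :
    castVec (lineMk i k t) = Function.update (castVec (lineMk i k 0)) i t := by
  ext j
  by_cases h : j = i
  · subst h
    simp [castVec, lineMk_self]
  · simp [castVec, lineMk_of_ne h, h]

theorem tsum_eq_tsum_lineMk (i : Fin d) (ψ : (Fin d → ℤ) → ENNReal) :
    ∑' k, ψ k = ∑' k : {j // j ≠ i} → ℤ, ∑' t, ψ (lineMk i k t) := by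
  rw [← (Equiv.funSplitAt i ℤ).symm.tsum_eq, ENNReal.tsum_prod', ENNReal.tsum_comm]
  rfl

theorem tsum_le_of_lines {b s : ℝ} (hb : 0 < b) (hs : 1 ≤ s) (i : Fin d) (c : Fin d → ℝ)
    (ψ : (Fin d → ℤ) → ENNReal) {β : ℝ} (hβ : 0 ≤ β)
    (h : ∀ k : {j // j ≠ i} → ℤ, ∑' t, ψ (lineMk i k t) ≤
      ENNReal.ofReal (β * expProfile (b / s) (fun j : {j // j ≠ i} => c j) fun j => k j)) :
    ∑' k, ψ k ≤ ENNReal.ofReal (β * (expSumConst b * s) ^ (d - 1)) := by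
  calc ∑' k, ψ k = ∑' k : {j // j ≠ i} → ℤ, ∑' t, ψ (lineMk i k t) := tsum_eq_tsum_lineMk i ψ
    _ ≤ ∑' k : {j // j ≠ i} → ℤ, ENNReal.ofReal β *
          ENNReal.ofReal (expProfile (b / s) (fun j : {j // j ≠ i} => c j) fun j => k j) :=
        ENNReal.tsum_le_tsum fun k => (h k).trans_eq (ENNReal.ofReal_mul hβ)
    _ ≤ ENNReal.ofReal (β * (expSumConst b * s) ^ (d - 1)) := by
        rw [ENNReal.tsum_mul_left, ENNReal.ofReal_mul hβ]
        gcongr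
        simpa [Fintype.card_subtype_compl] using
          tsum_expProfile_le hb hs (fun j : {j // j ≠ i} => c j)

theorem expProfile_lineMk_le {a : ℝ} (ha : 0 ≤ a) (c : Fin d → ℝ) (i : Fin d)
    (k : {j // j ≠ i} → ℤ) (t : ℤ) :
    expProfile a c (castVec (lineMk i k t)) ≤
      expProfile a (fun j : {j // j ≠ i} => c j) fun j => k j := by
  unfold expProfile
  rw [Fintype.prod_eq_mul_prod_subtype_ne _ i]
  calc _ ≤ 1 * ∏ j : {j // j ≠ i}, Real.exp (-(a * |castVec (lineMk i k t) j - c j|)) := by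
        gcongr
        exact Real.exp_le_one_iff.2 (neg_nonpos.2 (by positivity))
    _ = _ := by
        rw [one_mul]
        exact Finset.prod_congr rfl fun j _ => by rw [castVec, lineMk_of_ne j.2]

end Lines

section Unimodal

/-- `q` has no strict interior local minimum: it first increases and then decreases. -/
def IsUnimodal {α : Type*} [Preorder α] (q : α → ℝ) : Prop :=
  ∀ ⦃i j k⦄, i ≤ j → j ≤ k → min (q i) (q k) ≤ q j

theorem IsUnimodal.comp_monotone {α β : Type*} [Preorder α] [Preorder β] {q : α → ℝ}
    (hq : IsUnimodal q) {g : β → α} (hg : Monotone g) : IsUnimodal (q ∘ g) :=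
  fun _ _ _ hij hjk => hq (hg hij) (hg hjk)

theorem IsUnimodal.comp_antitone {α β : Type*} [Preorder α] [Preorder β] {q : α → ℝ}
    (hq : IsUnimodal q) {g : β → α} (hg : Antitone g) : IsUnimodal (q ∘ g) :=
  fun i _ k hij hjk => (min_comm (q (g i)) (q (g k))).trans_le (hq (hg hjk) (hg hij))

theorem IsUnimodal.sum_abs_sub_le {q : ℕ → ℝ} (hq : IsUnimodal q) {B : ℝ} (h0 : ∀ j, 0 ≤ q j)
    (hB : ∀ j, q j ≤ B) (n : ℕ) : ∑ j ∈ Finset.range n, |q (j + 1) - q j| ≤ 2 * B := by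
  -- Up to a maximum the variation is at most the current value; each later step down by `δ`
  -- lowers the first bound by exactly `δ`.
  suffices h : ∑ j ∈ Finset.range n, |q (j + 1) - q j| ≤ 2 * B - q n ∧
      ((∀ j ≤ n, q j ≤ q n) → ∑ j ∈ Finset.range n, |q (j + 1) - q j| ≤ q n) by
    linarith [h.1, h0 n]
  induction n with
  | zero => simpa using ⟨by linarith [h0 0, hB 0], h0 0⟩
  | succ n ih =>
    rw [Finset.sum_range_succ]
    rcases le_or_gt (q (n + 1)) (q n) with hle | hlt
    · rw [abs_of_nonpos (by linarith)]
      refine ⟨by linarith [ih.1], fun hmax => ?_⟩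
      linarith [hmax n (by omega), ih.2 fun j hj => (hmax j (by omega)).trans hle]
    · have hmax : ∀ j ≤ n, q j ≤ q n := fun j hj =>
        (min_le_iff.1 (hq hj n.le_succ)).resolve_right hlt.not_ge
      rw [abs_of_pos (by linarith)]
      exact ⟨by linarith [ih.2 hmax, hB (n + 1)], fun _ => by linarith [ih.2 hmax]⟩

theorem IsUnimodal.tsum_abs_sub_le_nat {q : ℕ → ℝ} (hq : IsUnimodal q) {B : ℝ}
    (h0 : ∀ j, 0 ≤ q j) (hB : ∀ j, q j ≤ B) :
    ∑' n, ENNReal.ofReal |q (n + 1) - q n| ≤ ENNReal.ofReal (2 * B) := by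
  rw [ENNReal.tsum_eq_iSup_nat]
  refine iSup_le fun n => ?_
  rw [← ENNReal.ofReal_sum_of_nonneg fun _ _ => abs_nonneg _]
  exact ENNReal.ofReal_le_ofReal (hq.sum_abs_sub_le h0 hB n)

theorem IsUnimodal.tsum_abs_sub_le {q : ℤ → ℝ} (hq : IsUnimodal q) {B : ℝ} (h0 : ∀ j, 0 ≤ q j)
    (hB : ∀ j, q j ≤ B) : ∑' t, ENNReal.ofReal |q (t + 1) - q t| ≤ ENNReal.ofReal (4 * B) := by
  have hB0 : 0 ≤ B := (h0 0).trans (hB 0)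
  rw [tsum_of_nat_of_neg_add_one ENNReal.summable ENNReal.summable,
    show 4 * B = 2 * B + 2 * B by ring, ENNReal.ofReal_add (by positivity) (by positivity)]
  refine add_le_add ?_ ?_
  · have hright : IsUnimodal fun n : ℕ => q n := hq.comp_monotone Nat.mono_cast
    simpa using hright.tsum_abs_sub_le_nat (fun _ => h0 _) fun _ => hB _
  · have hleft : IsUnimodal fun n : ℕ => q (-n) :=
      hq.comp_antitone fun m n hmn => neg_le_neg (Nat.mono_cast hmn)
    refine (ENNReal.tsum_le_tsum fun n => ?_).trans
      (hleft.tsum_abs_sub_le_nat (fun _ => h0 _) fun _ => hB _)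
    rw [abs_sub_comm]
    push_cast
    simp

theorem IsLogConcave.isUnimodal_lineMk {d : ℕ} {f : (Fin d → ℝ) → ℝ} (hf : IsLogConcave f)
    (i : Fin d) (k : {j // j ≠ i} → ℤ) : IsUnimodal fun t => f (castVec (lineMk i k t)) := by
  intro u v w huv hvw
  have hmem : castVec (lineMk i k v) ∈
      segment ℝ (castVec (lineMk i k u)) (castVec (lineMk i k w)) := by
    simp only [castVec_lineMk i k u, castVec_lineMk i k v, castVec_lineMk i k w,
      ← Pi.image_update_segment]
    refine Set.mem_image_of_mem _ ?_
    rw [segment_eq_Icc (by exact_mod_cast huv.trans hvw)]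
    exact ⟨by exact_mod_cast huv, by exact_mod_cast hvw⟩
  rcases (le_min (hf.nonneg _) (hf.nonneg _)).eq_or_lt with h | h
  · exact h.ge.trans (hf.nonneg _)
  · exact (hf.convex_superlevel h).segment_subset (Set.mem_ofPred.2 (min_le_left _ _))
      (Set.mem_ofPred.2 (min_le_right _ _)) hmem

end Unimodal

section TotalVariation

variable {G : Type*} [AddCommGroup G]

/-- The total variation of `p` with respect to the shift by `v`. -/
noncomputable def shiftVariation (p : G → ℝ) (v : G) : ENNReal :=
  ∑' k, ENNReal.ofReal |p (k + v) - p k|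

theorem shiftVariation_zero (p : G → ℝ) : shiftVariation p 0 = 0 := by
  simp [shiftVariation]

theorem tsum_abs_sub_eq_shiftVariation (p : G → ℝ) (a b : G) :
    ∑' k, ENNReal.ofReal |p (k - a) - p (k - b)| = shiftVariation p (b - a) := by
  rw [shiftVariation, ← (Equiv.addRight b).tsum_eq]
  simp only [Equiv.coe_addRight, add_sub_cancel_right, add_sub_assoc]

theorem shiftVariation_neg (p : G → ℝ) (v : G) : shiftVariation p (-v) = shiftVariation p v := by
  rw [← sub_zero v, neg_sub, ← tsum_abs_sub_eq_shiftVariation, ← tsum_abs_sub_eq_shiftVariation]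
  simp only [abs_sub_comm]

theorem shiftVariation_add_le (p : G → ℝ) (v w : G) :
    shiftVariation p (v + w) ≤ shiftVariation p v + shiftVariation p w := by
  unfold shiftVariation
  rw [← (Equiv.addRight w).tsum_eq fun k => ENNReal.ofReal |p (k + v) - p k|, ← ENNReal.tsum_add]
  refine ENNReal.tsum_le_tsum fun k => ?_
  rw [← ENNReal.ofReal_add (abs_nonneg _) (abs_nonneg _), Equiv.coe_addRight,
    show k + (v + w) = k + w + v by abel]
  exact ENNReal.ofReal_le_ofReal (abs_sub_le _ _ _)

theorem shiftVariation_nsmul_le (p : G → ℝ) (v : G) (n : ℕ) :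
    shiftVariation p (n • v) ≤ n * shiftVariation p v := by
  induction n with
  | zero => simp [shiftVariation_zero]
  | succ n ih =>
    rw [succ_nsmul]
    refine (shiftVariation_add_le p _ _).trans ?_
    push_cast
    rw [add_mul, one_mul]
    gcongr

theorem shiftVariation_zsmul_le (p : G → ℝ) (v : G) (z : ℤ) :
    shiftVariation p (z • v) ≤ z.natAbs * shiftVariation p v := by
  obtain ⟨n, rfl | rfl⟩ := z.eq_nat_or_neg
  · rw [natCast_zsmul, Int.natAbs_natCast]
    exact shiftVariation_nsmul_le p v n
  · rw [neg_zsmul, natCast_zsmul, shiftVariation_neg, Int.natAbs_neg, Int.natAbs_natCast]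
    exact shiftVariation_nsmul_le p v n

theorem shiftVariation_le_of_single {ι : Type*} [Fintype ι] [DecidableEq ι] (p : (ι → ℤ) → ℝ)
    {T : ENNReal} (hT : ∀ i, shiftVariation p (Pi.single i 1) ≤ T) {n : ℕ} {v : ι → ℤ}
    (hv : ∀ i, (v i).natAbs ≤ n) : shiftVariation p v ≤ Fintype.card ι * n * T := by
  calc shiftVariation p v
      = shiftVariation p (∑ i, v i • (Pi.single i 1 : ι → ℤ)) := by
        congr 1
        ext j
        simp [Finset.sum_apply, Pi.single_apply]
    _ ≤ ∑ i, shiftVariation p (v i • (Pi.single i 1 : ι → ℤ)) :=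
        Finset.le_sum_of_subadditive _ (shiftVariation_zero p).le (shiftVariation_add_le p) _ _
    _ ≤ ∑ _i : ι, (n : ENNReal) * T := Finset.sum_le_sum fun i _ =>
        (shiftVariation_zsmul_le p _ _).trans (mul_le_mul' (by exact_mod_cast hv i) (hT i))
    _ = Fintype.card ι * n * T := by simp [mul_assoc]

end TotalVariation

section Decay

variable {d : ℕ} {A b s : ℝ} {c : Fin d → ℝ} {p : (Fin d → ℤ) → ℝ}

/-- Exponential decay of a function on the lattice `ℤ^d` on the scale `s` about the center `c`. -/
def HasDecay (A b s : ℝ) (c : Fin d → ℝ) (p : (Fin d → ℤ) → ℝ) : Prop :=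
  ∀ k, p k ≤ A / s ^ d * expProfile (b / s) c (castVec k)

theorem HasDecay.shiftVariation_single_le (hp : HasDecay A b s c p) (hA : 0 < A) (hb : 0 < b)
    (hs : 1 ≤ s) {f : (Fin d → ℝ) → ℝ} (hf : IsLogConcaveExtension p f) (i : Fin d) :
    shiftVariation p (Pi.single i 1) ≤ ENNReal.ofReal (4 * A * expSumConst b ^ (d - 1) / s) := by
  have : 0 < s := by linarith
  have hline : ∀ k : {j // j ≠ i} → ℤ, ∑' t, ENNReal.ofReal
      |p (lineMk i k t + Pi.single i 1) - p (lineMk i k t)| ≤ ENNReal.ofReal (4 * (A / s ^ d) *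
        expProfile (b / s) (fun j : {j // j ≠ i} => c j) fun j => k j) := by
    intro k
    simp_rw [lineMk_add_single]
    rw [mul_assoc]
    have huni : IsUnimodal fun t => p (lineMk i k t) := by
      simp only [← hf.2]
      exact hf.1.isUnimodal_lineMk i k
    refine huni.tsum_abs_sub_le (fun t => by rw [← hf.2]; exact hf.1.nonneg _)
      fun t => (hp _).trans ?_
    gcongr
    exact expProfile_lineMk_le (by positivity) c i k t
  refine (tsum_le_of_lines hb hs i c _ (by positivity) hline).trans_eq ?_
  obtain ⟨m, rfl⟩ : ∃ m, d = m + 1 := ⟨d - 1, by have := i.pos; omega⟩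
  rw [Nat.add_sub_cancel, mul_pow, pow_succ]
  congr 1
  field_simp

end Decay

section JensenGap

theorem mul_mul_log_sub_log_le {w a m : ℝ} (hw0 : 0 ≤ w) (hw1 : w ≤ 1) (ha : 0 ≤ a)
    (hm : w * a ≤ m) : w * (a * (Real.log a - Real.log m)) ≤ 2 * |a - m| := by
  rcases hw0.eq_or_lt with rfl | hw
  · rw [zero_mul]
    positivity
  rcases ha.eq_or_lt with rfl | ha
  · rw [zero_mul, mul_zero]
    positivity
  have hm0 : 0 < m := lt_of_lt_of_le (by positivity) hm
  rw [← Real.log_div ha.ne' hm0.ne']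
  rcases le_or_gt a m with hle | hlt
  · have hlog : Real.log (a / m) ≤ 0 := Real.log_nonpos (by positivity) ((div_le_one hm0).2 hle)
    exact (mul_nonpos_of_nonneg_of_nonpos hw.le
      (mul_nonpos_of_nonneg_of_nonpos ha.le hlog)).trans (by positivity)
  rw [abs_of_pos (sub_pos.2 hlt)]
  have hlog0 : 0 ≤ Real.log (a / m) := Real.log_nonneg ((one_le_div hm0).2 hlt.le)
  have hlog : Real.log (a / m) ≤ a / m - 1 := Real.log_le_sub_one_of_pos (by positivity)
  have hmlog : m * Real.log (a / m) ≤ a - m := by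
    calc m * Real.log (a / m) ≤ m * (a / m - 1) := by gcongr
      _ = a - m := by field_simp
  have hwlog : w * Real.log (a / m) ≤ 1 := by
    calc w * Real.log (a / m) ≤ w * (a / m - 1) := by gcongr
      _ = w * a / m - w := by ring
      _ ≤ 1 := by linarith [(div_le_one hm0).2 hm]
  calc w * (a * Real.log (a / m))
      = (a - m) * (w * Real.log (a / m)) + w * (m * Real.log (a / m)) := by ring
    _ ≤ (a - m) * 1 + 1 * (m * Real.log (a / m)) := by gcongr
    _ ≤ 2 * (a - m) := by linarith

theorem abs_sub_weightedSum_le {ι : Type*} {K : Finset ι} {w : ι → ℝ} (a : ι → ℝ)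
    (hw : ∀ k ∈ K, 0 ≤ w k) (hw1 : ∑ k ∈ K, w k = 1) (t : ℝ) :
    |t - ∑ l ∈ K, w l * a l| ≤ ∑ l ∈ K, |t - a l| := by
  have hdiff : t - ∑ l ∈ K, w l * a l = ∑ l ∈ K, w l * (t - a l) := by
    simp only [mul_sub, Finset.sum_sub_distrib, ← Finset.sum_mul, hw1, one_mul]
  rw [hdiff]
  refine (Finset.abs_sum_le_sum_abs _ _).trans (Finset.sum_le_sum fun l hl => ?_)
  rw [abs_mul, abs_of_nonneg (hw l hl)]
  exact mul_le_of_le_one_left (abs_nonneg _) (hw1 ▸ Finset.single_le_sum hw hl)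

theorem negMulLog_weightedSum_le {ι : Type*} {K : Finset ι} {w a : ι → ℝ} (hw : ∀ k ∈ K, 0 ≤ w k)
    (hw1 : ∑ k ∈ K, w k = 1) (ha : ∀ k ∈ K, 0 ≤ a k) :
    Real.negMulLog (∑ k ∈ K, w k * a k) ≤
      ∑ k ∈ K, w k * Real.negMulLog (a k) + 2 * ∑ k ∈ K, ∑ l ∈ K, |a k - a l| := by
  set m := ∑ k ∈ K, w k * a k
  have hgap : Real.negMulLog m - ∑ k ∈ K, w k * Real.negMulLog (a k) =
      ∑ k ∈ K, w k * (a k * (Real.log (a k) - Real.log m)) := by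
    have hneg : Real.negMulLog m = ∑ k ∈ K, -(w k * a k * Real.log m) := by
      rw [Real.negMulLog, Finset.sum_neg_distrib, ← Finset.sum_mul, neg_mul]
    rw [hneg, ← Finset.sum_sub_distrib]
    exact Finset.sum_congr rfl fun k _ => by rw [Real.negMulLog]; ring
  have hosc : ∑ k ∈ K, w k * (a k * (Real.log (a k) - Real.log m)) ≤
      ∑ k ∈ K, 2 * ∑ l ∈ K, |a k - a l| := by
    refine Finset.sum_le_sum fun k hk => ?_
    have hterm : w k * a k ≤ m := Finset.single_le_sum (f := fun k => w k * a k)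
      (fun l hl => mul_nonneg (hw l hl) (ha l hl)) hk
    refine (mul_mul_log_sub_log_le (hw k hk) (hw1 ▸ Finset.single_le_sum hw hk) (ha k hk)
      hterm).trans ?_
    gcongr
    exact abs_sub_weightedSum_le a hw hw1 (a k)
  rw [Finset.mul_sum]
  linarith

end JensenGap

section Smoothing

variable {d n : ℕ} {p : (Fin d → ℤ) → ℝ} {u : (Fin d → ℝ) → ENNReal}

/-- The lattice point below `x`. -/
noncomputable def floorVec (x : Fin d → ℝ) : Fin d → ℤ := fun i => ⌊x i⌋

theorem measurable_floorVec : Measurable (floorVec (d := d)) :=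
  measurable_pi_lambda _ fun i => Int.measurable_floor.comp (measurable_pi_apply i)

theorem floorVec_preimage_singleton (k : Fin d → ℤ) :
    floorVec ⁻¹' {k} = Set.univ.pi fun i => Set.Ico (k i : ℝ) (k i + 1) := by
  ext x
  simp [floorVec, funext_iff, Int.floor_eq_iff]

theorem lintegral_comp_floorVec (F : (Fin d → ℤ) → ENNReal) :
    ∫⁻ x : Fin d → ℝ, F (floorVec x) = ∑' k, F k := by
  rw [← lintegral_map (f := F) (measurable_of_countable _) measurable_floorVec,
    lintegral_countable']
  refine tsum_congr fun k => ?_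
  rw [Measure.map_apply measurable_floorVec (measurableSet_singleton k),
    floorVec_preimage_singleton, Real.volume_pi_Ico]
  simp

/-- A probability density on the cube `[0, n]^d` whose lattice translates form a partition of
unity, such as the density of the sum of `n` independent uniform points of the unit cube. -/
structure IsLatticePartition (n : ℕ) (u : (Fin d → ℝ) → ENNReal) : Prop where
  measurable : Measurable u
  lintegral_eq_one : ∫⁻ x, u x = 1
  tsum_eq_one : ∀ x, ∑' k, u (x - castVec k) = 1
  support_subset : Function.support u ⊆ Set.Icc 0 fun _ => (n : ℝ)

/-- The density at `x` of `Y + U` for independent `Y` with mass function `p` on the lattice and `U`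
with Lebesgue density `u`. -/
noncomputable def latticeSmoothing (p : (Fin d → ℤ) → ℝ) (u : (Fin d → ℝ) → ENNReal)
    (x : Fin d → ℝ) : ENNReal :=
  ∑' k, ENNReal.ofReal (p k) * u (x - castVec k)

/-- The lattice points of the cube `[0, n]^d`. -/
noncomputable def latticeBox (d n : ℕ) : Finset (Fin d → ℤ) :=
  Fintype.piFinset fun _ => Finset.Icc 0 (n : ℤ)

theorem card_latticeBox (d n : ℕ) : (latticeBox d n).card = (n + 1) ^ d := by
  simp [latticeBox, Fintype.card_piFinset]

theorem measurable_latticeSmoothing (p : (Fin d → ℤ) → ℝ) (hu : Measurable u) :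
    Measurable (latticeSmoothing p u) :=
  Measurable.tsum fun k => (hu.comp (measurable_id.sub_const (castVec k))).const_mul _

theorem lintegral_latticeSmoothing (p : (Fin d → ℤ) → ℝ) (hu : IsLatticePartition n u) :
    ∫⁻ x, latticeSmoothing p u x = ∑' k, ENNReal.ofReal (p k) := by
  have hshift : ∀ k : Fin d → ℤ, Measurable fun x => u (x - castVec k) := fun k =>
    hu.measurable.comp (measurable_id.sub_const _)
  unfold latticeSmoothing
  rw [lintegral_tsum fun k => ((hshift k).const_mul _).aemeasurable]
  refine tsum_congr fun k => ?_
  rw [lintegral_const_mul _ (hshift k), lintegral_sub_right_eq_self u, hu.lintegral_eq_one, mul_one]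

theorem IsLatticePartition.eq_zero_of_notMem (hu : IsLatticePartition n u) (x : Fin d → ℝ)
    {a : Fin d → ℤ} (ha : a ∉ latticeBox d n) : u (x - castVec (floorVec x - a)) = 0 := by
  contrapose! ha
  have hmem := hu.support_subset ha
  rw [latticeBox, Fintype.mem_piFinset]
  intro i
  have hlow := hmem.1 i
  have hup := hmem.2 i
  simp only [Pi.sub_apply, Pi.zero_apply, castVec, floorVec, Int.cast_sub] at hlow hup
  have hlow' : (-1 : ℝ) < a i := by linarith [Int.lt_floor_add_one (x i)]
  have hup' : (a i : ℝ) ≤ n := by linarith [Int.floor_le (x i)]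
  rw [Finset.mem_Icc]
  exact ⟨by have : -1 < a i := by exact_mod_cast hlow'
            omega, by exact_mod_cast hup'⟩

/-- The weight in `latticeSmoothing` at `x` of the lattice point `a` steps below `x`. -/
noncomputable def partitionWeight (u : (Fin d → ℝ) → ENNReal) (x : Fin d → ℝ)
    (a : Fin d → ℤ) : ℝ :=
  (u (x - castVec (floorVec x - a))).toReal

theorem partitionWeight_nonneg (u : (Fin d → ℝ) → ENNReal) (x : Fin d → ℝ) (a : Fin d → ℤ) :
    0 ≤ partitionWeight u x a :=
  ENNReal.toReal_nonneg

theorem IsLatticePartition.latticeSmoothing_eq (hu : IsLatticePartition n u) (hp : ∀ k, 0 ≤ p k)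
    (x : Fin d → ℝ) : latticeSmoothing p u x = ENNReal.ofReal
      (∑ a ∈ latticeBox d n, partitionWeight u x a * p (floorVec x - a)) := by
  have hne_top : ∀ k, u (x - castVec k) ≠ ⊤ := fun k =>
    ((ENNReal.le_tsum (f := fun k => u (x - castVec k)) k).trans_eq (hu.tsum_eq_one x)).trans_lt
      ENNReal.one_lt_top |>.ne
  rw [latticeSmoothing, ← (Equiv.subLeft (floorVec x)).tsum_eq]
  simp only [Equiv.subLeft_apply]
  rw [tsum_eq_sum fun a ha => by rw [hu.eq_zero_of_notMem x ha, mul_zero],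
    ENNReal.ofReal_sum_of_nonneg fun a _ => mul_nonneg (partitionWeight_nonneg u x a) (hp _)]
  refine Finset.sum_congr rfl fun a _ => ?_
  rw [mul_comm, ENNReal.ofReal_mul (partitionWeight_nonneg u x a), partitionWeight,
    ENNReal.ofReal_toReal (hne_top _)]

theorem IsLatticePartition.toReal_latticeSmoothing (hu : IsLatticePartition n u)
    (hp : ∀ k, 0 ≤ p k) (x : Fin d → ℝ) : (latticeSmoothing p u x).toReal =
      ∑ a ∈ latticeBox d n, partitionWeight u x a * p (floorVec x - a) := by
  rw [hu.latticeSmoothing_eq hp, ENNReal.toReal_ofReal (Finset.sum_nonneg fun a _ =>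
    mul_nonneg (partitionWeight_nonneg u x a) (hp _))]

theorem IsLatticePartition.sum_partitionWeight (hu : IsLatticePartition n u) (x : Fin d → ℝ) :
    ∑ a ∈ latticeBox d n, partitionWeight u x a = 1 := by
  have h := hu.toReal_latticeSmoothing (p := fun _ => 1) (fun _ => zero_le_one) x
  simpa [latticeSmoothing, hu.tsum_eq_one x] using h.symm

/-- The total oscillation of `p` over the lattice cube of side `n` below the lattice point `m`. -/
noncomputable def boxOscillation (n : ℕ) (p : (Fin d → ℤ) → ℝ) (m : Fin d → ℤ) : ENNReal :=
  ∑ a ∈ latticeBox d n, ∑ b ∈ latticeBox d n, ENNReal.ofReal |p (m - a) - p (m - b)|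

theorem tsum_boxOscillation_le (n : ℕ) {T : ENNReal}
    (hT : ∀ i, shiftVariation p (Pi.single i 1) ≤ T) :
    ∑' m, boxOscillation n p m ≤ ((n + 1) ^ d) ^ 2 * (d * n * T) := by
  have hvar : ∀ a ∈ latticeBox d n, ∀ b ∈ latticeBox d n,
      ∑' m, ENNReal.ofReal |p (m - a) - p (m - b)| ≤ d * n * T := by
    intro a ha b hb
    rw [tsum_abs_sub_eq_shiftVariation]
    refine (shiftVariation_le_of_single p hT fun i => ?_).trans_eq (by rw [Fintype.card_fin])
    have hai := Finset.mem_Icc.1 (Fintype.mem_piFinset.1 ha i)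
    have hbi := Finset.mem_Icc.1 (Fintype.mem_piFinset.1 hb i)
    rw [Pi.sub_apply]
    omega
  unfold boxOscillation
  rw [Summable.tsum_finsetSum fun _ _ => ENNReal.summable]
  simp_rw [Summable.tsum_finsetSum fun _ _ => ENNReal.summable]
  calc _ ≤ ∑ _a ∈ latticeBox d n, ∑ _b ∈ latticeBox d n, (d * n * T : ENNReal) :=
        Finset.sum_le_sum fun a ha => Finset.sum_le_sum fun b hb => hvar a ha b hb
    _ = ((n + 1) ^ d) ^ 2 * (d * n * T) := by
        simp only [Finset.sum_const, nsmul_eq_mul, card_latticeBox]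
        push_cast
        ring

theorem IsLatticePartition.latticeSmoothing_negMulLog_le (hu : IsLatticePartition n u)
    (hp0 : ∀ k, 0 ≤ p k) (hp1 : ∀ k, p k ≤ 1) (x : Fin d → ℝ) :
    latticeSmoothing (fun k => Real.negMulLog (p k)) u x ≤
      ENNReal.ofReal (Real.negMulLog (latticeSmoothing p u x).toReal) := by
  rw [hu.toReal_latticeSmoothing hp0,
    hu.latticeSmoothing_eq fun k => Real.negMulLog_nonneg (hp0 k) (hp1 k)]
  exact ENNReal.ofReal_le_ofReal (Real.concaveOn_negMulLog.le_map_sum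
    (fun a _ => partitionWeight_nonneg u x a) (hu.sum_partitionWeight x) fun a _ => hp0 _)

theorem IsLatticePartition.negMulLog_latticeSmoothing_le (hu : IsLatticePartition n u)
    (hp0 : ∀ k, 0 ≤ p k) (hp1 : ∀ k, p k ≤ 1) (x : Fin d → ℝ) :
    ENNReal.ofReal (Real.negMulLog (latticeSmoothing p u x).toReal) ≤
      latticeSmoothing (fun k => Real.negMulLog (p k)) u x +
        2 * boxOscillation n p (floorVec x) := by
  rw [hu.toReal_latticeSmoothing hp0,
    hu.latticeSmoothing_eq fun k => Real.negMulLog_nonneg (hp0 k) (hp1 k)]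
  have hgap := negMulLog_weightedSum_le (a := fun a => p (floorVec x - a))
    (fun a _ => partitionWeight_nonneg u x a) (hu.sum_partitionWeight x) fun a _ => hp0 _
  refine (ENNReal.ofReal_le_ofReal hgap).trans (ENNReal.ofReal_add_le.trans_eq ?_)
  rw [ENNReal.ofReal_mul zero_le_two, ENNReal.ofReal_ofNat, boxOscillation,
    ENNReal.ofReal_sum_of_nonneg fun a _ => Finset.sum_nonneg fun _ _ => abs_nonneg _]
  simp_rw [ENNReal.ofReal_sum_of_nonneg fun _ _ => abs_nonneg _]

theorem IsLatticePartition.toReal_latticeSmoothing_le_one (hu : IsLatticePartition n u)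
    (hp1 : ∀ k, p k ≤ 1) (x : Fin d → ℝ) : (latticeSmoothing p u x).toReal ≤ 1 := by
  refine ENNReal.toReal_le_of_le_ofReal zero_le_one ?_
  rw [ENNReal.ofReal_one, ← hu.tsum_eq_one x]
  exact ENNReal.tsum_le_tsum fun k =>
    mul_le_of_le_one_left zero_le (ENNReal.ofReal_le_one.2 (hp1 k))

/-- The constant in the bound for the entropy gap under smoothing by a lattice partition of unity
supported in `[0, n]^d`. -/
noncomputable def smoothingConst (d n : ℕ) : ℝ := 2 * ((n + 1) ^ d) ^ 2 * d * n

theorem smoothingConst_nonneg (d n : ℕ) : 0 ≤ smoothingConst d n := by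
  unfold smoothingConst
  positivity

theorem IsLatticePartition.lintegral_negMulLog_le (hu : IsLatticePartition n u)
    (hp0 : ∀ k, 0 ≤ p k) (hp1 : ∀ k, p k ≤ 1) (hH : Summable fun k => Real.negMulLog (p k)) {τ : ℝ}
    (hτ0 : 0 ≤ τ) (hτ : ∀ i, shiftVariation p (Pi.single i 1) ≤ ENNReal.ofReal τ) :
    ∫⁻ x, ENNReal.ofReal (Real.negMulLog (latticeSmoothing p u x).toReal) ≤
      ENNReal.ofReal (∑' k, Real.negMulLog (p k) + smoothingConst d n * τ) := by
  have hη0 : ∀ k, 0 ≤ Real.negMulLog (p k) := fun k => Real.negMulLog_nonneg (hp0 k) (hp1 k)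
  have hconst : 2 * (((n + 1 : ENNReal) ^ d) ^ 2 * (d * n * ENNReal.ofReal τ)) =
      ENNReal.ofReal (smoothingConst d n * τ) := by
    have hcast : smoothingConst d n = ((2 * ((n + 1) ^ d) ^ 2 * d * n : ℕ) : ℝ) := by
      rw [smoothingConst]
      push_cast
      rfl
    rw [hcast, ENNReal.ofReal_mul (Nat.cast_nonneg _), ENNReal.ofReal_natCast]
    push_cast
    ring
  calc _ ≤ ∫⁻ x, (latticeSmoothing (fun k => Real.negMulLog (p k)) u x +
          2 * boxOscillation n p (floorVec x)) :=
        lintegral_mono (hu.negMulLog_latticeSmoothing_le hp0 hp1)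
    _ = ∑' k, ENNReal.ofReal (Real.negMulLog (p k)) + 2 * ∑' m, boxOscillation n p m := by
        rw [lintegral_add_left (measurable_latticeSmoothing _ hu.measurable),
          lintegral_latticeSmoothing _ hu, lintegral_const_mul' _ _ ENNReal.ofNat_ne_top,
          lintegral_comp_floorVec]
    _ ≤ _ := by
        rw [ENNReal.ofReal_add (tsum_nonneg hη0) (mul_nonneg (smoothingConst_nonneg d n) hτ0),
          ENNReal.ofReal_tsum_of_nonneg hη0 hH, ← hconst]
        gcongr
        exact tsum_boxOscillation_le n hτ

theorem IsLatticePartition.integrable_negMulLog (hu : IsLatticePartition n u)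
    (hp0 : ∀ k, 0 ≤ p k) (hp1 : ∀ k, p k ≤ 1) (hH : Summable fun k => Real.negMulLog (p k)) {τ : ℝ}
    (hτ0 : 0 ≤ τ) (hτ : ∀ i, shiftVariation p (Pi.single i 1) ≤ ENNReal.ofReal τ) :
    Integrable fun x => Real.negMulLog (latticeSmoothing p u x).toReal := by
  refine ⟨(Real.continuous_negMulLog.measurable.comp (measurable_latticeSmoothing p
    hu.measurable).ennreal_toReal).aestronglyMeasurable, ?_⟩
  rw [hasFiniteIntegral_iff_ofReal (Filter.Eventually.of_forall fun x => Real.negMulLog_nonneg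
    ENNReal.toReal_nonneg (hu.toReal_latticeSmoothing_le_one hp1 x))]
  exact (hu.lintegral_negMulLog_le hp0 hp1 hH hτ0 hτ).trans_lt ENNReal.ofReal_lt_top

theorem IsLatticePartition.abs_integral_negMulLog_sub_tsum_le (hu : IsLatticePartition n u)
    (hp0 : ∀ k, 0 ≤ p k) (hp1 : ∀ k, p k ≤ 1) (hH : Summable fun k => Real.negMulLog (p k)) {τ : ℝ}
    (hτ0 : 0 ≤ τ) (hτ : ∀ i, shiftVariation p (Pi.single i 1) ≤ ENNReal.ofReal τ) :
    |(∫ x, Real.negMulLog (latticeSmoothing p u x).toReal) - ∑' k, Real.negMulLog (p k)| ≤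
      smoothingConst d n * τ := by
  have hη0 : ∀ k, 0 ≤ Real.negMulLog (p k) := fun k => Real.negMulLog_nonneg (hp0 k) (hp1 k)
  have hint := hu.integrable_negMulLog hp0 hp1 hH hτ0 hτ
  have hnonneg : ∀ x, 0 ≤ Real.negMulLog (latticeSmoothing p u x).toReal := fun x =>
    Real.negMulLog_nonneg ENNReal.toReal_nonneg (hu.toReal_latticeSmoothing_le_one hp1 x)
  have hofReal := ofReal_integral_eq_lintegral_ofReal hint (Filter.Eventually.of_forall hnonneg)
  have hlow : ∑' k, Real.negMulLog (p k) ≤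
      ∫ x, Real.negMulLog (latticeSmoothing p u x).toReal := by
    rw [← ENNReal.ofReal_le_ofReal_iff (integral_nonneg hnonneg), hofReal,
      ENNReal.ofReal_tsum_of_nonneg hη0 hH, ← lintegral_latticeSmoothing _ hu]
    exact lintegral_mono (hu.latticeSmoothing_negMulLog_le hp0 hp1)
  have hup : ∫ x, Real.negMulLog (latticeSmoothing p u x).toReal ≤
      ∑' k, Real.negMulLog (p k) + smoothingConst d n * τ := by
    rw [← ENNReal.ofReal_le_ofReal_iff (add_nonneg (tsum_nonneg hη0)
      (mul_nonneg (smoothingConst_nonneg d n) hτ0)), hofReal]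
    exact hu.lintegral_negMulLog_le hp0 hp1 hH hτ0 hτ
  rw [abs_of_nonneg (sub_nonneg.2 hlow)]
  linarith

end Smoothing

section Convolution

theorem conv_withDensity {G : Type*} [AddCommGroup G] [MeasurableSpace G] [MeasurableAdd₂ G]
    [MeasurableSub₂ G] (ν μ : Measure G) [SFinite ν] [SFinite μ] [μ.IsAddRightInvariant]
    {u : G → ENNReal} (hu : Measurable u) :
    ν ∗ μ.withDensity u = μ.withDensity fun x => ∫⁻ w, u (x - w) ∂ν := by
  ext s hs
  have hind : Measurable (s.indicator (1 : G → ENNReal)) := measurable_one.indicator hs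
  have hshift : ∀ w, ∫⁻ v, s.indicator 1 (w + v) ∂μ.withDensity u =
      ∫⁻ x, u (x - w) * s.indicator 1 x ∂μ := by
    intro w
    rw [lintegral_withDensity_eq_lintegral_mul _ hu (g := fun v => s.indicator 1 (w + v))
        (hind.comp (measurable_const_add w)),
      ← lintegral_add_right_eq_self (fun x => u (x - w) * s.indicator 1 x) w]
    simp [add_comm w]
  have hjoint : Measurable fun q : G × G => u (q.2 - q.1) * s.indicator 1 q.2 :=
    (hu.comp (measurable_snd.sub measurable_fst)).mul (hind.comp measurable_snd)
  rw [← lintegral_indicator_one hs, Measure.lintegral_conv hind, withDensity_apply _ hs,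
    ← lintegral_indicator hs]
  simp_rw [hshift]
  rw [lintegral_lintegral_swap hjoint.aemeasurable]
  refine lintegral_congr fun x => ?_
  by_cases hx : x ∈ s <;> simp [hx]

theorem isLatticePartition_lintegral_sub {d m : ℕ} (ν : Measure (Fin d → ℝ))
    [IsProbabilityMeasure ν] (hν : ∀ᵐ w ∂ν, w ∈ Set.Icc 0 fun _ => (m : ℝ)) {n : ℕ}
    {u : (Fin d → ℝ) → ENNReal} (hu : IsLatticePartition n u) :
    IsLatticePartition (m + n) fun x => ∫⁻ w, u (x - w) ∂ν where
  measurable := (hu.measurable.comp (measurable_fst.sub measurable_snd)).lintegral_prod_right'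
  lintegral_eq_one := by
    rw [lintegral_lintegral_swap (f := fun x w => u (x - w))
      (hu.measurable.comp (measurable_fst.sub measurable_snd)).aemeasurable]
    simp [lintegral_sub_right_eq_self, hu.lintegral_eq_one]
  tsum_eq_one x := by
    rw [← lintegral_tsum (f := fun k w => u (x - castVec k - w)) fun k =>
      (hu.measurable.comp (measurable_const_sub _)).aemeasurable]
    simp [sub_right_comm x, hu.tsum_eq_one]
  support_subset x hx := by
    obtain ⟨w, hux, hw⟩ := ((frequently_ae_iff.2 fun hzero => hx
      (lintegral_eq_zero_of_ae_eq_zero hzero)).and_eventually hν).exists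
    have hxw := hu.support_subset hux
    refine ⟨fun i => ?_, fun i => ?_⟩
    · simpa using add_nonneg (hxw.1 i) (hw.1 i)
    · have := add_le_add (hw.2 i) (hxw.2 i)
      simpa using this

theorem isLatticePartition_unitCube (d : ℕ) :
    IsLatticePartition 1 ((floorVec ⁻¹' {0}).indicator (1 : (Fin d → ℝ) → ENNReal)) where
  measurable := measurable_one.indicator (measurable_floorVec (measurableSet_singleton 0))
  lintegral_eq_one := by
    rw [lintegral_indicator_one (measurable_floorVec (measurableSet_singleton 0)),
      floorVec_preimage_singleton, Real.volume_pi_Ico]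
    simp
  tsum_eq_one x := by
    have hfloor : ∀ k, floorVec (x - castVec k) = floorVec x - k := fun k => by
      ext i
      simp [floorVec, castVec]
    have hsingle : ∀ k, (floorVec ⁻¹' {0}).indicator (1 : (Fin d → ℝ) → ENNReal) (x - castVec k) =
        if k = floorVec x then 1 else 0 := fun k => by
      split_ifs with hk
      · exact Set.indicator_of_mem (by simp [hfloor, hk]) _
      · exact Set.indicator_of_notMem (by simpa [hfloor, sub_eq_zero, eq_comm] using hk) _
    simp_rw [hsingle]
    exact tsum_ite_eq _ _
  support_subset x hx := by
    have hmem : x ∈ floorVec ⁻¹' {0} := Set.mem_of_indicator_ne_zero hx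
    rw [floorVec_preimage_singleton] at hmem
    refine ⟨fun i => ?_, fun i => ?_⟩
    · simpa using (hmem i trivial).1
    · simpa using (hmem i trivial).2.le

theorem restrict_Icc_eq_withDensity (d : ℕ) :
    (volume : Measure (Fin d → ℝ)).restrict (Set.Icc 0 1) =
      volume.withDensity ((floorVec ⁻¹' {0}).indicator 1) := by
  rw [withDensity_indicator_one (measurable_floorVec (measurableSet_singleton 0)),
    floorVec_preimage_singleton]
  simp only [Pi.zero_apply, Int.cast_zero, zero_add]
  exact (Measure.restrict_congr_set (Measure.univ_pi_Ico_ae_eq_Icc (f := fun _ => 0)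
    (g := fun _ => 1))).symm

end Convolution

section RandomVectors

variable {Ω : Type*} [MeasurableSpace Ω] {P : Measure Ω} {d : ℕ}

theorem map_uniform {V : Ω → Fin d → ℝ} (hV : pdf.IsUniform V (Set.Icc 0 1) P volume) :
    P.map V = volume.restrict (Set.Icc 0 1) := by
  rw [pdf.IsUniform] at hV
  rw [hV, ProbabilityTheory.cond, Real.volume_Icc_pi]
  simp

theorem ae_sum_mem_Icc {ι : Type*} {U : ι → Ω → Fin d → ℝ} (hU : ∀ i, Measurable (U i))
    (hUu : ∀ i, pdf.IsUniform (U i) (Set.Icc 0 1) P volume) (s : Finset ι) :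
    ∀ᵐ ω ∂P, ∑ i ∈ s, U i ω ∈ Set.Icc 0 fun _ => (s.card : ℝ) := by
  have hcube : ∀ i ∈ s, ∀ᵐ ω ∂P, U i ω ∈ Set.Icc (0 : Fin d → ℝ) 1 := fun i _ => by
    refine ae_of_ae_map (hU i).aemeasurable (p := fun y => y ∈ Set.Icc (0 : Fin d → ℝ) 1) ?_
    rw [map_uniform (hUu i)]
    exact ae_restrict_mem measurableSet_Icc
  filter_upwards [(ae_ball_iff s.countable_toSet).2 hcube] with ω hω
  refine ⟨Finset.sum_nonneg fun i hi => (hω i hi).1, ?_⟩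
  refine (Finset.sum_le_sum fun i hi => (hω i hi).2).trans_eq ?_
  ext j
  simp

theorem exists_isLatticePartition_map_sum [IsProbabilityMeasure P] {ι : Type*} [Fintype ι]
    [Nonempty ι] {U : ι → Ω → Fin d → ℝ} (hU : ∀ i, Measurable (U i)) (hUi : iIndepFun U P)
    (hUu : ∀ i, pdf.IsUniform (U i) (Set.Icc 0 1) P volume) :
    ∃ u, IsLatticePartition (Fintype.card ι) u ∧
      P.map (fun ω => ∑ i, U i ω) = volume.withDensity u := by
  classical
  obtain ⟨i₀⟩ := ‹Nonempty ι›
  set W : Ω → Fin d → ℝ := fun ω => ∑ i ∈ Finset.univ.erase i₀, U i ω with hW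
  have hWm : Measurable W := Finset.measurable_fun_sum _ fun i _ => hU i
  have : IsProbabilityMeasure (P.map W) := Measure.isProbabilityMeasure_map hWm.aemeasurable
  have hmem : ∀ᵐ w ∂P.map W, w ∈ Set.Icc 0 fun _ => ((Finset.univ.erase i₀).card : ℝ) :=
    (ae_map_iff hWm.aemeasurable measurableSet_Icc).2 (ae_sum_mem_Icc hU hUu _)
  have hindep : IndepFun W (U i₀) P := by
    convert hUi.indepFun_finsetSum_of_notMem hU (Finset.notMem_erase i₀ Finset.univ) using 1
    ext ω
    simp [hW]
  have hsplit : (fun ω => ∑ i, U i ω) = W + U i₀ := by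
    ext1 ω
    exact (Finset.sum_erase_add _ _ (Finset.mem_univ i₀)).symm
  have hpart := isLatticePartition_lintegral_sub (P.map W) hmem (isLatticePartition_unitCube d)
  rw [Finset.card_erase_add_one (Finset.mem_univ i₀), Finset.card_univ] at hpart
  refine ⟨_, hpart, ?_⟩
  rw [hsplit, hindep.map_add_eq_map_conv_map hWm (hU i₀), map_uniform (hUu i₀),
    restrict_Icc_eq_withDensity, conv_withDensity _ _ (isLatticePartition_unitCube d).measurable]

theorem map_castVec_add [IsFiniteMeasure P] {S : Ω → Fin d → ℤ} {V : Ω → Fin d → ℝ}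
    {u : (Fin d → ℝ) → ENNReal} (hS : Measurable S) (hV : Measurable V) (hSV : IndepFun S V P)
    (hu : Measurable u) (hVu : P.map V = volume.withDensity u) :
    P.map (fun ω => castVec (S ω) + V ω) = volume.withDensity (latticeSmoothing (pmf P S) u) := by
  have hcast : Measurable (castVec (d := d)) := measurable_of_countable _
  have hindep : IndepFun (castVec ∘ S) V P := hSV.comp hcast measurable_id
  have hsum := hindep.map_add_eq_map_conv_map (hcast.comp hS) hV
  rw [hVu, conv_withDensity _ _ hu, ← Measure.map_map hcast hS] at hsum
  refine hsum.trans ?_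
  congr 1
  ext x
  rw [lintegral_map (f := fun w => u (x - w)) (hu.comp (measurable_const_sub x)) hcast,
    lintegral_countable']
  exact tsum_congr fun k => by simp [pmf, mul_comm]

theorem exists_map_smoothedSum_eq [IsProbabilityMeasure P] {n : ℕ} (hn : 0 < n)
    {X : Fin n → Ω → Fin d → ℤ} {U : Fin n → Ω → Fin d → ℝ} (hX : ∀ i, Measurable (X i))
    (hU : ∀ i, Measurable (U i)) (hUi : iIndepFun U P)
    (hUu : ∀ i, pdf.IsUniform (U i) (Set.Icc 0 1) P volume)
    (hXU : IndepFun (fun ω i => X i ω) (fun ω i => U i ω) P) :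
    ∃ u, IsLatticePartition n u ∧ P.map (smoothedSum X U) =
      volume.withDensity (latticeSmoothing (pmf P (latticeSum X)) u) := by
  have : Nonempty (Fin n) := ⟨⟨0, hn⟩⟩
  obtain ⟨u, hu, hlaw⟩ := exists_isLatticePartition_map_sum hU hUi hUu
  rw [Fintype.card_fin] at hu
  have hindep : IndepFun (latticeSum X) (fun ω => ∑ i, U i ω) P :=
    hXU.comp (φ := fun x : Fin n → Fin d → ℤ => ∑ i, x i)
      (ψ := fun y : Fin n → Fin d → ℝ => ∑ i, y i)
      (Finset.measurable_fun_sum _ fun i _ => measurable_pi_apply i)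
      (Finset.measurable_fun_sum _ fun i _ => measurable_pi_apply i)
  have hsum : smoothedSum X U = fun ω => castVec (latticeSum X ω) + ∑ i, U i ω := by
    ext ω j
    simp [smoothedSum, castVec]
  refine ⟨u, hu, ?_⟩
  rw [hsum]
  exact map_castVec_add (Finset.measurable_fun_sum _ fun i _ => hX i)
    (Finset.measurable_fun_sum _ fun i _ => hU i) hindep hu.measurable hlaw

end RandomVectors

section MassFunction

variable {Ω : Type*} [MeasurableSpace Ω] {P : Measure Ω} {d : ℕ} {X : Ω → Fin d → ℤ}

theorem pmf_nonneg (k : Fin d → ℤ) : 0 ≤ pmf P X k := measureReal_nonneg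

theorem ofReal_pmf [IsFiniteMeasure P] (k : Fin d → ℤ) :
    ENNReal.ofReal (pmf P X k) = P.map X {k} :=
  ofReal_measureReal

theorem hasSum_mul_pmf (hX : Measurable X) {g : (Fin d → ℤ) → ℝ}
    (hg : Integrable (fun ω => g (X ω)) P) :
    HasSum (fun k => g k * pmf P X k) (∫ ω, g (X ω) ∂P) := by
  have hmeas : AEStronglyMeasurable g (P.map X) :=
    (measurable_of_countable g).aestronglyMeasurable
  have hmap : Integrable g (P.map X) := (integrable_map_measure hmeas hX.aemeasurable).2 hg
  rw [← integral_map hX.aemeasurable hmeas]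
  rw [← Measure.sum_smul_dirac (P.map X)] at hmap ⊢
  refine (hasSum_integral_measure hmap).congr_fun fun k => ?_
  rw [integral_smul_measure, integral_dirac, smul_eq_mul, mul_comm, pmf, measureReal_def]

variable [IsProbabilityMeasure P]

theorem pmf_le_one (hX : Measurable X) (k : Fin d → ℤ) : pmf P X k ≤ 1 := by
  have : IsProbabilityMeasure (P.map X) := Measure.isProbabilityMeasure_map hX.aemeasurable
  exact measureReal_le_one

theorem hasSum_pmf (hX : Measurable X) : HasSum (pmf P X) 1 := by
  simpa using hasSum_mul_pmf (P := P) hX (g := fun _ => 1) (by simp)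

theorem exists_pmf_pos (hX : Measurable X) : ∃ k, 0 < pmf P X k := by
  by_contra! hle
  have hzero : pmf P X = 0 := funext fun k => le_antisymm (hle k) (pmf_nonneg k)
  have hsum := hasSum_pmf (P := P) hX
  rw [hzero] at hsum
  exact zero_ne_one (hasSum_zero.unique hsum)

theorem discreteCovMatrix_pmf (hX : Measurable X)
    (hL : ∀ j, MemLp (fun ω => (X ω j : ℝ)) 2 P) (i j : Fin d) :
    discreteCovMatrix (pmf P X) i j =
      cov[fun ω => (X ω i : ℝ), fun ω => (X ω j : ℝ); P] := by
  have hmean : ∀ j, ∑' k : Fin d → ℤ, (k j : ℝ) * pmf P X k = ∫ ω, (X ω j : ℝ) ∂P := fun j =>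
    (hasSum_mul_pmf hX (g := fun k => (k j : ℝ)) ((hL j).integrable one_le_two)).tsum_eq
  have hprod : ∑' k : Fin d → ℤ, (k i : ℝ) * (k j : ℝ) * pmf P X k =
      ∫ ω, (X ω i : ℝ) * (X ω j : ℝ) ∂P :=
    (hasSum_mul_pmf hX (g := fun k => (k i : ℝ) * (k j : ℝ))
      ((hL i).integrable_mul (hL j))).tsum_eq
  rw [covariance_eq_sub (hL i) (hL j), discreteCovMatrix, Matrix.of_apply,
    (hasSum_pmf hX).tsum_eq, hmean, hmean, hprod]
  simp

end MassFunction

section DecayMoments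

variable {Ω : Type*} [MeasurableSpace Ω] {P : Measure Ω} {d : ℕ} {X : Ω → Fin d → ℤ}
  {A b s : ℝ} {c : Fin d → ℝ}

theorem sq_sub_mul_expProfile_le {ι : Type*} [Fintype ι] {a : ℝ} (ha : 0 < a) (c x : ι → ℝ)
    (j : ι) : (x j - c j) ^ 2 * expProfile a c x ≤ 8 / a ^ 2 * expProfile (a / 2) c x := by
  set t := ∑ i, |x i - c i|
  have : 0 ≤ t := Finset.sum_nonneg fun i _ => abs_nonneg _
  have hexp : (a / 2 * t) ^ 2 / 2 ≤ Real.exp (a / 2 * t) := by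
    have : 0 ≤ a / 2 * t := by positivity
    linarith [Real.quadratic_le_exp_of_nonneg this]
  have hsq : (x j - c j) ^ 2 ≤ 8 / a ^ 2 * Real.exp (a / 2 * t) := by
    calc (x j - c j) ^ 2 = |x j - c j| ^ 2 := (sq_abs _).symm
      _ ≤ t ^ 2 := by
        gcongr
        exact Finset.single_le_sum (f := fun i => |x i - c i|) (fun i _ => abs_nonneg _)
          (Finset.mem_univ j)
      _ = 8 / a ^ 2 * ((a / 2 * t) ^ 2 / 2) := by
        field_simp
        norm_num
      _ ≤ 8 / a ^ 2 * Real.exp (a / 2 * t) := by gcongr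
  rw [expProfile_eq_exp, expProfile_eq_exp]
  calc (x j - c j) ^ 2 * Real.exp (-(a * t))
      ≤ 8 / a ^ 2 * Real.exp (a / 2 * t) * Real.exp (-(a * t)) := by gcongr
    _ = 8 / a ^ 2 * Real.exp (-(a / 2 * t)) := by
        rw [mul_assoc, ← Real.exp_add]
        ring_nf

/-- Up to the factor `s ^ 2`, a bound for the coordinate variances of a random vector whose mass
function has decay `HasDecay A b s c`. -/
noncomputable def varianceConst (d : ℕ) (A b : ℝ) : ℝ := 8 * A * expSumConst (b / 2) ^ d / b ^ 2

theorem varianceConst_pos (d : ℕ) (hA : 0 < A) (hb : 0 < b) : 0 < varianceConst d A b := by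
  have := expSumConst_pos (half_pos hb)
  unfold varianceConst
  positivity

theorem HasDecay.tsum_sq_mul_le {p : (Fin d → ℤ) → ℝ} (hp : HasDecay A b s c p) (hA : 0 < A)
    (hb : 0 < b) (hs : 1 ≤ s) (j : Fin d) :
    ∑' k : Fin d → ℤ, ENNReal.ofReal ((k j - c j) ^ 2 * p k) ≤
      ENNReal.ofReal (varianceConst d A b * s ^ 2) := by
  have : 0 < s := by linarith
  have hterm : ∀ k : Fin d → ℤ, (k j - c j) ^ 2 * p k ≤
      A / s ^ d * (8 / (b / s) ^ 2) * expProfile (b / 2 / s) c (castVec k) := by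
    intro k
    calc (k j - c j) ^ 2 * p k
        ≤ (k j - c j) ^ 2 * (A / s ^ d * expProfile (b / s) c (castVec k)) :=
          mul_le_mul_of_nonneg_left (hp k) (sq_nonneg _)
      _ = A / s ^ d * ((castVec k j - c j) ^ 2 * expProfile (b / s) c (castVec k)) := by
          rw [castVec]
          ring
      _ ≤ A / s ^ d * (8 / (b / s) ^ 2 * expProfile (b / s / 2) c (castVec k)) :=
          mul_le_mul_of_nonneg_left (sq_sub_mul_expProfile_le (by positivity) c _ j)
            (by positivity)
      _ = _ := by rw [mul_assoc, div_right_comm b s 2]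
  calc _ ≤ ∑' k : Fin d → ℤ, ENNReal.ofReal (A / s ^ d * (8 / (b / s) ^ 2)) *
        ENNReal.ofReal (expProfile (b / 2 / s) c (castVec k)) :=
        ENNReal.tsum_le_tsum fun k => (ENNReal.ofReal_le_ofReal (hterm k)).trans_eq
          (ENNReal.ofReal_mul (by positivity))
    _ ≤ ENNReal.ofReal (A / s ^ d * (8 / (b / s) ^ 2)) *
        ENNReal.ofReal ((expSumConst (b / 2) * s) ^ d) := by
        rw [ENNReal.tsum_mul_left]
        gcongr
        exact (tsum_expProfile_le (half_pos hb) hs c).trans_eq (by rw [Fintype.card_fin])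
    _ = _ := by
        rw [← ENNReal.ofReal_mul (by positivity), varianceConst, mul_pow]
        congr 1
        field_simp

variable [IsProbabilityMeasure P]

theorem HasDecay.lintegral_sq_sub_le (hp : HasDecay A b s c (pmf P X)) (hX : Measurable X)
    (hA : 0 < A) (hb : 0 < b) (hs : 1 ≤ s) (j : Fin d) :
    ∫⁻ ω, ENNReal.ofReal ((X ω j - c j) ^ 2) ∂P ≤
      ENNReal.ofReal (varianceConst d A b * s ^ 2) := by
  rw [← lintegral_map (f := fun k : Fin d → ℤ => ENNReal.ofReal ((k j - c j) ^ 2))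
    (measurable_of_countable _) hX, lintegral_countable']
  refine (tsum_congr fun k => ?_).trans_le (hp.tsum_sq_mul_le hA hb hs j)
  rw [← ofReal_pmf, ENNReal.ofReal_mul (sq_nonneg _)]

theorem HasDecay.memLp (hp : HasDecay A b s c (pmf P X)) (hX : Measurable X) (hA : 0 < A)
    (hb : 0 < b) (hs : 1 ≤ s) (j : Fin d) : MemLp (fun ω => (X ω j : ℝ)) 2 P := by
  have hmeas : Measurable fun ω => (X ω j : ℝ) - c j :=
    ((measurable_of_countable fun k : Fin d → ℤ => (k j : ℝ)).comp hX).sub_const _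
  have hcenter : MemLp (fun ω => (X ω j : ℝ) - c j) 2 P := by
    refine (memLp_two_iff_integrable_sq hmeas.aestronglyMeasurable).2
      ⟨(hmeas.pow_const 2).aestronglyMeasurable, ?_⟩
    rw [hasFiniteIntegral_iff_ofReal (Filter.Eventually.of_forall fun ω => sq_nonneg _)]
    exact (hp.lintegral_sq_sub_le hX hA hb hs j).trans_lt ENNReal.ofReal_lt_top
  refine (hcenter.add (memLp_const (c j))).ae_eq (Filter.Eventually.of_forall fun ω => ?_)
  simp

theorem HasDecay.variance_le (hp : HasDecay A b s c (pmf P X)) (hX : Measurable X) (hA : 0 < A)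
    (hb : 0 < b) (hs : 1 ≤ s) (j : Fin d) :
    Var[fun ω => (X ω j : ℝ); P] ≤ varianceConst d A b * s ^ 2 := by
  have hmeas : Measurable fun ω => (X ω j : ℝ) :=
    (measurable_of_countable fun k : Fin d → ℤ => (k j : ℝ)).comp hX
  have hcenter := (hmeas.sub_const (c j)).aestronglyMeasurable (μ := P)
  have hconst := varianceConst_pos d hA hb
  rw [← variance_sub_const hmeas.aestronglyMeasurable (c j)]
  refine (variance_le_expectation_sq hcenter).trans ?_
  simp only [Pi.pow_apply]
  rw [integral_eq_lintegral_of_nonneg_ae (Filter.Eventually.of_forall fun ω => sq_nonneg _)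
    (hcenter.pow 2)]
  exact ENNReal.toReal_le_of_le_ofReal (by positivity) (hp.lintegral_sq_sub_le hX hA hb hs j)

end DecayMoments

section Entropy

variable {Ω : Type*} [MeasurableSpace Ω] {P : Measure Ω} [IsProbabilityMeasure P] {d : ℕ}
  {X : Ω → Fin d → ℤ}

theorem negMulLog_le_mul_neg_log_add {q r : ℝ} (hq : 0 ≤ q) (hr : 0 < r) :
    Real.negMulLog q ≤ q * -Real.log r + r := by
  rcases hq.eq_or_lt with rfl | hq
  · simpa using hr.le
  have hlog : Real.log r - Real.log q ≤ r / q - 1 := by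
    rw [← Real.log_div hr.ne' hq.ne']
    exact Real.log_le_sub_one_of_pos (div_pos hr hq)
  have hmul := mul_le_mul_of_nonneg_left hlog hq.le
  rw [mul_sub q (r / q), mul_div_cancel₀ _ hq.ne'] at hmul
  rw [Real.negMulLog]
  linarith

/-- Weights on `ℤ^d` of total mass `O(1)` with respect to which a random vector of spread `s`
around `c` has relative entropy `O(1)`; the reference for the upper bound on the entropy. -/
noncomputable def laplaceWeight (s : ℝ) (c : Fin d → ℝ) (k : Fin d → ℤ) : ℝ :=
  (s ^ d)⁻¹ * expProfile (1 / s) c (castVec k)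

theorem laplaceWeight_pos {s : ℝ} (hs : 0 < s) (c : Fin d → ℝ) (k : Fin d → ℤ) :
    0 < laplaceWeight s c k := by
  rw [laplaceWeight, expProfile_eq_exp]
  positivity

theorem neg_log_laplaceWeight {s : ℝ} (hs : 0 < s) (c : Fin d → ℝ) (k : Fin d → ℤ) :
    -Real.log (laplaceWeight s c k) = d * Real.log s + 1 / s * ∑ i, |(k i : ℝ) - c i| := by
  rw [laplaceWeight, expProfile_eq_exp,
    Real.log_mul (by positivity) (Real.exp_pos _).ne', Real.log_exp, Real.log_inv, Real.log_pow]
  simp only [castVec]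
  ring

theorem tsum_ofReal_laplaceWeight_le {s : ℝ} (hs : 1 ≤ s) (c : Fin d → ℝ) :
    ∑' k, ENNReal.ofReal (laplaceWeight s c k) ≤ ENNReal.ofReal (expSumConst 1 ^ d) := by
  have : 0 < s := by linarith
  have hinv : 0 ≤ (s ^ d)⁻¹ := by positivity
  simp only [laplaceWeight, ENNReal.ofReal_mul hinv]
  rw [ENNReal.tsum_mul_left]
  calc _ ≤ ENNReal.ofReal (s ^ d)⁻¹ * ENNReal.ofReal ((expSumConst 1 * s) ^ d) := by
        gcongr
        exact (tsum_expProfile_le one_pos hs c).trans_eq (by rw [Fintype.card_fin])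
    _ = ENNReal.ofReal (expSumConst 1 ^ d) := by
        rw [← ENNReal.ofReal_mul hinv, mul_pow]
        congr 1
        field_simp

theorem summable_laplaceWeight {s : ℝ} (hs : 1 ≤ s) (c : Fin d → ℝ) :
    Summable (laplaceWeight s c) :=
  (ENNReal.summable_toReal
    ((tsum_ofReal_laplaceWeight_le hs c).trans_lt ENNReal.ofReal_lt_top).ne).congr
    fun k => ENNReal.toReal_ofReal (laplaceWeight_pos (by linarith) c k).le

theorem tsum_laplaceWeight_le {s : ℝ} (hs : 1 ≤ s) (c : Fin d → ℝ) :
    ∑' k, laplaceWeight s c k ≤ expSumConst 1 ^ d := by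
  have hle := tsum_ofReal_laplaceWeight_le hs c
  rw [← ENNReal.ofReal_tsum_of_nonneg (fun k => (laplaceWeight_pos (by linarith) c k).le)
    (summable_laplaceWeight hs c)] at hle
  exact (ENNReal.ofReal_le_ofReal_iff (pow_nonneg (expSumConst_pos one_pos).le d)).1 hle

theorem negMulLog_le_of_laplaceWeight {s q : ℝ} (hs : 0 < s) (hq : 0 ≤ q) (c : Fin d → ℝ)
    (k : Fin d → ℤ) :
    Real.negMulLog q ≤ (d * Real.log s + d) * q + ∑ j, (s ^ 2)⁻¹ * ((k j - c j) ^ 2 * q) +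
      laplaceWeight s c k := by
  have habs : ∀ i, 1 / s * |(k i : ℝ) - c i| ≤ 1 + (s ^ 2)⁻¹ * (k i - c i) ^ 2 := fun i => by
    have hsq : (s ^ 2)⁻¹ * ((k i : ℝ) - c i) ^ 2 = (1 / s * |(k i : ℝ) - c i|) ^ 2 := by
      rw [mul_pow, sq_abs, one_div, inv_pow]
    rw [hsq]
    nlinarith [sq_nonneg (1 / s * |(k i : ℝ) - c i| - 1), sq_nonneg (1 / s * |(k i : ℝ) - c i|)]
  have hsum : 1 / s * ∑ i, |(k i : ℝ) - c i| ≤ d + ∑ i, (s ^ 2)⁻¹ * (k i - c i) ^ 2 := by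
    calc _ ≤ ∑ i, (1 + (s ^ 2)⁻¹ * ((k i : ℝ) - c i) ^ 2) := by
          rw [Finset.mul_sum]
          exact Finset.sum_le_sum fun i _ => habs i
      _ = _ := by simp [Finset.sum_add_distrib]
  refine (negMulLog_le_mul_neg_log_add hq (laplaceWeight_pos hs c k)).trans ?_
  rw [neg_log_laplaceWeight hs]
  have hmul := mul_le_mul_of_nonneg_left hsum hq
  simp only [← mul_assoc, ← Finset.sum_mul]
  linarith

theorem hasSum_sq_sub_mean_mul_pmf (hX : Measurable X) {j : Fin d}
    (hL : MemLp (fun ω => (X ω j : ℝ)) 2 P) :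
    HasSum (fun k => ((k j : ℝ) - ∫ ω, (X ω j : ℝ) ∂P) ^ 2 * pmf P X k)
      Var[fun ω => (X ω j : ℝ); P] := by
  rw [variance_eq_integral hL.aemeasurable]
  exact hasSum_mul_pmf hX (g := fun k => (k j - ∫ ω, (X ω j : ℝ) ∂P) ^ 2)
    (hL.sub (memLp_const _)).integrable_sq

theorem hasShannonEntropy_and_shannonEntropy_le {s V : ℝ} (hX : Measurable X) (hs : 1 ≤ s)
    (hL : ∀ j, MemLp (fun ω => (X ω j : ℝ)) 2 P)
    (hV : ∀ j, Var[fun ω => (X ω j : ℝ); P] ≤ V * s ^ 2) :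
    HasShannonEntropy P X ∧
      shannonEntropy P X ≤ d * Real.log s + (d + d * V + expSumConst 1 ^ d) := by
  have hs0 : 0 < s := by linarith
  set c : Fin d → ℝ := fun j => ∫ ω, (X ω j : ℝ) ∂P
  have hbound : ∀ k, Real.negMulLog (pmf P X k) ≤ (d * Real.log s + d) * pmf P X k +
      ∑ j, (s ^ 2)⁻¹ * ((k j - c j) ^ 2 * pmf P X k) + laplaceWeight s c k :=
    fun k => negMulLog_le_of_laplaceWeight hs0 (pmf_nonneg k) c k
  have hsum := (((hasSum_pmf (P := P) hX).mul_left (d * Real.log s + d)).add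
    (hasSum_sum fun j (_ : j ∈ Finset.univ) =>
      (hasSum_sq_sub_mean_mul_pmf hX (hL j)).mul_left (s ^ 2)⁻¹)).add
      (summable_laplaceWeight hs c).hasSum
  have hentropy : HasShannonEntropy P X :=
    hsum.summable.of_nonneg_of_le
      (fun k => Real.negMulLog_nonneg (pmf_nonneg k) (pmf_le_one hX k)) hbound
  have hvar : ∑ j, (s ^ 2)⁻¹ * Var[fun ω => (X ω j : ℝ); P] ≤ d * V := by
    calc _ ≤ ∑ _j : Fin d, V := Finset.sum_le_sum fun j _ => by
          rw [inv_mul_le_iff₀ (by positivity), mul_comm]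
          exact hV j
      _ = d * V := by simp
  have htsum := (hentropy.tsum_le_tsum hbound hsum.summable).trans_eq hsum.tsum_eq
  refine ⟨hentropy, ?_⟩
  rw [shannonEntropy]
  linarith [tsum_laplaceWeight_le hs c]

theorem one_le_shannonEntropy (hX : Measurable X) (hH : HasShannonEntropy P X)
    (hp : ∀ k, pmf P X k ≤ Real.exp (-1)) : 1 ≤ shannonEntropy P X := by
  rw [← (hasSum_pmf (P := P) hX).tsum_eq]
  refine (hasSum_pmf hX).summable.tsum_le_tsum (fun k => ?_) hH
  rcases (pmf_nonneg (P := P) (X := X) k).eq_or_lt with hzero | hpos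
  · rw [← hzero, Real.negMulLog_zero]
  · have hlog : Real.log (pmf P X k) ≤ -1 := (Real.log_le_iff_le_exp hpos).2 (hp k)
    rw [Real.negMulLog]
    nlinarith

end Entropy

section Determinant

open Matrix

variable {ι : Type*} [Fintype ι] [DecidableEq ι] {A : Matrix ι ι ℝ}

theorem pow_card_le_det {L : ℝ} (hA : A.IsHermitian) (hL : 0 ≤ L)
    (hlower : ∀ θ : ι → ℝ, L * (θ ⬝ᵥ θ) ≤ θ ⬝ᵥ A *ᵥ θ) : L ^ Fintype.card ι ≤ A.det := by
  have heigen : ∀ i, L ≤ hA.eigenvalues i := fun i => by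
    set v : ι → ℝ := ⇑(hA.eigenvectorBasis i)
    have hunit : v ⬝ᵥ v = 1 := by
      have hnorm := hA.eigenvectorBasis.orthonormal.1 i
      rw [EuclideanSpace.norm_eq, Real.sqrt_eq_one] at hnorm
      simpa [v, dotProduct, ← sq] using hnorm
    calc L = L * (v ⬝ᵥ v) := by rw [hunit, mul_one]
      _ ≤ v ⬝ᵥ A *ᵥ v := hlower v
      _ = hA.eigenvalues i := (hA.eigenvalues_eq i).symm
  have hdet : A.det = ∏ i, hA.eigenvalues i := by simpa using hA.det_eq_prod_eigenvalues
  rw [hdet, ← Finset.card_univ, ← Finset.prod_const]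
  exact Finset.prod_le_prod (fun _ _ => hL) fun i _ => heigen i

theorem det_le_pow_card {V : ℝ} (hA : A.PosSemidef) (hV : ∀ i, A i i ≤ V) :
    A.det ≤ (Fintype.card ι * V) ^ Fintype.card ι := by
  have heigen : ∀ i, hA.1.eigenvalues i ≤ Fintype.card ι * V := fun i => by
    calc hA.1.eigenvalues i ≤ ∑ i, hA.1.eigenvalues i :=
          Finset.single_le_sum (fun i _ => hA.eigenvalues_nonneg i) (Finset.mem_univ i)
      _ = A.trace := by simpa using hA.1.trace_eq_sum_eigenvalues.symm
      _ ≤ ∑ _i : ι, V := Finset.sum_le_sum fun i _ => hV i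
      _ = Fintype.card ι * V := by simp
  have hdet : A.det = ∏ i, hA.1.eigenvalues i := by simpa using hA.1.det_eq_prod_eigenvalues
  rw [hdet, ← Finset.card_univ, ← Finset.prod_const, Finset.card_univ]
  exact Finset.prod_le_prod (fun i _ => hA.eigenvalues_nonneg i) fun i _ => heigen i

variable {d : ℕ} {B : Matrix (Fin d) (Fin d) ℝ} {t : ℝ}

theorem sq_pow_rpow_one_div_two_mul (hd : 0 < d) (ht : 0 ≤ t) :
    ((t ^ 2) ^ d) ^ (1 / (2 * (d : ℝ))) = t := by
  have hexp : (1 : ℝ) / (2 * d) = ((2 * d : ℕ) : ℝ)⁻¹ := by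
    push_cast
    rw [one_div]
  rw [← pow_mul, hexp]
  exact Real.pow_rpow_inv_natCast ht (by positivity)

theorem le_scale_of_pow_le_det (hd : 0 < d) (ht : 0 ≤ t) (hdet : (t ^ 2) ^ d ≤ B.det) :
    t ≤ scale B := by
  rw [scale, ← sq_pow_rpow_one_div_two_mul hd ht]
  gcongr

theorem scale_le_of_det_le_pow (hd : 0 < d) (ht : 0 ≤ t) (hdet0 : 0 ≤ B.det)
    (hdet : B.det ≤ (t ^ 2) ^ d) : scale B ≤ t := by
  rw [scale, ← sq_pow_rpow_one_div_two_mul hd ht]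
  gcongr

end Determinant

section Slab

open Matrix

variable {Ω : Type*} [MeasurableSpace Ω] {P : Measure Ω} {d : ℕ} {X : Ω → Fin d → ℤ}
  {A b s : ℝ} {c : Fin d → ℝ}

theorem card_Icc_ceil_floor_le (r : ℝ) {h : ℝ} (hh : 0 ≤ h) :
    ((Finset.Icc ⌈r - h⌉ ⌊r + h⌋).card : ℝ) ≤ 2 * h + 1 := by
  rw [Int.card_Icc, ← Int.cast_natCast, Int.ofNat_toNat, Int.cast_max, max_le_iff]
  push_cast
  constructor <;> linarith [Int.floor_le (r + h), Int.le_ceil (r - h)]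

theorem tsum_le_of_eq_zero_off_interval {ψ : ℤ → ENNReal} {β r h : ℝ} (hh : 0 ≤ h)
    (hψ : ∀ t, ψ t ≤ ENNReal.ofReal β) (hzero : ∀ t : ℤ, h ≤ |t - r| → ψ t = 0) :
    ∑' t, ψ t ≤ ENNReal.ofReal ((2 * h + 1) * β) := by
  have hsupport : ∀ t ∉ Finset.Icc ⌈r - h⌉ ⌊r + h⌋, ψ t = 0 := fun t ht => by
    refine hzero t ?_
    by_contra! hlt
    rw [abs_lt] at hlt
    refine ht (Finset.mem_Icc.2 ⟨Int.ceil_le.2 ?_, Int.le_floor.2 ?_⟩) <;> linarith [hlt.1, hlt.2]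
  rw [tsum_eq_sum hsupport]
  refine (Finset.sum_le_card_nsmul _ _ _ fun t _ => hψ t).trans ?_
  rw [nsmul_eq_mul, ENNReal.ofReal_mul (by positivity), ← ENNReal.ofReal_natCast]
  gcongr
  exact card_Icc_ceil_floor_le r hh

theorem dotProduct_castVec_lineMk (θ : Fin d → ℝ) (i : Fin d) (k : {j // j ≠ i} → ℤ) (t : ℤ) :
    θ ⬝ᵥ castVec (lineMk i k t) = θ i * t + ∑ j : {j // j ≠ i}, θ j * k j := by
  rw [dotProduct, Fintype.sum_eq_add_sum_subtype_ne _ i, castVec, lineMk_self]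
  congr 1
  exact Finset.sum_congr rfl fun j _ => by rw [castVec, lineMk_of_ne j.2]

theorem measure_preimage_eq_tsum_indicator [IsFiniteMeasure P] (hX : Measurable X)
    (S : Set (Fin d → ℤ)) :
    P (X ⁻¹' S) = ∑' k, S.indicator (fun k => ENNReal.ofReal (pmf P X k)) k := by
  rw [← Measure.map_apply hX S.to_countable.measurableSet,
    ← lintegral_indicator_one S.to_countable.measurableSet, lintegral_countable']
  refine tsum_congr fun k => ?_
  by_cases hk : k ∈ S <;> simp [hk, ofReal_pmf]

theorem HasDecay.measure_slab_le [IsFiniteMeasure P] (hp : HasDecay A b s c (pmf P X))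
    (hX : Measurable X) (hA : 0 < A) (hb : 0 < b) (hs : 1 ≤ s) {θ : Fin d → ℝ} {i : Fin d}
    (hθ : θ i ≠ 0) (a : ℝ) {h : ℝ} (hh : 1 ≤ h) :
    P {ω | |θ ⬝ᵥ castVec (X ω) - a| < h * |θ i|} ≤
      ENNReal.ofReal (3 * h * A * expSumConst b ^ (d - 1) / s) := by
  have : 0 < s := by linarith
  set slab : Set (Fin d → ℤ) := {k | |θ ⬝ᵥ castVec k - a| < h * |θ i|}
  have hline : ∀ k : {j // j ≠ i} → ℤ,
      ∑' t, slab.indicator (fun k => ENNReal.ofReal (pmf P X k)) (lineMk i k t) ≤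
        ENNReal.ofReal ((2 * h + 1) * (A / s ^ d) *
          expProfile (b / s) (fun j : {j // j ≠ i} => c j) fun j => k j) := fun k => by
    rw [mul_assoc]
    refine tsum_le_of_eq_zero_off_interval (r := (a - ∑ j : {j // j ≠ i}, θ j * k j) / θ i)
      (by linarith) (fun t => ?_) fun t ht => Set.indicator_of_notMem ?_ _
    · refine (Set.indicator_le_self _ _ _).trans (ENNReal.ofReal_le_ofReal ((hp _).trans ?_))
      gcongr
      exact expProfile_lineMk_le (by positivity) c i k t
    · have hscaled : θ ⬝ᵥ castVec (lineMk i k t) - a =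
          (t - (a - ∑ j : {j // j ≠ i}, θ j * k j) / θ i) * θ i := by
        rw [dotProduct_castVec_lineMk]
        field_simp
        ring
      rw [Set.mem_ofPred_eq, not_lt, hscaled, abs_mul]
      gcongr
  change P (X ⁻¹' slab) ≤ _
  rw [measure_preimage_eq_tsum_indicator hX]
  refine (tsum_le_of_lines hb hs i c _ (by positivity) hline).trans (ENNReal.ofReal_le_ofReal ?_)
  obtain ⟨m, rfl⟩ : ∃ m, d = m + 1 := ⟨d - 1, by have := i.pos; omega⟩
  have := expSumConst_pos hb
  calc (2 * h + 1) * (A / s ^ (m + 1)) * (expSumConst b * s) ^ m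
      = (2 * h + 1) * A * expSumConst b ^ m / s := by
        rw [mul_pow, pow_succ]
        field_simp
    _ ≤ 3 * h * A * expSumConst b ^ m / s := by
        gcongr
        linarith

/-- The multiple of `s * |θ i|` such that a slab `|θ ⬝ᵥ x - a| < spreadConst d A b * s * |θ i|`
carries at most half of the mass under `HasDecay A b s c`. -/
noncomputable def spreadConst (d : ℕ) (A b : ℝ) : ℝ := 1 / (6 * A * expSumConst b ^ (d - 1))

theorem spreadConst_pos (d : ℕ) (hA : 0 < A) (hb : 0 < b) : 0 < spreadConst d A b := by
  have := expSumConst_pos hb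
  unfold spreadConst
  positivity

theorem exists_norm_eq_abs_of_ne_zero {ι : Type*} [Fintype ι] {θ : ι → ℝ} (hθ : θ ≠ 0) :
    ∃ i, θ i ≠ 0 ∧ ‖θ‖ = |θ i| := by
  have : Nonempty ι := (Function.ne_iff.1 hθ).nonempty
  obtain ⟨i, hi⟩ := Finite.exists_max fun i => |θ i|
  have hnorm : ‖θ‖ = |θ i| :=
    le_antisymm ((pi_norm_le_iff_of_nonneg (abs_nonneg _)).2 hi) (norm_le_pi_norm θ i)
  exact ⟨i, abs_pos.1 (hnorm ▸ norm_pos_iff.2 hθ), hnorm⟩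

variable [IsProbabilityMeasure P]

theorem HasDecay.le_variance_dotProduct (hp : HasDecay A b s c (pmf P X)) (hX : Measurable X)
    (hA : 0 < A) (hb : 0 < b) (hs : 1 ≤ s) (hspread : 1 ≤ spreadConst d A b * s)
    (θ : Fin d → ℝ) :
    spreadConst d A b ^ 2 / 2 * s ^ 2 * ‖θ‖ ^ 2 ≤ Var[fun ω => θ ⬝ᵥ castVec (X ω); P] := by
  set δ := spreadConst d A b with hδ
  rcases eq_or_ne θ 0 with rfl | hθ
  · simp [variance_nonneg]
  obtain ⟨i, hθi, hnorm⟩ := exists_norm_eq_abs_of_ne_zero hθ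
  set Y : Ω → ℝ := fun ω => θ ⬝ᵥ castVec (X ω)
  have hY : MemLp Y 2 P :=
    memLp_finsetSum _ fun j _ => (hp.memLp hX hA hb hs j).const_mul (θ j)
  have hδs : 0 < δ * s * |θ i| := by
    have := abs_pos.2 hθi
    positivity
  have hslab : P {ω | |Y ω - P[Y]| < δ * s * |θ i|} ≤ ENNReal.ofReal (1 / 2) := by
    refine (hp.measure_slab_le hX hA hb hs hθi _ hspread).trans_eq (congrArg _ ?_)
    have := expSumConst_pos hb
    rw [hδ, spreadConst]
    field_simp
    norm_num
  have hcheb := meas_ge_le_variance_div_sq hY hδs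
  have hone : (1 : ENNReal) ≤ ENNReal.ofReal (1 / 2) +
      ENNReal.ofReal (Var[Y; P] / (δ * s * |θ i|) ^ 2) := by
    calc (1 : ENNReal) = P Set.univ := measure_univ.symm
      _ ≤ P ({ω | |Y ω - P[Y]| < δ * s * |θ i|} ∪ {ω | δ * s * |θ i| ≤ |Y ω - P[Y]|}) :=
        measure_mono fun ω _ => lt_or_ge |Y ω - P[Y]| (δ * s * |θ i|)
      _ ≤ _ := (measure_union_le _ _).trans (add_le_add hslab hcheb)
  have hvar0 : 0 ≤ Var[Y; P] / (δ * s * |θ i|) ^ 2 :=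
    div_nonneg (variance_nonneg Y P) (sq_nonneg _)
  rw [← ENNReal.ofReal_add (by norm_num) hvar0, ENNReal.one_le_ofReal] at hone
  have hhalf : 1 / 2 ≤ Var[Y; P] / (δ * s * |θ i|) ^ 2 := by linarith
  rw [le_div_iff₀ (by positivity)] at hhalf
  rw [hnorm]
  linarith [mul_pow (δ * s) |θ i| 2, mul_pow δ s 2]

theorem variance_dotProduct_castVec (hL : ∀ j, MemLp (fun ω => (X ω j : ℝ)) 2 P)
    (hX : Measurable X) (θ : Fin d → ℝ) :
    Var[fun ω => θ ⬝ᵥ castVec (X ω); P] = θ ⬝ᵥ discreteCovMatrix (pmf P X) *ᵥ θ := by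
  simp only [dotProduct, castVec]
  rw [variance_fun_sum fun j => (hL j).const_mul (θ j)]
  refine Finset.sum_congr rfl fun i _ => ?_
  rw [mulVec, dotProduct, Finset.mul_sum]
  refine Finset.sum_congr rfl fun j _ => ?_
  rw [covariance_const_mul_left, covariance_const_mul_right, discreteCovMatrix_pmf hX hL]
  ring

theorem dotProduct_self_le_card_mul_norm_sq {ι : Type*} [Fintype ι] (θ : ι → ℝ) :
    θ ⬝ᵥ θ ≤ Fintype.card ι * ‖θ‖ ^ 2 := by
  calc θ ⬝ᵥ θ ≤ ∑ _i : ι, ‖θ‖ ^ 2 := Finset.sum_le_sum fun i _ => by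
        rw [← sq, ← sq_abs]
        gcongr
        exact norm_le_pi_norm θ i
    _ = Fintype.card ι * ‖θ‖ ^ 2 := by simp

theorem HasDecay.le_dotProduct_discreteCovMatrix (hp : HasDecay A b s c (pmf P X))
    (hX : Measurable X) (hA : 0 < A) (hb : 0 < b) (hs : 1 ≤ s)
    (hspread : 1 ≤ spreadConst d A b * s) (θ : Fin d → ℝ) :
    spreadConst d A b ^ 2 / (2 * d) * s ^ 2 * (θ ⬝ᵥ θ) ≤
      θ ⬝ᵥ discreteCovMatrix (pmf P X) *ᵥ θ := by
  rw [← variance_dotProduct_castVec (fun j => hp.memLp hX hA hb hs j) hX]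
  refine le_trans ?_ (hp.le_variance_dotProduct hX hA hb hs hspread θ)
  have hnorm := dotProduct_self_le_card_mul_norm_sq θ
  rw [Fintype.card_fin] at hnorm
  have hcancel : (d : ℝ)⁻¹ * (d * ‖θ‖ ^ 2) ≤ ‖θ‖ ^ 2 := by
    rw [← mul_assoc]
    exact mul_le_of_le_one_left (sq_nonneg _) inv_mul_le_one
  calc spreadConst d A b ^ 2 / (2 * d) * s ^ 2 * (θ ⬝ᵥ θ)
      = spreadConst d A b ^ 2 / 2 * s ^ 2 * ((d : ℝ)⁻¹ * (θ ⬝ᵥ θ)) := by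
        rw [← div_div, div_eq_mul_inv _ (d : ℝ)]
        ring
    _ ≤ spreadConst d A b ^ 2 / 2 * s ^ 2 * ‖θ‖ ^ 2 := by
        gcongr
        exact le_trans (by gcongr) hcancel

end Slab

section IndependentSums

variable {Ω : Type*} [MeasurableSpace Ω] {P : Measure Ω} {d n : ℕ} {X : Fin n → Ω → Fin d → ℤ}

theorem measurable_latticeSum (hX : ∀ i, Measurable (X i)) : Measurable (latticeSum X) :=
  Finset.measurable_fun_sum _ fun i _ => hX i

theorem pmf_eq_of_identDistrib {Y Z : Ω → Fin d → ℤ} (h : IdentDistrib Y Z P P) :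
    pmf P Y = pmf P Z := by
  unfold pmf
  rw [h.map_eq]

theorem covariance_eq_of_identDistrib {Y Z : Ω → Fin d → ℤ} (h : IdentDistrib Y Z P P)
    (i j : Fin d) :
    cov[fun ω => (Y ω i : ℝ), fun ω => (Y ω j : ℝ); P] =
      cov[fun ω => (Z ω i : ℝ), fun ω => (Z ω j : ℝ); P] := by
  have hcoord : ∀ j : Fin d, Measurable fun k : Fin d → ℤ => (k j : ℝ) := fun j =>
    measurable_of_countable _
  have hmap : ∀ W : Ω → Fin d → ℤ, AEMeasurable W P →
      cov[fun ω => (W ω i : ℝ), fun ω => (W ω j : ℝ); P] =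
        cov[fun k : Fin d → ℤ => (k i : ℝ), fun k : Fin d → ℤ => (k j : ℝ); P.map W] :=
    fun W hW => (covariance_map_fun (hcoord i).aestronglyMeasurable
      (hcoord j).aestronglyMeasurable hW).symm
  rw [hmap Y h.aemeasurable_fst, hmap Z h.aemeasurable_snd, h.map_eq]

variable [IsProbabilityMeasure P]

theorem prod_pmf_le_pmf_latticeSum (hX : ∀ i, Measurable (X i)) (hind : iIndepFun X P)
    (k : Fin n → Fin d → ℤ) : ∏ i, pmf P (X i) (k i) ≤ pmf P (latticeSum X) (∑ i, k i) := by
  have hpmf : ∀ {Y : Ω → Fin d → ℤ}, Measurable Y → ∀ l, pmf P Y l = P.real (Y ⁻¹' {l}) :=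
    fun hY l => map_measureReal_apply hY (measurableSet_singleton l)
  have hinter : P.real (⋂ i ∈ Finset.univ, X i ⁻¹' {k i}) = ∏ i, pmf P (X i) (k i) := by
    rw [measureReal_def, hind.measure_inter_preimage_eq_mul Finset.univ
      fun i _ => measurableSet_singleton (k i), ENNReal.toReal_prod]
    exact Finset.prod_congr rfl fun i _ => (hpmf (hX i) _).symm
  rw [← hinter, hpmf (measurable_latticeSum hX)]
  refine measureReal_mono fun ω hω => ?_
  simp only [Finset.mem_univ, Set.iInter_true, Set.mem_iInter, Set.mem_preimage,
    Set.mem_singleton_iff] at hω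
  exact Finset.sum_congr rfl fun i _ => hω i

theorem pmf_mul_pow_le_pmf_latticeSum (hX : ∀ i, Measurable (X i)) (hind : iIndepFun X P)
    (hid : ∀ i j, IdentDistrib (X i) (X j) P P) (i₀ : Fin n) (k l : Fin d → ℤ) :
    pmf P (X i₀) k * pmf P (X i₀) l ^ (n - 1) ≤ pmf P (latticeSum X) (k + (n - 1) • l) := by
  have hcard : (Finset.univ.erase i₀).card = n - 1 := by
    rw [Finset.card_erase_of_mem (Finset.mem_univ _), Finset.card_univ, Fintype.card_fin]
  have hne : ∀ i ∈ Finset.univ.erase i₀, Function.update (fun _ => l) i₀ k i = l :=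
    fun i hi => Function.update_of_ne (Finset.ne_of_mem_erase hi) _ _
  have hprod := prod_pmf_le_pmf_latticeSum hX hind (Function.update (fun _ => l) i₀ k)
  rwa [← Finset.mul_prod_erase _ _ (Finset.mem_univ i₀),
    ← Finset.add_sum_erase _ _ (Finset.mem_univ i₀), Function.update_self,
    Finset.sum_congr rfl hne, Finset.sum_const, hcard,
    Finset.prod_congr rfl fun i hi => by rw [hne i hi, pmf_eq_of_identDistrib (hid i i₀)],
    Finset.prod_const, hcard] at hprod

theorem pmf_le_of_pmf_latticeSum_le_pow (hX : ∀ i, Measurable (X i)) (hind : iIndepFun X P)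
    (hid : ∀ i j, IdentDistrib (X i) (X j) P P) {m : ℝ} (hm : 0 ≤ m)
    (hle : ∀ k, pmf P (latticeSum X) k ≤ m ^ n) (i : Fin n) (k : Fin d → ℤ) :
    pmf P (X i) k ≤ m := by
  have hn : n ≠ 0 := i.pos.ne'
  have hpow := (pmf_mul_pow_le_pmf_latticeSum hX hind hid i k k).trans (hle _)
  rw [mul_pow_sub_one hn] at hpow
  exact (pow_le_pow_iff_left₀ (pmf_nonneg k) hm hn).1 hpow

theorem HasDecay.exists_summand {A b s : ℝ} {c : Fin d → ℝ}
    (hp : HasDecay A b s c (pmf P (latticeSum X))) (hA : 0 < A) (hX : ∀ i, Measurable (X i))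
    (hind : iIndepFun X P) (hid : ∀ i j, IdentDistrib (X i) (X j) P P) (i : Fin n) :
    ∃ (A' : ℝ) (c' : Fin d → ℝ), 0 < A' ∧ HasDecay A' b s c' (pmf P (X i)) := by
  obtain ⟨l, hl⟩ := exists_pmf_pos (P := P) (hX i)
  refine ⟨A / pmf P (X i) l ^ (n - 1), fun j => c j - (n - 1 : ℕ) * l j, by positivity,
    fun k => ?_⟩
  have hle := (pmf_mul_pow_le_pmf_latticeSum hX hind hid i k l).trans (hp _)
  rw [← le_div_iff₀ (by positivity)] at hle
  refine hle.trans_eq ?_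
  rw [div_right_comm A, mul_div_right_comm]
  congr 1
  simp only [expProfile, castVec, Pi.add_apply, nsmul_eq_mul, Pi.mul_apply, Pi.natCast_apply,
    Int.cast_add, Int.cast_mul, Int.cast_natCast, sub_sub_eq_add_sub]

theorem HasDecay.memLp_summand {A b s : ℝ} {c : Fin d → ℝ}
    (hp : HasDecay A b s c (pmf P (latticeSum X))) (hA : 0 < A) (hb : 0 < b) (hs : 1 ≤ s)
    (hX : ∀ i, Measurable (X i)) (hind : iIndepFun X P)
    (hid : ∀ i j, IdentDistrib (X i) (X j) P P) (i : Fin n) (j : Fin d) :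
    MemLp (fun ω => (X i ω j : ℝ)) 2 P := by
  obtain ⟨A', c', hA', hq⟩ := hp.exists_summand hA hX hind hid i
  exact hq.memLp (hX i) hA' hb hs j

theorem discreteCovMatrix_latticeSum (hX : ∀ i, Measurable (X i)) (hind : iIndepFun X P)
    (hid : ∀ i j, IdentDistrib (X i) (X j) P P)
    (hL : ∀ i j, MemLp (fun ω => (X i ω j : ℝ)) 2 P) (i₀ : Fin n) :
    discreteCovMatrix (pmf P (latticeSum X)) =
      (n : ℝ) • discreteCovMatrix (pmf P (X i₀)) := by
  have hcoord : ∀ j : Fin d, Measurable fun k : Fin d → ℤ => (k j : ℝ) := fun j =>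
    measurable_of_countable _
  have hsum : ∀ j : Fin d, (fun ω => (latticeSum X ω j : ℝ)) = fun ω => ∑ a, (X a ω j : ℝ) :=
    fun j => by
      ext ω
      simp [latticeSum]
  have hLsum : ∀ j, MemLp (fun ω => (latticeSum X ω j : ℝ)) 2 P := fun j => by
    rw [hsum]
    exact memLp_finsetSum _ fun a _ => hL a j
  ext i j
  have hrow : ∀ a, ∑ a', cov[fun ω => (X a ω i : ℝ), fun ω => (X a' ω j : ℝ); P] =
      discreteCovMatrix (pmf P (X i₀)) i j := fun a => by
    rw [Finset.sum_eq_single a, covariance_eq_of_identDistrib (hid a i₀),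
      discreteCovMatrix_pmf (hX i₀) (hL i₀)]
    · exact fun a' _ hne => ((hind.indepFun hne.symm).comp (hcoord i)
        (hcoord j)).covariance_eq_zero (hL a i) (hL a' j)
    · simp
  rw [discreteCovMatrix_pmf (measurable_latticeSum hX) hLsum, hsum, hsum,
    covariance_fun_sum_fun_sum (fun a => hL a i) fun a => hL a j]
  simp only [hrow, Finset.sum_const, Finset.card_univ, Fintype.card_fin, nsmul_eq_mul,
    Matrix.smul_apply, smul_eq_mul]

end IndependentSums

section AlmostIsotropic

open Matrix

variable {d : ℕ} {f : (Fin d → ℝ) → ℝ} {K : ℝ}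

theorem abs_dotProduct_mulVec_le {ι : Type*} [Fintype ι] {E : Matrix ι ι ℝ} {ε : ℝ} (hε : 0 ≤ ε)
    (hE : ∀ i j, |E i j| ≤ ε) (θ : ι → ℝ) :
    |θ ⬝ᵥ E *ᵥ θ| ≤ ε * (Fintype.card ι * (θ ⬝ᵥ θ)) := by
  have hterm : ∀ i j, |θ i * (E i j * θ j)| ≤ ε * (|θ i| * |θ j|) := fun i j => by
    rw [abs_mul, abs_mul, mul_left_comm]
    gcongr
    exact hE i j
  calc |θ ⬝ᵥ E *ᵥ θ| = |∑ i, ∑ j, θ i * (E i j * θ j)| := by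
        simp only [dotProduct, mulVec, Finset.mul_sum]
    _ ≤ ∑ i, ∑ j, ε * (|θ i| * |θ j|) :=
        (Finset.abs_sum_le_sum_abs _ _).trans (Finset.sum_le_sum fun i _ =>
          (Finset.abs_sum_le_sum_abs _ _).trans (Finset.sum_le_sum fun j _ => hterm i j))
    _ = ε * (∑ i, |θ i|) ^ 2 := by
        simp only [← Finset.mul_sum]
        rw [← Finset.sum_mul, sq]
    _ ≤ ε * (Fintype.card ι * (θ ⬝ᵥ θ)) := by
        gcongr
        simpa [dotProduct, ← sq] using
          sq_sum_le_card_mul_sum_sq (s := Finset.univ) (f := fun i => |θ i|)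

theorem IsAlmostIsotropic.abs_covMatrix_sub_le (hK : IsAlmostIsotropic K f) (i j : Fin d) :
    |(covMatrix f - scale (covMatrix f) ^ 2 • (1 : Matrix (Fin d) (Fin d) ℝ)) i j| ≤
      K * scale (covMatrix f) := by
  rcases eq_or_ne i j with rfl | hij
  · simpa using hK.diag i
  · simpa [hij] using hK.offDiag i j hij

theorem IsAlmostIsotropic.isRoughlyIsotropic (hK : IsAlmostIsotropic K f) (hd : 0 < d)
    (hs : 0 < scale (covMatrix f)) (hsK : 2 * d * K ≤ scale (covMatrix f)) :
    IsRoughlyIsotropic 6 (scale (covMatrix f) / 2) f := by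
  have hd1 : (1 : ℝ) ≤ d := by exact_mod_cast hd
  set σ := scale (covMatrix f)
  have hK0 : 0 ≤ K := nonneg_of_mul_nonneg_left ((abs_nonneg _).trans (hK.diag ⟨0, hd⟩)) hs
  refine ⟨half_pos hs, hK.integrable, fun θ => ?_, fun i => ?_⟩
  · have hquad : θ ⬝ᵥ (covMatrix f - σ ^ 2 • (1 : Matrix (Fin d) (Fin d) ℝ)) *ᵥ θ =
        θ ⬝ᵥ covMatrix f *ᵥ θ - σ ^ 2 * (θ ⬝ᵥ θ) := by
      rw [sub_mulVec, dotProduct_sub, smul_mulVec, one_mulVec, dotProduct_smul, smul_eq_mul]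
    have herror := (abs_le.1 (abs_dotProduct_mulVec_le (by positivity)
      hK.abs_covMatrix_sub_le θ)).1
    rw [hquad, Fintype.card_fin] at herror
    have hθ : 0 ≤ θ ⬝ᵥ θ := Finset.sum_nonneg fun i _ => mul_self_nonneg _
    have hsmall : K * σ * (d * (θ ⬝ᵥ θ)) ≤ σ / 2 * σ * (θ ⬝ᵥ θ) := by
      calc K * σ * (d * (θ ⬝ᵥ θ)) = d * K * σ * (θ ⬝ᵥ θ) := by ring
        _ ≤ σ / 2 * σ * (θ ⬝ᵥ θ) := by
          gcongr
          linarith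
    nlinarith [mul_nonneg (sq_nonneg σ) hθ]
  · have : K ≤ σ / 2 := by nlinarith
    nlinarith [(abs_le.1 (hK.diag i)).2]

end AlmostIsotropic

section Rates

open Matrix

variable {Ω : Type*} [MeasurableSpace Ω] {P : Measure Ω} [IsProbabilityMeasure P] {d n : ℕ}
  {X : Fin n → Ω → Fin d → ℤ} {A b s : ℝ} {c : Fin d → ℝ}

theorem exists_hasDecay_of_isRoughlyIsotropic (hd : 0 < d) (Λ : ℝ) :
    ∃ A b s₀ : ℝ, 0 < A ∧ 0 < b ∧ ∀ (p : (Fin d → ℤ) → ℝ) (f : (Fin d → ℝ) → ℝ) (s : ℝ),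
      HasSum p 1 → IsLogConcaveExtension p f → IsRoughlyIsotropic Λ s f → s₀ ≤ s →
        ∃ c, HasDecay A b s c p := by
  have hcube := cubeRatio_pos hd
  have := dropRatio_pos (Λ := Λ) hd
  refine ⟨8 / cubeRatio d ^ d, 1 / (2 * dropRatio d Λ * d), 1 / cubeRatio d, by positivity,
    by positivity, fun p f s hp hf hiso hs => ?_⟩
  obtain ⟨c, hc⟩ := hiso.exists_decay hd hf.1 (fun F => by
    simp_rw [hf.2]
    exact sum_le_hasSum F (fun k _ => hf.2 k ▸ hf.1.nonneg _) hp) ((div_le_iff₀' hcube).1 hs)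
  exact ⟨c, fun k => hf.2 k ▸ hc (castVec k)⟩

theorem HasDecay.le {p : (Fin d → ℤ) → ℝ} (hp : HasDecay A b s c p) (hA : 0 < A) (hb : 0 < b)
    (hs : 0 < s) (k : Fin d → ℤ) : p k ≤ A / s ^ d := by
  refine (hp k).trans (mul_le_of_le_one_right (by positivity) ?_)
  rw [expProfile_eq_exp, Real.exp_le_one_iff, neg_nonpos]
  positivity

/-- The constant in the bound for the entropy gap between a lattice-valued sum and its smoothed
version. -/
noncomputable def gapConst (d n : ℕ) (A b : ℝ) : ℝ :=
  smoothingConst d n * (4 * A * expSumConst b ^ (d - 1))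

theorem gapConst_pos (hd : 0 < d) (hn : 0 < n) (hA : 0 < A) (hb : 0 < b) :
    0 < gapConst d n A b := by
  have := expSumConst_pos hb
  unfold gapConst smoothingConst
  positivity

/-- Beyond `d * log s`, a bound for the entropy of a random vector on `ℤ^d` with variances at most
`varianceConst d A b * s ^ 2`. -/
noncomputable def entropyConst (d : ℕ) (A b : ℝ) : ℝ :=
  d + d * varianceConst d A b + expSumConst 1 ^ d

/-- A factor by which both rates, `H * exp (-H / d)` and `log σ / σ` for the entropy `H` and the
scale `σ` of the summands of a sum with decay `HasDecay A b s c`, dominate `1 / s`. -/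
noncomputable def rateConst (d : ℕ) (A b : ℝ) : ℝ :=
  max (Real.exp (entropyConst d A b / d)) (d * varianceConst d A b + 1)

theorem rateConst_pos (d : ℕ) (A b : ℝ) : 0 < rateConst d A b :=
  lt_max_of_lt_left (Real.exp_pos _)

theorem differentialEntropy_smoothedSum {U : Fin n → Ω → Fin d → ℝ} (hn : 0 < n)
    (hX : ∀ i, Measurable (X i)) (hU : ∀ i, Measurable (U i)) (hUi : iIndepFun U P)
    (hUu : ∀ i, pdf.IsUniform (U i) (Set.Icc 0 1) P volume)
    (hXU : IndepFun (fun ω i => X i ω) (fun ω i => U i ω) P)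
    (hH : HasShannonEntropy P (latticeSum X)) {τ : ℝ} (hτ0 : 0 ≤ τ)
    (hτ : ∀ i, shiftVariation (pmf P (latticeSum X)) (Pi.single i 1) ≤ ENNReal.ofReal τ) :
    HasDifferentialEntropy P (smoothedSum X U) ∧
      |differentialEntropy P (smoothedSum X U) - shannonEntropy P (latticeSum X)| ≤
        smoothingConst d n * τ := by
  have hmeas : Measurable (smoothedSum X U) := measurable_pi_lambda _ fun j =>
    ((measurable_of_countable fun k : Fin d → ℤ => (k j : ℝ)).comp (measurable_latticeSum hX)).add
      (Finset.measurable_fun_sum _ fun i _ => (measurable_pi_apply j).comp (hU i))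
  obtain ⟨u, hu, hlaw⟩ := exists_map_smoothedSum_eq hn hX hU hUi hUu hXU
  set g := latticeSmoothing (pmf P (latticeSum X)) u
  have hg : Measurable g := measurable_latticeSmoothing _ hu.measurable
  have hp0 : ∀ k, 0 ≤ pmf P (latticeSum X) k := pmf_nonneg
  have hp1 : ∀ k, pmf P (latticeSum X) k ≤ 1 := pmf_le_one (measurable_latticeSum hX)
  have hHasPDF : HasPDF (smoothedSum X U) P volume :=
    hasPDF_of_map_eq_withDensity hmeas.aemeasurable g hg.aemeasurable hlaw
  have hpdf : (fun x => Real.negMulLog (pdf (smoothedSum X U) P volume x).toReal) =ᵐ[volume]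
      fun x => Real.negMulLog (g x).toReal := by
    filter_upwards [(pdf.eq_of_map_eq_withDensity g hg.aemeasurable).1 hlaw] with x hx
    rw [hx]
  refine ⟨⟨hHasPDF, (hu.integrable_negMulLog hp0 hp1 hH hτ0 hτ).congr hpdf.symm⟩, ?_⟩
  rw [differentialEntropy, integral_congr_ae hpdf]
  exact hu.abs_integral_negMulLog_sub_tsum_le hp0 hp1 hH hτ0 hτ

theorem HasDecay.hasShannonEntropy {Y : Ω → Fin d → ℤ} (hp : HasDecay A b s c (pmf P Y))
    (hA : 0 < A) (hb : 0 < b) (hs : 1 ≤ s) (hY : Measurable Y) : HasShannonEntropy P Y :=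
  (hasShannonEntropy_and_shannonEntropy_le hY hs (hp.memLp hY hA hb hs)
    (hp.variance_le hY hA hb hs)).1

theorem HasDecay.differentialEntropy_smoothedSum {U : Fin n → Ω → Fin d → ℝ}
    {f : (Fin d → ℝ) → ℝ} (hp : HasDecay A b s c (pmf P (latticeSum X))) (hA : 0 < A)
    (hb : 0 < b) (hs : 1 ≤ s) (hn : 0 < n)
    (hX : ∀ i, Measurable (X i)) (hU : ∀ i, Measurable (U i)) (hUi : iIndepFun U P)
    (hUu : ∀ i, pdf.IsUniform (U i) (Set.Icc 0 1) P volume)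
    (hXU : IndepFun (fun ω i => X i ω) (fun ω i => U i ω) P)
    (hf : IsLogConcaveExtension (pmf P (latticeSum X)) f) :
    HasDifferentialEntropy P (smoothedSum X U) ∧
      |differentialEntropy P (smoothedSum X U) - shannonEntropy P (latticeSum X)| ≤
        gapConst d n A b * (1 / s) := by
  have := expSumConst_pos hb
  rw [gapConst, mul_assoc, mul_one_div]
  exact DiscreteEntropy.differentialEntropy_smoothedSum hn hX hU hUi hUu hXU
    (hp.hasShannonEntropy hA hb hs (measurable_latticeSum hX)) (by positivity)
    (hp.shiftVariation_single_le hA hb hs hf)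

theorem HasDecay.variance_summand_le (hp : HasDecay A b s c (pmf P (latticeSum X))) (hA : 0 < A)
    (hb : 0 < b) (hs : 1 ≤ s) (hX : ∀ i, Measurable (X i)) (hind : iIndepFun X P)
    (hid : ∀ i j, IdentDistrib (X i) (X j) P P) (i : Fin n) (j : Fin d) :
    Var[fun ω => (X i ω j : ℝ); P] ≤ varianceConst d A b * s ^ 2 := by
  have hL := hp.memLp_summand hA hb hs hX hind hid
  have hLsum := hp.memLp (measurable_latticeSum hX) hA hb hs
  have hn : (1 : ℝ) ≤ n := by exact_mod_cast i.pos
  have hcov := congrFun₂ (discreteCovMatrix_latticeSum hX hind hid hL i) j j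
  rw [Matrix.smul_apply, discreteCovMatrix_pmf (measurable_latticeSum hX) hLsum,
    discreteCovMatrix_pmf (hX i) (hL i), covariance_self (hLsum j).aemeasurable,
    covariance_self (hL i j).aemeasurable, smul_eq_mul] at hcov
  calc Var[fun ω => (X i ω j : ℝ); P] ≤ n * Var[fun ω => (X i ω j : ℝ); P] :=
        le_mul_of_one_le_left (variance_nonneg _ _) hn
    _ ≤ varianceConst d A b * s ^ 2 :=
        hcov ▸ hp.variance_le (measurable_latticeSum hX) hA hb hs j

theorem HasDecay.shannonEntropy_summand (hp : HasDecay A b s c (pmf P (latticeSum X)))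
    (hA : 0 < A) (hb : 0 < b) (hs : 1 ≤ s) (hX : ∀ i, Measurable (X i)) (hind : iIndepFun X P)
    (hid : ∀ i j, IdentDistrib (X i) (X j) P P) (i : Fin n) :
    HasShannonEntropy P (X i) ∧
      shannonEntropy P (X i) ≤ d * Real.log s + entropyConst d A b :=
  hasShannonEntropy_and_shannonEntropy_le (hX i) hs (hp.memLp_summand hA hb hs hX hind hid i)
    (hp.variance_summand_le hA hb hs hX hind hid i)

theorem HasDecay.one_le_shannonEntropy_summand (hp : HasDecay A b s c (pmf P (latticeSum X)))
    (hA : 0 < A) (hb : 0 < b) (hs : 1 ≤ s) (hd : 0 < d) (hAs : A * Real.exp 1 ^ n ≤ s)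
    (hX : ∀ i, Measurable (X i)) (hind : iIndepFun X P)
    (hid : ∀ i j, IdentDistrib (X i) (X j) P P) (i : Fin n) : 1 ≤ shannonEntropy P (X i) := by
  have hsum : ∀ k, pmf P (latticeSum X) k ≤ Real.exp (-1) ^ n := fun k => by
    have : 0 < s := by linarith
    refine (hp.le hA hb this k).trans ?_
    rw [Real.exp_neg, inv_pow, ← one_div, div_le_div_iff₀ (by positivity) (by positivity),
      one_mul]
    exact hAs.trans (le_self_pow₀ hs hd.ne')
  exact one_le_shannonEntropy (hX i) (hp.shannonEntropy_summand hA hb hs hX hind hid i).1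
    (pmf_le_of_pmf_latticeSum_le_pow hX hind hid (Real.exp_pos _).le hsum i)

theorem HasDecay.inv_le_shannonEntropy_mul_exp (hp : HasDecay A b s c (pmf P (latticeSum X)))
    (hA : 0 < A) (hb : 0 < b) (hs : 1 ≤ s) (hd : 0 < d) (hAs : A * Real.exp 1 ^ n ≤ s)
    (hX : ∀ i, Measurable (X i)) (hind : iIndepFun X P)
    (hid : ∀ i j, IdentDistrib (X i) (X j) P P) (i : Fin n) :
    1 / s ≤
      rateConst d A b * (shannonEntropy P (X i) * Real.exp (-shannonEntropy P (X i) / d)) := by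
  have hH := (hp.shannonEntropy_summand hA hb hs hX hind hid i).2
  have hH1 := hp.one_le_shannonEntropy_summand hA hb hs hd hAs hX hind hid i
  have hs0 : 0 < s := by linarith
  set H := shannonEntropy P (X i)
  calc 1 / s = Real.exp (-Real.log s) := by rw [Real.exp_neg, Real.exp_log hs0, one_div]
    _ ≤ Real.exp (entropyConst d A b / d + -H / d) := by
        gcongr
        rw [← add_div, le_div_iff₀ (by positivity)]
        linarith
    _ = Real.exp (entropyConst d A b / d) * (1 * Real.exp (-H / d)) := by
        rw [Real.exp_add, one_mul]
    _ ≤ rateConst d A b * (H * Real.exp (-H / d)) := by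
        have := (rateConst_pos d A b).le
        gcongr
        exact le_max_left (Real.exp _) _

theorem posSemidef_discreteCovMatrix_pmf {Y : Ω → Fin d → ℤ} (hY : Measurable Y)
    (hL : ∀ j, MemLp (fun ω => (Y ω j : ℝ)) 2 P) : (discreteCovMatrix (pmf P Y)).PosSemidef := by
  refine PosSemidef.of_dotProduct_mulVec_nonneg ?_ fun θ => ?_
  · ext i j
    rw [conjTranspose_apply, star_trivial, discreteCovMatrix_pmf hY hL,
      discreteCovMatrix_pmf hY hL, covariance_comm]
  · rw [star_trivial, ← variance_dotProduct_castVec hL hY]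
    exact variance_nonneg _ _

theorem HasDecay.le_scale_summand (hp : HasDecay A b s c (pmf P (latticeSum X))) (hA : 0 < A)
    (hb : 0 < b) (hs : 1 ≤ s) (hd : 0 < d) (hspread : 1 ≤ spreadConst d A b * s)
    (hX : ∀ i, Measurable (X i)) (hind : iIndepFun X P)
    (hid : ∀ i j, IdentDistrib (X i) (X j) P P) (i : Fin n) :
    spreadConst d A b / (2 * n * d) * s ≤ scale (discreteCovMatrix (pmf P (X i))) := by
  have hL := hp.memLp_summand hA hb hs hX hind hid
  have hn : (1 : ℝ) ≤ n := by exact_mod_cast i.pos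
  have hd1 : (1 : ℝ) ≤ d := by exact_mod_cast hd
  have := spreadConst_pos d hA hb
  have hlower : ∀ θ, (spreadConst d A b / (2 * n * d) * s) ^ 2 * (θ ⬝ᵥ θ) ≤
      θ ⬝ᵥ discreteCovMatrix (pmf P (X i)) *ᵥ θ := fun θ => by
    have hsum := hp.le_dotProduct_discreteCovMatrix (measurable_latticeSum hX) hA hb hs hspread θ
    rw [discreteCovMatrix_latticeSum hX hind hid hL i, smul_mulVec, dotProduct_smul,
      smul_eq_mul, ← div_le_iff₀' (by positivity)] at hsum
    refine le_trans ?_ hsum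
    have hθ : 0 ≤ θ ⬝ᵥ θ := Finset.sum_nonneg fun i _ => mul_self_nonneg _
    calc (spreadConst d A b / (2 * n * d) * s) ^ 2 * (θ ⬝ᵥ θ)
        = spreadConst d A b ^ 2 / (2 * d) * s ^ 2 * (θ ⬝ᵥ θ) / n * (1 / (2 * n * d)) := by
          field_simp
      _ ≤ spreadConst d A b ^ 2 / (2 * d) * s ^ 2 * (θ ⬝ᵥ θ) / n :=
          mul_le_of_le_one_right (by positivity)
            ((div_le_one (by positivity)).2 (by nlinarith))
  refine le_scale_of_pow_le_det hd (by positivity) ?_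
  simpa using pow_card_le_det (posSemidef_discreteCovMatrix_pmf (hX i) (hL i)).1
    (sq_nonneg _) hlower

theorem HasDecay.scale_summand_le (hp : HasDecay A b s c (pmf P (latticeSum X))) (hA : 0 < A)
    (hb : 0 < b) (hs : 1 ≤ s) (hd : 0 < d) (hX : ∀ i, Measurable (X i)) (hind : iIndepFun X P)
    (hid : ∀ i j, IdentDistrib (X i) (X j) P P) (i : Fin n) :
    scale (discreteCovMatrix (pmf P (X i))) ≤ (d * varianceConst d A b + 1) * s := by
  have hL := hp.memLp_summand hA hb hs hX hind hid i
  have hpsd := posSemidef_discreteCovMatrix_pmf (hX i) hL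
  have hV : 0 ≤ d * varianceConst d A b :=
    mul_nonneg d.cast_nonneg (varianceConst_pos d hA hb).le
  have hdet := det_le_pow_card hpsd fun j => by
    rw [discreteCovMatrix_pmf (hX i) hL, covariance_self (hL j).aemeasurable]
    exact hp.variance_summand_le hA hb hs hX hind hid i j
  rw [Fintype.card_fin] at hdet
  refine scale_le_of_det_le_pow hd (by positivity) hpsd.det_nonneg (hdet.trans ?_)
  rw [← mul_assoc, mul_pow (_ + 1)]
  gcongr
  nlinarith

theorem HasDecay.inv_le_log_scale_div (hp : HasDecay A b s c (pmf P (latticeSum X)))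
    (hA : 0 < A) (hb : 0 < b) (hs : 1 ≤ s) (hd : 0 < d) (hspread : 1 ≤ spreadConst d A b * s)
    (hscale : 3 ≤ spreadConst d A b / (2 * n * d) * s)
    (hX : ∀ i, Measurable (X i)) (hind : iIndepFun X P)
    (hid : ∀ i j, IdentDistrib (X i) (X j) P P) (i : Fin n) :
    1 / s ≤ rateConst d A b * (Real.log (scale (discreteCovMatrix (pmf P (X i)))) /
      scale (discreteCovMatrix (pmf P (X i)))) := by
  have hlower := hscale.trans (hp.le_scale_summand hA hb hs hd hspread hX hind hid i)
  have hupper := hp.scale_summand_le hA hb hs hd hX hind hid i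
  set σ := scale (discreteCovMatrix (pmf P (X i)))
  have hσ : 0 < σ := by linarith
  have hlog : 1 ≤ Real.log σ := by
    rw [Real.le_log_iff_exp_le hσ]
    linarith [Real.exp_one_lt_d9]
  rw [← mul_div_assoc, div_le_div_iff₀ (by linarith) hσ, one_mul]
  calc σ ≤ (d * varianceConst d A b + 1) * s := hupper
    _ ≤ rateConst d A b * s := by
        gcongr
        exact le_max_right (Real.exp _) _
    _ ≤ rateConst d A b * Real.log σ * s := by
        gcongr
        exact le_mul_of_one_le_right (rateConst_pos d A b).le hlog

end Rates

end DiscreteEntropy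

open DiscreteEntropy in
theorem mainTheorem2_general (d n : ℕ) (hd : 0 < d) (hn : 0 < n) (Λ : ℝ) :
    ∃ C : ℝ, 0 < C ∧ ∃ N : ℝ,
      ∀ (Ω : Type*) [MeasurableSpace Ω] (P : Measure Ω) [IsProbabilityMeasure P]
        (X : Fin n → Ω → Fin d → ℤ) (U : Fin n → Ω → Fin d → ℝ) (f : (Fin d → ℝ) → ℝ) (s : ℝ),
        (∀ i, Measurable (X i)) → (∀ i, Measurable (U i)) →
        iIndepFun X P → (∀ i j, IdentDistrib (X i) (X j) P P) →
        iIndepFun U P → (∀ i, pdf.IsUniform (U i) (Set.Icc 0 1) P volume) →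
        IndepFun (fun ω i => X i ω) (fun ω i => U i ω) P →
        IsLogConcaveExtension (pmf P (latticeSum X)) f →
        IsRoughlyIsotropic Λ s f → N ≤ s →
        HasShannonEntropy P (X ⟨0, hn⟩) ∧ HasShannonEntropy P (latticeSum X) ∧
        HasDifferentialEntropy P (smoothedSum X U) ∧
        |differentialEntropy P (smoothedSum X U) - shannonEntropy P (latticeSum X)| ≤
          C * (shannonEntropy P (X ⟨0, hn⟩) * Real.exp (-shannonEntropy P (X ⟨0, hn⟩) / d)) ∧
        |differentialEntropy P (smoothedSum X U) - shannonEntropy P (latticeSum X)| ≤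
          C * (Real.log (scale (discreteCovMatrix (pmf P (X ⟨0, hn⟩)))) /
            scale (discreteCovMatrix (pmf P (X ⟨0, hn⟩)))) := by
  obtain ⟨A, b, s₀, hA, hb, hdecay⟩ := exists_hasDecay_of_isRoughlyIsotropic hd Λ
  have hG := gapConst_pos hd hn hA hb
  have hδ := spreadConst_pos d hA hb
  have hl : 0 < spreadConst d A b / (2 * n * d) := by positivity
  refine ⟨gapConst d n A b * rateConst d A b, mul_pos hG (rateConst_pos d A b),
    max s₀ (max 1 (max (1 / spreadConst d A b)
      (max (3 / (spreadConst d A b / (2 * n * d))) (A * Real.exp 1 ^ n)))), ?_⟩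
  intro Ω _ P _ X U f s hX hU hind hid hUi hUu hXU hf hiso hN
  simp only [max_le_iff, div_le_iff₀' hδ, div_le_iff₀' hl] at hN
  obtain ⟨hs₀, hs, hspread, hscale, hAs⟩ := hN
  obtain ⟨c, hp⟩ := hdecay _ f s (hasSum_pmf (measurable_latticeSum hX)) hf hiso hs₀
  obtain ⟨hdiff, hgap⟩ := hp.differentialEntropy_smoothedSum hA hb hs hn hX hU hUi hUu hXU hf
  have hrate : ∀ {r : ℝ}, 1 / s ≤ rateConst d A b * r →
      |differentialEntropy P (smoothedSum X U) - shannonEntropy P (latticeSum X)| ≤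
        gapConst d n A b * rateConst d A b * r := fun hr =>
    hgap.trans ((mul_le_mul_of_nonneg_left hr hG.le).trans_eq (mul_assoc _ _ _).symm)
  exact ⟨(hp.shannonEntropy_summand hA hb hs hX hind hid _).1,
    hp.hasShannonEntropy hA hb hs (measurable_latticeSum hX), hdiff,
    hrate (hp.inv_le_shannonEntropy_mul_exp hA hb hs hd hAs hX hind hid _),
    hrate (hp.inv_le_log_scale_div hA hb hs hd hspread hscale hX hind hid _)⟩

open DiscreteEntropy in
theorem mainTheorem2 (d n : ℕ) (hd : 0 < d) (hn : 0 < n) :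
    ∃ C : ℝ, 0 < C ∧ ∀ K : ℝ, ∃ N : ℝ,
      ∀ (Ω : Type*) [MeasurableSpace Ω] (P : Measure Ω) [IsProbabilityMeasure P]
        (X : Fin n → Ω → Fin d → ℤ) (U : Fin n → Ω → Fin d → ℝ) (f : (Fin d → ℝ) → ℝ),
        (∀ i, Measurable (X i)) → (∀ i, Measurable (U i)) →
        -- `X₁, …, Xₙ` are i.i.d.
        iIndepFun X P → (∀ i j, IdentDistrib (X i) (X j) P P) →
        -- `U₁, …, Uₙ` are i.i.d. uniform on `[0,1]^d`, and independent of `X₁, …, Xₙ`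
        iIndepFun U P → (∀ i, pdf.IsUniform (U i) (Set.Icc 0 1) P volume) →
        IndepFun (fun ω i => X i ω) (fun ω i => U i ω) P →
        -- `f` is an almost isotropic log-concave extension of the p.m.f. of `X₁ + ⋯ + Xₙ`
        IsLogConcaveExtension (pmf P (latticeSum X)) f →
        IsAlmostIsotropic K f → N ≤ scale (covMatrix f) →
        -- all the entropies are well defined and finite
        HasShannonEntropy P (X ⟨0, hn⟩) ∧ HasShannonEntropy P (latticeSum X) ∧
        HasDifferentialEntropy P (smoothedSum X U) ∧
        -- the rate in terms of `H(X₁)`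
        |differentialEntropy P (smoothedSum X U) - shannonEntropy P (latticeSum X)| ≤
          C * (shannonEntropy P (X ⟨0, hn⟩) * Real.exp (-shannonEntropy P (X ⟨0, hn⟩) / d)) ∧
        -- the rate `log σ / σ` in terms of `σ = det(Cov(X₁))^(1/(2d))`
        |differentialEntropy P (smoothedSum X U) - shannonEntropy P (latticeSum X)| ≤
          C * (Real.log (scale (discreteCovMatrix (pmf P (X ⟨0, hn⟩)))) /
            scale (discreteCovMatrix (pmf P (X ⟨0, hn⟩)))) := by
  obtain ⟨C, hC, N, hgeneral⟩ := mainTheorem2_general d n hd hn 6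
  refine ⟨C, hC, fun K => ⟨max 1 (max (2 * d * K) (2 * N)), ?_⟩⟩
  intro Ω _ P _ X U f hX hU hind hid hUi hUu hXU hf hK hN
  obtain ⟨h_one, h_isotropic, h_threshold⟩ := by simpa only [max_le_iff] using hN
  exact hgeneral Ω P X U f (scale (covMatrix f) / 2) hX hU hind hid hUi hUu hXU hf
    (hK.isRoughlyIsotropic hd (one_pos.trans_le h_one) h_isotropic) (by linarith)
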